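/- A radial weight is a nonnegative function $\omega\in L^1([0,1))$, extended to the unit disc $\mathbb{D}$ by $\omega(z)=\omega(|z|)$, such that $\widehat{\omega}(r)=\int_r^1\omega(s)\,ds>0$ for all $0\le r<1$; we write $\widehat{\omega}(z)=\widehat{\omega}(|z|)$ and $\omega_x=\int_0^1 s^x\omega(s)\,ds$ for $x\ge 0$, and use the same notation for $\omega/\widehat{\nu}$. A radial weight $\omega$ belongs to $\widehat{\mathcal{D}}$ if there is $C>0$ with $\widehat{\omega}(r)\le C\,\widehat{\omega}\left(\frac{1+r}{2}\right)$ for all $r$ sufficiently close to $1$; it belongs to $\widecheck{\mathcal{D}}$ if there are $K>1$ and $C>1$ with $\widehat{\omega}(r)\ge C\,\widehat{\omega}\left(1-\frac{1-r}{K}\right)$ for all $r$ sufficiently close to $1$; and $\mathcal{D}=\widehat{\mathcal{D}}\cap\widecheck{\mathcal{D}}$. Let $dA=\frac{dx\,dy}{\pi}$ and let $$B^\omega_z(\zeta)=\sum_{n=0}^\infty\frac{(\overline{z}\zeta)^n}{2\omega_{2n+1}}$$ be the reproducing kernel of the weighted Bergman space $A^2_\omega$ of analytic functions $f$ on $\mathbb{D}$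 with $\int_{\mathbb{D}}|f|^2\omega\,dA<\infty$. The Bergman projection is $$P_\omega(f)(z)=\int_{\mathbb{D}}f(\zeta)\overline{B^\omega_z(\zeta)}\,\omega(\zeta)\,dA(\zeta),\qquad z\in\mathbb{D}.$$ For a radial weight $\nu$, let $L^\infty_{\widehat{\nu}}$ be the space of measurable $f:\mathbb{D}\to\mathbb{C}$ with $\|f\|_{\infty,\widehat{\nu}}=\operatorname{ess\,sup}_{z\in\mathbb{D}}|f(z)|\widehat{\nu}(z)<\infty$, and let $H^\infty_{\widehat{\nu}}$ be its subspace of analytic functions. We say that $P_\omega:L^\infty_{\widehat{\nu}}\to H^\infty_{\widehat{\nu}}$ is bounded if, for some $C\ge 0$ and every $f\in L^\infty_{\widehat{\nu}}$, the integral defining $P_\omega(f)(z)$ converges absolutely for every $z\in\mathbb{D}$, $P_\omega(f)\in H^\infty_{\widehat{\nu}}$ and $\|P_\omega(f)\|_{\infty,\widehat{\nu}}\le C\|f\|_{\infty,\widehat{\nu}}$. **Theorem.** Let $\nu$ be a radial weight and $\omega\in\widehat{\mathcal{D}}$. Then the following conditions are equivalent: (i) $P_\omega:L^\infty_{\widehat{\nu}}\to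 H^\infty_{\widehat{\nu}}$ is bounded; (ii) $\nu\in\widecheck{\mathcal{D}}$ and $$\sup_{x\ge 0}\frac{\nu_x}{\omega_{2x}}\left(\frac{\omega}{\widehat{\nu}}\right)_x<\infty;$$ (iii) $\nu\in\widecheck{\mathcal{D}}$ and $$\sup_{0\le r<1}\frac{\widehat{\nu}(r)}{\widehat{\omega}(r)}\int_r^1\frac{\omega(s)}{\widehat{\nu}(s)}\,ds<\infty;$$ (iv) $\frac{\omega}{\widehat{\nu}}\in\mathcal{D}$ (in particular $\frac{\omega}{\widehat{\nu}}$ is a radial weight) and $\nu\in\mathcal{D}$. -/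

import Mathlib

open MeasureTheory Set Filter Topology
open scoped ENNReal NNReal ComplexConjugate

noncomputable section

/-- The tail integral `r ↦ ∫_r^1 ω(s) ds`. -/
def tail (ω : ℝ → ℝ) (r : ℝ) : ℝ := ∫ s in r..1, ω s

/-- The moment `ω_x = ∫_0^1 s^x ω(s) ds`. -/
def moment (ω : ℝ → ℝ) (x : ℝ) : ℝ := ∫ s in (0 : ℝ)..1, s ^ x * ω s

/-- A radial weight is given by its profile `ω` on `[0, 1)`: nonnegative, integrable, with positive
tail integrals. The weight on the unit disc is `z ↦ ω ‖z‖`. The values of `ω` outside `[0, 1)`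
play no role. -/
structure IsRadialWeight (ω : ℝ → ℝ) : Prop where
  nonneg : ∀ r ∈ Ico (0 : ℝ) 1, 0 ≤ ω r
  integrableOn : IntegrableOn ω (Ico 0 1)
  tail_pos : ∀ r ∈ Ico (0 : ℝ) 1, 0 < tail ω r

/-- The class of upper doubling radial weights. -/
def UpperDoubling (ω : ℝ → ℝ) : Prop :=
  IsRadialWeight ω ∧ ∃ C : ℝ, 0 < C ∧ ∀ᶠ r in 𝓝[<] (1 : ℝ), tail ω r ≤ C * tail ω ((1 + r) / 2)

/-- The class of lower doubling radial weights. -/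
def LowerDoubling (ω : ℝ → ℝ) : Prop :=
  IsRadialWeight ω ∧ ∃ K : ℝ, 1 < K ∧ ∃ C : ℝ, 1 < C ∧
    ∀ᶠ r in 𝓝[<] (1 : ℝ), C * tail ω (1 - (1 - r) / K) ≤ tail ω r

/-- The class of doubling radial weights. -/
def Doubling (ω : ℝ → ℝ) : Prop := UpperDoubling ω ∧ LowerDoubling ω

/-- The function `ω / ν̂` on `[0, 1)`. -/
def divTail (ω ν : ℝ → ℝ) (s : ℝ) : ℝ := ω s / tail ν s

/-- The normalized area measure `dA = dx dy / π` on the unit disc. -/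
def diskMeasure : Measure ℂ :=
  ENNReal.ofReal (1 / Real.pi) • volume.restrict (Metric.ball (0 : ℂ) 1)

/-- The Bergman space `A²_ω`, as a set of functions (only their values on the disc matter). -/
def bergmanSpace (ω : ℝ → ℝ) : Set (ℂ → ℂ) :=
  {f | DifferentiableOn ℂ f (Metric.ball 0 1) ∧
    Integrable (fun z => ‖f z‖ ^ 2 * ω ‖z‖) diskMeasure}

/-- The Bergman kernel `B^ω_z(ζ) = ∑ (z̄ ζ)^n / (2 ω_{2n+1})`, the reproducing kernel of `A²_ω`
(see `bergmanKernel_reproducing` below). -/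
def bergmanKernel (ω : ℝ → ℝ) (z ζ : ℂ) : ℂ :=
  ∑' n : ℕ, (conj z * ζ) ^ n / ((2 * moment ω (2 * n + 1) : ℝ) : ℂ)

/-- The Bergman projection `P_ω f(z) = ∫ f(ζ) conj(B^ω_z(ζ)) ω(ζ) dA(ζ)`. -/
def bergmanProj (ω : ℝ → ℝ) (f : ℂ → ℂ) (z : ℂ) : ℂ :=
  ∫ ζ, f ζ * conj (bergmanKernel ω z ζ) * (ω ‖ζ‖ : ℂ) ∂diskMeasure

/-- The weighted norm `ess sup_{z ∈ 𝔻} |f(z)| v(|z|)`, possibly infinite. -/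
def growthNorm (v : ℝ → ℝ) (f : ℂ → ℂ) : ℝ≥0∞ :=
  eLpNorm (fun z => f z * (v ‖z‖ : ℂ)) ∞ diskMeasure

/-- The growth space `L^∞_v`. -/
def growthSpace (v : ℝ → ℝ) : Set (ℂ → ℂ) :=
  {f | AEStronglyMeasurable f diskMeasure ∧ growthNorm v f < ∞}

/-- The space `H^∞_v` of analytic functions in `L^∞_v`. -/
def analyticGrowthSpace (v : ℝ → ℝ) : Set (ℂ → ℂ) :=
  {f | f ∈ growthSpace v ∧ DifferentiableOn ℂ f (Metric.ball 0 1)}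

/-- `P_ω : L^∞_v → H^∞_v` is bounded: on every `f ∈ L^∞_v` the integral defining `P_ω f(z)` exists
for all `z` in the disc, `P_ω f` belongs to `H^∞_v`, and the operator norm is finite. -/
def BergmanProjBounded (ω v : ℝ → ℝ) : Prop :=
  ∃ C : ℝ≥0, ∀ f ∈ growthSpace v,
    (∀ z ∈ Metric.ball (0 : ℂ) 1,
      Integrable (fun ζ => f ζ * conj (bergmanKernel ω z ζ) * (ω ‖ζ‖ : ℂ)) diskMeasure) ∧
    bergmanProj ω f ∈ analyticGrowthSpace v ∧
    growthNorm v (bergmanProj ω f) ≤ C * growthNorm v f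

/-- `sup_{x ≥ 0} (ν_x / ω_{2x}) (ω/ν̂)_x < ∞`. The finiteness of `(ω/ν̂)_0` (implied by that of the
supremum, at `x = 0`) is recorded as integrability of `ω/ν̂`. -/
def MomentCondition (ω ν : ℝ → ℝ) : Prop :=
  IntegrableOn (divTail ω ν) (Ico 0 1) ∧
  ∃ C : ℝ, ∀ x : ℝ, 0 ≤ x → moment ν x / moment ω (2 * x) * moment (divTail ω ν) x ≤ C

/-- `sup_{0 ≤ r < 1} (ν̂(r) / ω̂(r)) ∫_r^1 ω(s)/ν̂(s) ds < ∞`. The finiteness of the integral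
(implied by that of the supremum, at `r = 0`) is recorded as integrability of `ω/ν̂`. -/
def TailCondition (ω ν : ℝ → ℝ) : Prop :=
  IntegrableOn (divTail ω ν) (Ico 0 1) ∧
  ∃ C : ℝ, ∀ r ∈ Ico (0 : ℝ) 1, tail ν r / tail ω r * (∫ s in r..1, divTail ω ν s) ≤ C

theorem integral_polar {H : ℂ → ℂ} (hH : Integrable H) :
    ∫ z, H z = ∫ r in Ioi (0 : ℝ), ∫ θ in Ioo (-Real.pi) Real.pi,
      (r : ℂ) * H (Complex.polarCoord.symm (r, θ)) := by
  rw [← Complex.integral_comp_polarCoord_symm]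
  have h1 : Integrable (fun p => H (Complex.measurableEquivRealProd.symm p)) :=
    (Complex.volume_preserving_equiv_real_prod.symm.integrable_comp_emb
      Complex.measurableEquivRealProd.symm.measurableEmbedding).2 hH
  have h2 : IntegrableOn (fun p => H (Complex.measurableEquivRealProd.symm p))
      (polarCoord.symm '' polarCoord.target) := h1.integrableOn
  rw [integrableOn_image_iff_integrableOn_abs_det_fderiv_smul volume
    polarCoord.open_target.measurableSet
    (fun p _ => (hasFDerivAt_polarCoord_symm p).hasFDerivWithinAt) polarCoord.symm.injOn] at h2
  have h3 : IntegrableOn (fun p : ℝ × ℝ => p.1 • H (Complex.polarCoord.symm p))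
      (Ioi (0 : ℝ) ×ˢ Ioo (-Real.pi) Real.pi) := by
    refine h2.congr_fun (fun p hp => ?_) polarCoord.open_target.measurableSet
    have : 0 < p.1 := hp.1
    simp only [det_fderivPolarCoordSymm, abs_of_pos this]
    rfl
  rw [show polarCoord.target = Ioi (0 : ℝ) ×ˢ Ioo (-Real.pi) Real.pi from rfl,
    Measure.volume_eq_prod, setIntegral_prod _ (by rwa [← Measure.volume_eq_prod])]
  simp only [Complex.real_smul]

theorem exists_coeff {f : ℂ → ℂ} (hf : DifferentiableOn ℂ f (Metric.ball 0 1)) :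
    ∃ a : ℕ → ℂ, (∀ z ∈ Metric.ball (0 : ℂ) 1, HasSum (fun n => a n * z ^ n) (f z)) ∧
      ∀ r ∈ Ioo (0 : ℝ) 1, ∀ n : ℕ,
        ∫ θ in Ioo (-Real.pi) Real.pi, f (Complex.polarCoord.symm (r, θ)) *
          conj (Complex.polarCoord.symm (r, θ)) ^ n = 2 * Real.pi * r ^ (2 * n) * a n := by
  have key : ∀ r ∈ Ioo (0 : ℝ) 1, HasFPowerSeriesOnBall f (cauchyPowerSeries f 0 r) 0
      r.toNNReal := by
    intro r hr
    have h0 : ((r.toNNReal : ℝ≥0) : ℝ) = r := Real.coe_toNNReal _ hr.1.le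
    have := DifferentiableOn.hasFPowerSeriesOnBall (c := 0) (f := f)
      (R := r.toNNReal) (by rw [h0]; exact hf.mono (Metric.closedBall_subset_ball hr.2))
      (by simpa using hr.1)
    rwa [h0] at this
  have hhalf : (1 / 2 : ℝ) ∈ Ioo (0 : ℝ) 1 := by norm_num
  have heq : ∀ r ∈ Ioo (0 : ℝ) 1,
      cauchyPowerSeries f 0 r = cauchyPowerSeries f 0 (1 / 2) := fun r hr =>
    (key r hr).hasFPowerSeriesAt.eq_formalMultilinearSeries (key _ hhalf).hasFPowerSeriesAt
  refine ⟨fun n => (cauchyPowerSeries f 0 (1 / 2)).coeff n, fun z hz => ?_, fun r hr n => ?_⟩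
  · obtain ⟨r, hr1, hr2⟩ := exists_between (show ‖z‖ < 1 by simpa using hz)
    have hr : r ∈ Ioo (0 : ℝ) 1 := ⟨(norm_nonneg z).trans_lt hr1, hr2⟩
    have h1 := (key r hr).hasSum (y := z) (by
      rw [Metric.mem_eball, edist_zero_right, ← ofReal_norm]
      exact (ENNReal.ofReal_lt_ofReal_iff hr.1).2 hr1)
    rw [heq r hr, zero_add] at h1
    simpa [FormalMultilinearSeries.apply_eq_pow_smul_coeff, mul_comm] using h1
  · have hr0 : (r : ℂ) ≠ 0 := by exact_mod_cast hr.1.ne'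
    have hpi : (Real.pi : ℂ) ≠ 0 := by exact_mod_cast Real.pi_ne_zero
    have hsymm : ∀ θ : ℝ, Complex.polarCoord.symm (r, θ) = circleMap 0 r θ := by
      intro θ
      simp [circleMap, Complex.exp_mul_I]
    have hper : Function.Periodic (fun θ => f (circleMap 0 r θ) * conj (circleMap 0 r θ) ^ n)
        (2 * Real.pi) := fun θ => by
      simp only [periodic_circleMap 0 r θ]
    have hc : (cauchyPowerSeries f 0 (1 / 2)).coeff n =
        (2 * Real.pi * Complex.I)⁻¹ * ∮ w in C(0, r), (1 / w) ^ n * (w⁻¹ * f w) := by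
      rw [← heq r hr, FormalMultilinearSeries.coeff]
      have := cauchyPowerSeries_apply f 0 r n 1
      simpa using this
    have hcirc : ∮ w in C(0, r), (1 / w) ^ n * (w⁻¹ * f w) =
        Complex.I * ((r : ℂ) ^ (2 * n))⁻¹ *
          ∫ θ in (0 : ℝ)..2 * Real.pi, f (circleMap 0 r θ) * conj (circleMap 0 r θ) ^ n := by
      rw [circleIntegral, ← intervalIntegral.integral_const_mul]
      refine intervalIntegral.integral_congr fun θ _ => ?_
      have hw : circleMap 0 r θ ≠ 0 := circleMap_ne_center hr.1.ne'
      have hn : circleMap 0 r θ * conj (circleMap 0 r θ) = (r : ℂ) ^ 2 := by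
        rw [Complex.mul_conj, Complex.normSq_eq_norm_sq, norm_circleMap_zero]
        push_cast
        rw [← Complex.ofReal_pow, sq_abs, Complex.ofReal_pow]
      have hn2 : conj (circleMap 0 r θ) = (r : ℂ) ^ 2 / circleMap 0 r θ := by
        rw [← hn]; field_simp
      simp only [deriv_circleMap, smul_eq_mul, hn2]
      rw [pow_mul, div_pow, div_pow, one_pow]
      field_simp
    simp only [hsymm]
    rw [← integral_Ioc_eq_integral_Ioo, ← intervalIntegral.integral_of_le (by linarith [Real.pi_pos])]
    have := hper.intervalIntegral_add_eq (-Real.pi) 0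
    rw [show -Real.pi + 2 * Real.pi = Real.pi by ring, zero_add] at this
    rw [this, hc, hcirc]
    field_simp

theorem IsRadialWeight.integrableOn_disk {ω : ℝ → ℝ} (h : IsRadialWeight ω) :
    IntegrableOn (fun z : ℂ => ω ‖z‖) (Metric.ball 0 1) := by
  rw [integrableOn_fun_norm_addHaar]
  have h1 : IntegrableOn ω (Ioo 0 1) := h.integrableOn.mono_set Ioo_subset_Ico_self
  simp only [Complex.finrank_real_complex, smul_eq_mul]
  refine h1.bdd_mul (c := 1) (by fun_prop) ?_
  refine (ae_restrict_iff' measurableSet_Ioo).2 (.of_forall fun r hr => ?_)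
  simp [abs_of_pos hr.1, hr.2.le]

theorem IsRadialWeight.pow_mul_tail_le {ω : ℝ → ℝ} (h : IsRadialWeight ω) {ρ : ℝ}
    (hρ : ρ ∈ Ioo (0 : ℝ) 1) (n : ℕ) : ρ ^ n * tail ω ρ ≤ ∫ s in Ioo (0 : ℝ) 1, s ^ n * ω s := by
  have h1 : IntegrableOn ω (Ioo 0 1) := h.integrableOn.mono_set Ioo_subset_Ico_self
  have h2 : IntegrableOn (fun s => s ^ n * ω s) (Ioo 0 1) := by
    refine h1.bdd_mul (c := 1) (by fun_prop) ?_
    refine (ae_restrict_iff' measurableSet_Ioo).2 (.of_forall fun r hr => ?_)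
    simpa [abs_of_pos hr.1] using pow_le_one₀ hr.1.le hr.2.le
  have hsub : Ioo ρ 1 ⊆ Ioo 0 1 := Ioo_subset_Ioo_left hρ.1.le
  rw [tail, intervalIntegral.integral_of_le hρ.2.le, integral_Ioc_eq_integral_Ioo,
    ← integral_const_mul]
  calc ∫ s in Ioo ρ 1, ρ ^ n * ω s ≤ ∫ s in Ioo ρ 1, s ^ n * ω s := by
        refine setIntegral_mono_on ((h1.mono_set hsub).const_mul _) (h2.mono_set hsub)
          measurableSet_Ioo fun s hs => ?_
        exact mul_le_mul_of_nonneg_right (pow_le_pow_left₀ hρ.1.le hs.1.le n)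
          (h.nonneg s ⟨(hsub hs).1.le, hs.2⟩)
    _ ≤ _ := by
        refine setIntegral_mono_set h2 ?_ hsub.eventuallyLE
        refine (ae_restrict_iff' measurableSet_Ioo).2 (.of_forall fun s hs => ?_)
        exact mul_nonneg (pow_nonneg hs.1.le n) (h.nonneg s ⟨hs.1.le, hs.2⟩)

theorem moment_natCast (ω : ℝ → ℝ) (n : ℕ) :
    moment ω (2 * n + 1) = ∫ s in Ioo (0 : ℝ) 1, s ^ (2 * n + 1) * ω s := by
  rw [moment, intervalIntegral.integral_of_le zero_le_one, integral_Ioc_eq_integral_Ioo]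
  refine setIntegral_congr_fun measurableSet_Ioo fun s _ => ?_
  rw [← Real.rpow_natCast]
  push_cast
  rfl

theorem IsRadialWeight.moment_pos {ω : ℝ → ℝ} (h : IsRadialWeight ω) (n : ℕ) :
    0 < moment ω (2 * n + 1) := by
  rw [moment_natCast]
  refine lt_of_lt_of_le ?_ (h.pow_mul_tail_le (ρ := 1 / 2) (by norm_num) _)
  have := h.tail_pos (1 / 2) (by norm_num)
  positivity

theorem IsRadialWeight.summable {ω : ℝ → ℝ} (h : IsRadialWeight ω) {t : ℝ} (h0 : 0 ≤ t)
    (h1 : t < 1) : Summable fun n : ℕ => t ^ n / (2 * moment ω (2 * n + 1)) := by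
  obtain ⟨ρ, hρ1, hρ2⟩ := exists_between ((Real.sqrt_lt' one_pos).2 (by simpa using h1))
  have hρ0 : 0 < ρ := (Real.sqrt_nonneg t).trans_lt hρ1
  have hlt : t < ρ ^ 2 := (Real.sqrt_lt' hρ0).1 hρ1
  have hT := h.tail_pos ρ ⟨hρ0.le, hρ2⟩
  have hq : t / ρ ^ 2 < 1 := (div_lt_one (by positivity)).2 hlt
  refine Summable.of_nonneg_of_le (fun n => ?_) (fun n => ?_)
    ((summable_geometric_of_lt_one (by positivity) hq).mul_left (1 / (2 * ρ * tail ω ρ)))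
  · have := h.moment_pos n
    positivity
  · have h3 := h.pow_mul_tail_le (ρ := ρ) ⟨hρ0, hρ2⟩ (2 * n + 1)
    rw [← moment_natCast] at h3
    calc _ ≤ t ^ n / (2 * (ρ ^ (2 * n + 1) * tail ω ρ)) := by gcongr
      _ = _ := by rw [div_pow, pow_succ, pow_mul]; field_simp

theorem norm_kernelTerm_le {ω : ℝ → ℝ} (h : IsRadialWeight ω) {z ζ : ℂ}
    (hζ : ζ ∈ Metric.ball (0 : ℂ) 1) (n : ℕ) :
    ‖(conj z * ζ) ^ n / ((2 * moment ω (2 * n + 1) : ℝ) : ℂ)‖ ≤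
      ‖z‖ ^ n / (2 * moment ω (2 * n + 1)) := by
  have hm := h.moment_pos n
  have hζ' : ‖ζ‖ < 1 := by simpa using hζ
  rw [norm_div, norm_pow, norm_mul, RCLike.norm_conj, Complex.norm_real, Real.norm_eq_abs,
    abs_of_pos (by positivity)]
  gcongr
  exact mul_le_of_le_one_right (norm_nonneg _) hζ'.le

/-- For `z` in the disc, `B^ω_z` belongs to `A²_ω` and has the reproducing property there. -/
theorem bergmanKernel_reproducing {ω : ℝ → ℝ} (h : IsRadialWeight ω) {z : ℂ}
    (hz : z ∈ Metric.ball (0 : ℂ) 1) :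
    bergmanKernel ω z ∈ bergmanSpace ω ∧ ∀ f ∈ bergmanSpace ω, bergmanProj ω f z = f z := by
  have hz' : ‖z‖ < 1 := by simpa using hz
  have hsum := h.summable (norm_nonneg z) hz'
  have hd : DifferentiableOn ℂ (bergmanKernel ω z) (Metric.ball 0 1) := by
    refine Complex.differentiableOn_tsum_of_summable_norm hsum (fun n => ?_) Metric.isOpen_ball
      fun n ζ hζ => norm_kernelTerm_le h hζ n
    fun_prop
  have hball : MeasurableSet (Metric.ball (0 : ℂ) 1) := measurableSet_ball
  have hω := h.integrableOn_disk
  refine ⟨⟨hd, ?_⟩, fun f hf => ?_⟩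
  · rw [diskMeasure]
    refine Integrable.smul_measure ?_ (by simp)
    refine hω.bdd_mul (c := (∑' n : ℕ, ‖z‖ ^ n / (2 * moment ω (2 * n + 1))) ^ 2)
      ((hd.continuousOn.norm.pow 2).aestronglyMeasurable hball) ?_
    refine (ae_restrict_iff' hball).2 (.of_forall fun ζ hζ => ?_)
    rw [norm_pow, norm_norm]
    gcongr
    exact tsum_of_norm_bounded hsum.hasSum fun n => norm_kernelTerm_le h hζ n
  obtain ⟨hfd, hf2⟩ := hf
  obtain ⟨a, ha, hint⟩ := exists_coeff hfd
  have hf2' : IntegrableOn (fun z => ‖f z‖ ^ 2 * ω ‖z‖) (Metric.ball 0 1) := by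
    rwa [diskMeasure, integrable_smul_measure (by simp [Real.pi_pos]) (by simp)] at hf2
  have hfω : IntegrableOn (fun ζ => f ζ * (ω ‖ζ‖ : ℂ)) (Metric.ball 0 1) := by
    refine (hf2'.add hω).mono' ((hfd.continuousOn.aestronglyMeasurable hball).mul
      (Complex.continuous_ofReal.comp_aestronglyMeasurable hω.1)) ?_
    refine (ae_restrict_iff' hball).2 (.of_forall fun ζ hζ => ?_)
    have h0 : 0 ≤ ω ‖ζ‖ := h.nonneg _ ⟨norm_nonneg _, by simpa using hζ⟩
    simp only [norm_mul, Complex.norm_real, Real.norm_eq_abs, abs_of_nonneg h0, Pi.add_apply]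
    nlinarith [mul_nonneg (sq_nonneg (‖f ζ‖ - 1)) h0, mul_nonneg (sq_nonneg (‖f ζ‖)) h0]
  have hmono : ∀ n : ℕ, IntegrableOn (fun ζ => conj ζ ^ n * (f ζ * (ω ‖ζ‖ : ℂ)))
      (Metric.ball 0 1) := by
    intro n
    refine hfω.bdd_mul (c := 1) (by fun_prop) ?_
    refine (ae_restrict_iff' hball).2 (.of_forall fun ζ hζ => ?_)
    have hζ' : ‖ζ‖ < 1 := by simpa using hζ
    simpa using pow_le_one₀ (norm_nonneg ζ) hζ'.le
  have hmonoint : ∀ n : ℕ, ∫ ζ in Metric.ball 0 1, conj ζ ^ n * (f ζ * (ω ‖ζ‖ : ℂ)) =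
      2 * Real.pi * moment ω (2 * n + 1) * a n := by
    intro n
    rw [← integral_indicator hball, integral_polar ((integrable_indicator_iff hball).2 (hmono n)),
      moment_natCast]
    have : ∀ r ∈ Ioi (0 : ℝ), (∫ θ in Ioo (-Real.pi) Real.pi, (r : ℂ) *
        (Metric.ball 0 1).indicator (fun ζ => conj ζ ^ n * (f ζ * (ω ‖ζ‖ : ℂ)))
          (Complex.polarCoord.symm (r, θ))) = (Ioo (0 : ℝ) 1).indicator (fun r =>
            ((r ^ (2 * n + 1) * ω r : ℝ) : ℂ) * (2 * Real.pi * a n)) r := by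
      intro r hr
      have hr0 : (0 : ℝ) < r := hr
      have hn : ∀ θ, ‖Complex.polarCoord.symm (r, θ)‖ = r := fun θ => by
        rw [Complex.norm_polarCoord_symm, abs_of_pos hr0]
      by_cases hr1 : r < 1
      · rw [indicator_of_mem (show r ∈ Ioo (0 : ℝ) 1 from ⟨hr0, hr1⟩)]
        have hi := hint r ⟨hr0, hr1⟩ n
        calc _ = ∫ θ in Ioo (-Real.pi) Real.pi, ((r : ℂ) * ω r) *
              (f (Complex.polarCoord.symm (r, θ)) *
                conj (Complex.polarCoord.symm (r, θ)) ^ n) := by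
              refine integral_congr_ae (.of_forall fun θ => ?_)
              simp only
              rw [indicator_of_mem (by rw [mem_ball_zero_iff, hn]; exact hr1), hn]
              ring
          _ = _ := by
              rw [integral_const_mul, hi]
              push_cast
              ring
      · rw [indicator_of_notMem (show r ∉ Ioo (0 : ℝ) 1 from fun h => hr1 h.2)]
        simp only [indicator, mem_ball_zero_iff, hn, hr1, if_false, mul_zero, integral_zero]
    rw [setIntegral_congr_fun measurableSet_Ioi this, setIntegral_indicator measurableSet_Ioo,
      inter_eq_self_of_subset_right (fun x hx => hx.1), integral_mul_const, integral_complex_ofReal]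
    ring
  have hterm : ∀ n : ℕ, ∀ ζ : ℂ,
      f ζ * conj ((conj z * ζ) ^ n / ((2 * moment ω (2 * n + 1) : ℝ) : ℂ)) * (ω ‖ζ‖ : ℂ) =
      (z ^ n / ((2 * moment ω (2 * n + 1) : ℝ) : ℂ)) * (conj ζ ^ n * (f ζ * (ω ‖ζ‖ : ℂ))) := by
    intro n ζ
    simp only [map_div₀, map_pow, map_mul, Complex.conj_conj, Complex.conj_ofReal]
    ring
  have hs := hasSum_integral_of_summable_integral_norm
    (μ := volume.restrict (Metric.ball (0 : ℂ) 1))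
    (F := fun (n : ℕ) ζ => f ζ * conj ((conj z * ζ) ^ n /
      ((2 * moment ω (2 * n + 1) : ℝ) : ℂ)) * (ω ‖ζ‖ : ℂ))
    (fun n => by simp only [hterm]; exact (hmono n).const_mul _) (by
      refine Summable.of_nonneg_of_le (fun n => integral_nonneg fun _ => norm_nonneg _)
        (fun n => ?_) (hsum.mul_right (∫ ζ in Metric.ball 0 1, ‖f ζ * (ω ‖ζ‖ : ℂ)‖))
      rw [← integral_const_mul]
      refine setIntegral_mono_on ?_ (hfω.norm.const_mul _) hball fun ζ hζ => ?_
      · simp only [hterm]; exact ((hmono n).const_mul _).norm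
      · rw [mul_right_comm, norm_mul, mul_comm, RCLike.norm_conj]
        exact mul_le_mul_of_nonneg_right (norm_kernelTerm_le h hζ n) (norm_nonneg _))
  have hrhs : ∫ ζ in Metric.ball 0 1, (∑' n : ℕ, f ζ * conj ((conj z * ζ) ^ n /
      ((2 * moment ω (2 * n + 1) : ℝ) : ℂ)) * (ω ‖ζ‖ : ℂ)) =
      ∫ ζ in Metric.ball 0 1, f ζ * conj (bergmanKernel ω z ζ) * (ω ‖ζ‖ : ℂ) := by
    refine setIntegral_congr_fun hball fun ζ _ => ?_
    simp only [bergmanKernel]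
    rw [tsum_mul_right, tsum_mul_left, Complex.conj_tsum]
  rw [hrhs] at hs
  have hlhs : ∀ n : ℕ, ∫ ζ in Metric.ball 0 1, f ζ * conj ((conj z * ζ) ^ n /
      ((2 * moment ω (2 * n + 1) : ℝ) : ℂ)) * (ω ‖ζ‖ : ℂ) = Real.pi * (a n * z ^ n) := by
    intro n
    simp only [hterm]
    rw [integral_const_mul, hmonoint]
    have : (moment ω (2 * n + 1) : ℂ) ≠ 0 := by exact_mod_cast (h.moment_pos n).ne'
    push_cast
    field_simp
  simp only [hlhs] at hs
  have := hs.unique ((ha z hz).mul_left (Real.pi : ℂ))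
  rw [bergmanProj, diskMeasure, integral_smul_measure, this,
    ENNReal.toReal_ofReal (by positivity), Complex.real_smul]
  have hpi : (Real.pi : ℂ) ≠ 0 := by exact_mod_cast Real.pi_ne_zero
  push_cast
  field_simp

end

/-! Write σ = ω/ν̂, which is `divTail ω ν`. Everything turns on comparing ω̂ with the product ν̂σ̂.
Since ν̂ decreases, ω̂ ≤ ν̂σ̂ always holds (`tail_le_mul_tail_divTail`); the tail condition is the
reverse inequality up to a constant.

Conditions on weights: for an upper doubling weight the moment of order x is comparable to the tail
at 1 - 1/x (`UpperDoubling.exists_moment_le_tail`), which identifies the moment and tail conditions.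
If ω̂ ≈ ν̂σ̂, upper doubling passes from ω to both decreasing factors, and lower doubling passes
from ν to σ. Conversely, lower doubling of σ and upper doubling of ν give back the tail condition.

Sufficiency: it is enough to bound ν̂(z) ∫ |B_z| σ. The kernel coefficients 1/(2ω_{2n+1}) vary
slowly, with first and second differences smaller by factors 1/n and 1/n², so two summations by
parts localize the kernel to n ≲ 1/|1 - z̄ζ| (`norm_tsum_le_of_slowly_varying`). Integration leaves
the sum of |z|^n σ_{n+1} / ((n+1) ω_{2n+1}). The moment condition replaces σ_{n+1}/ω_{2n+1} by a
multiple of 1/ν_{n+1}, and doubling of ν bounds the resulting sum by a multiple of 1/ν̂(z)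
(`Doubling.exists_sum_inv_moment_le`).

Necessity: the projection is tested on arg ζ / ν̂(ζ). The Fourier coefficients of arg have size 1/n,
and at z = -r their alternating signs disappear, so ν̂(r) ∑ σ_{n+1} r^n / (n ω_{2n+1}) is bounded
(`BergmanProjBounded.exists_sum_moment_le`). The indices n ≈ 1/(1-r) give the tail condition. A long
run of dyadic blocks of indices, where harmonic sums grow, forces ν̂ to decay and gives lower
doubling. -/

/-! ### Tails and moments of a radial weight. -/

theorem IsRadialWeight.intervalIntegrable {ω : ℝ → ℝ} (h : IsRadialWeight ω) {a b : ℝ}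
    (ha : a ∈ Icc (0 : ℝ) 1) (hb : b ∈ Icc (0 : ℝ) 1) : IntervalIntegrable ω volume a b := by
  have h0 : IntervalIntegrable ω volume 0 1 :=
    (intervalIntegrable_iff_integrableOn_Ico_of_le zero_le_one).2 h.integrableOn
  refine h0.mono_set ?_
  rw [uIcc_of_le zero_le_one]
  exact uIcc_subset_Icc ha hb

theorem IsRadialWeight.integral_nonneg {ω : ℝ → ℝ} (h : IsRadialWeight ω) {a b : ℝ}
    (ha : 0 ≤ a) (hb : b ≤ 1) (hab : a ≤ b) : 0 ≤ ∫ s in a..b, ω s := by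
  rw [intervalIntegral.integral_of_le hab, integral_Ioc_eq_integral_Ioo]
  exact setIntegral_nonneg measurableSet_Ioo fun s hs =>
    h.nonneg s ⟨ha.trans hs.1.le, hs.2.trans_le hb⟩

theorem IsRadialWeight.tail_sub {ω : ℝ → ℝ} (h : IsRadialWeight ω) {a b : ℝ}
    (ha : a ∈ Icc (0 : ℝ) 1) (hb : b ∈ Icc (0 : ℝ) 1) :
    tail ω a - tail ω b = ∫ s in a..b, ω s := by
  have h1 : (1 : ℝ) ∈ Icc (0 : ℝ) 1 := by simp
  rw [tail, tail, ← intervalIntegral.integral_add_adjacent_intervals (h.intervalIntegrable ha hb)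
    (h.intervalIntegrable hb h1)]
  ring

theorem IsRadialWeight.tail_antitone {ω : ℝ → ℝ} (h : IsRadialWeight ω) {a b : ℝ}
    (ha : 0 ≤ a) (hb : b ≤ 1) (hab : a ≤ b) : tail ω b ≤ tail ω a := by
  have := h.integral_nonneg ha hb hab
  rw [← h.tail_sub ⟨ha, hab.trans hb⟩ ⟨ha.trans hab, hb⟩] at this
  linarith

/-- As ω is merely integrable, ω̂ need not be differentiable everywhere; absolute continuity is what
permits integration by parts. -/
theorem IsRadialWeight.absolutelyContinuous_tail {ω : ℝ → ℝ} (h : IsRadialWeight ω) :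
    AbsolutelyContinuousOnInterval (tail ω) 0 1 := by
  have h0 := h.intervalIntegrable (a := 0) (b := 1) (by simp) (by simp)
  have := (h0.absolutelyContinuousOnInterval_intervalIntegral (c := 1) (by simp)).neg
  convert! this using 1
  ext x
  simp [tail, intervalIntegral.integral_symm x 1]

theorem IsRadialWeight.continuousOn_tail {ω : ℝ → ℝ} (h : IsRadialWeight ω) :
    ContinuousOn (tail ω) (Icc 0 1) := by
  simpa using h.absolutelyContinuous_tail.continuousOn

theorem IsRadialWeight.tail_nonneg {ω : ℝ → ℝ} (h : IsRadialWeight ω) {r : ℝ}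
    (hr : r ∈ Icc (0 : ℝ) 1) : 0 ≤ tail ω r := h.integral_nonneg hr.1 le_rfl hr.2

theorem moment_eq_setIntegral (ω : ℝ → ℝ) (x : ℝ) :
    moment ω x = ∫ s in Ioo (0 : ℝ) 1, s ^ x * ω s := by
  rw [moment, intervalIntegral.integral_of_le zero_le_one, integral_Ioc_eq_integral_Ioo]

theorem IsRadialWeight.integrableOn_rpow_mul {ω : ℝ → ℝ} (h : IsRadialWeight ω) {x : ℝ}
    (hx : 0 ≤ x) : IntegrableOn (fun s => s ^ x * ω s) (Ioo 0 1) := by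
  have h1 : IntegrableOn ω (Ioo 0 1) := h.integrableOn.mono_set Ioo_subset_Ico_self
  refine h1.bdd_mul (c := 1) (by fun_prop) ?_
  refine (ae_restrict_iff' measurableSet_Ioo).2 (.of_forall fun r hr => ?_)
  rw [Real.norm_of_nonneg (Real.rpow_nonneg hr.1.le _)]
  exact Real.rpow_le_one hr.1.le hr.2.le hx

theorem IsRadialWeight.moment_antitone {ω : ℝ → ℝ} (h : IsRadialWeight ω) {x y : ℝ}
    (hx : 0 ≤ x) (hxy : x ≤ y) : moment ω y ≤ moment ω x := by
  rw [moment_eq_setIntegral, moment_eq_setIntegral]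
  refine setIntegral_mono_on (h.integrableOn_rpow_mul (hx.trans hxy)) (h.integrableOn_rpow_mul hx)
    measurableSet_Ioo fun s hs => ?_
  exact mul_le_mul_of_nonneg_right (Real.rpow_le_rpow_of_exponent_ge hs.1 hs.2.le hxy)
    (h.nonneg s ⟨hs.1.le, hs.2⟩)

theorem IsRadialWeight.rpow_mul_tail_le {ω : ℝ → ℝ} (h : IsRadialWeight ω) {ρ : ℝ}
    (hρ : ρ ∈ Ico (0 : ℝ) 1) {x : ℝ} (hx : 0 ≤ x) : ρ ^ x * tail ω ρ ≤ moment ω x := by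
  have h2 := h.integrableOn_rpow_mul hx
  have h1 : IntegrableOn ω (Ioo 0 1) := h.integrableOn.mono_set Ioo_subset_Ico_self
  have hsub : Ioo ρ 1 ⊆ Ioo 0 1 := Ioo_subset_Ioo_left hρ.1
  rw [moment_eq_setIntegral, tail, intervalIntegral.integral_of_le hρ.2.le,
    integral_Ioc_eq_integral_Ioo, ← integral_const_mul]
  calc ∫ s in Ioo ρ 1, ρ ^ x * ω s ≤ ∫ s in Ioo ρ 1, s ^ x * ω s := by
        refine setIntegral_mono_on ((h1.mono_set hsub).const_mul _) (h2.mono_set hsub)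
          measurableSet_Ioo fun s hs => ?_
        exact mul_le_mul_of_nonneg_right (Real.rpow_le_rpow hρ.1 hs.1.le hx)
          (h.nonneg s ⟨(hsub hs).1.le, hs.2⟩)
    _ ≤ _ := by
        refine setIntegral_mono_set h2 ?_ hsub.eventuallyLE
        refine (ae_restrict_iff' measurableSet_Ioo).2 (.of_forall fun s hs => ?_)
        exact mul_nonneg (Real.rpow_nonneg hs.1.le _) (h.nonneg s ⟨hs.1.le, hs.2⟩)

theorem IsRadialWeight.moment_pos' {ω : ℝ → ℝ} (h : IsRadialWeight ω) {x : ℝ} (hx : 0 ≤ x) :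
    0 < moment ω x := by
  refine lt_of_lt_of_le ?_ (h.rpow_mul_tail_le (ρ := 1 / 2) (by norm_num) hx)
  have := h.tail_pos (1 / 2) (by norm_num)
  positivity

/-- From log y ≥ 1 - 1/y with y = 1 - 1/x, the logarithm of the right side is at least -x/(x-1), and
this is at least -2 once x ≥ 2. -/
theorem exp_neg_two_le_one_sub_inv_rpow {x : ℝ} (hx : 2 ≤ x) :
    Real.exp (-2) ≤ (1 - 1 / x) ^ x := by
  have hx0 : 0 < x := by linarith
  have h2 : 1 / x ≤ 1 / 2 := one_div_le_one_div_of_le two_pos hx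
  rw [Real.rpow_def_of_pos (by linarith)]
  refine Real.exp_le_exp.2 ?_
  have h5 := Real.one_sub_inv_le_log_of_pos (show 0 < 1 - 1 / x by linarith)
  have h6 : (-2) ≤ (1 - (1 - 1 / x)⁻¹) * x := by
    have : (1 - (1 - 1 / x)⁻¹) * x = - (x / (x - 1)) := by
      have : x - 1 ≠ 0 := by linarith
      field_simp
      ring
    rw [this, neg_le_neg_iff, div_le_iff₀ (by linarith)]
    linarith
  nlinarith

/-- The moments dominate the tail at the natural scale. -/
theorem IsRadialWeight.tail_le_moment {ω : ℝ → ℝ} (h : IsRadialWeight ω) {x : ℝ} (hx : 2 ≤ x) :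
    tail ω (1 - 1 / x) ≤ Real.exp 2 * moment ω x := by
  have hx0 : 0 < x := by linarith
  have h2 : 1 / x ≤ 1 / 2 := one_div_le_one_div_of_le two_pos hx
  have h3 : 0 < 1 / x := by positivity
  have h1 := h.rpow_mul_tail_le (ρ := 1 - 1 / x) ⟨by linarith, by linarith⟩ hx0.le
  have h4 := exp_neg_two_le_one_sub_inv_rpow hx
  have h7 : 0 ≤ tail ω (1 - 1 / x) := h.tail_nonneg ⟨by linarith, by linarith⟩
  have h8 : Real.exp 2 * Real.exp (-2) = 1 := by rw [← Real.exp_add]; simp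
  calc tail ω (1 - 1 / x) = Real.exp 2 * (Real.exp (-2) * tail ω (1 - 1 / x)) := by
        rw [← mul_assoc, h8, one_mul]
    _ ≤ _ := by gcongr; exact (mul_le_mul_of_nonneg_right h4 h7).trans h1

/-! ### Upper doubling: moments are comparable to tails. -/

/-- Away from 1 the tail is bounded above and bounded below by a positive number, so enlarging the
constant extends the doubling inequality to all of [0, 1). -/
theorem UpperDoubling.exists_forall {ω : ℝ → ℝ} (h : UpperDoubling ω) :
    ∃ C : ℝ, 1 ≤ C ∧ ∀ r ∈ Ico (0 : ℝ) 1, tail ω r ≤ C * tail ω ((1 + r) / 2) := by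
  obtain ⟨hω, C, hC, hev⟩ := h
  obtain ⟨r₀, hr₀, hr⟩ := mem_nhdsLT_iff_exists_Ioo_subset.1 hev
  have hr₀1 : r₀ < 1 := hr₀
  set r₁ := max r₀ 0 with hr₁
  have h0 : 0 ≤ r₁ := le_max_right _ _
  have h1 : r₁ < 1 := max_lt hr₀1 one_pos
  have hp := hω.tail_pos ((1 + r₁) / 2) ⟨by linarith, by linarith⟩
  refine ⟨max (max C 1) (tail ω 0 / tail ω ((1 + r₁) / 2)),
    (le_max_right _ _).trans (le_max_left _ _), fun r hr' => ?_⟩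
  have hp' := hω.tail_pos ((1 + r) / 2) ⟨by linarith [hr'.1], by linarith [hr'.2]⟩
  rcases le_or_gt r r₁ with hle | hlt
  · calc tail ω r ≤ tail ω 0 := hω.tail_antitone le_rfl hr'.2.le hr'.1
      _ = tail ω 0 / tail ω ((1 + r₁) / 2) * tail ω ((1 + r₁) / 2) := by field_simp
      _ ≤ tail ω 0 / tail ω ((1 + r₁) / 2) * tail ω ((1 + r) / 2) := by
        gcongr
        · exact div_nonneg (hω.tail_nonneg (by simp)) hp.le
        · exact hω.tail_antitone (by linarith [hr'.1]) (by linarith) (by linarith)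
      _ ≤ _ := by gcongr; exact le_max_right _ _
  · refine (hr ⟨(le_max_left _ _).trans_lt hlt, hr'.2⟩ : tail ω r ≤ C * _).trans ?_
    gcongr
    exact (le_max_left _ _).trans (le_max_left _ _)

/-- Iterating the upper doubling condition. -/
theorem UpperDoubling.exists_forall_le {ω : ℝ → ℝ} (h : UpperDoubling ω) {K : ℝ} (hK : 1 ≤ K) :
    ∃ C : ℝ, 1 ≤ C ∧ ∀ r ∈ Ico (0 : ℝ) 1, tail ω r ≤ C * tail ω (1 - (1 - r) / K) := by
  obtain ⟨C, hC, hd⟩ := h.exists_forall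
  -- With 2^n > K, halving the distance to 1 n times goes beyond the target point, and monotonicity
  -- of the tail finishes.
  obtain ⟨n, hn⟩ := pow_unbounded_of_one_lt K one_lt_two
  have key : ∀ n : ℕ, ∀ r ∈ Ico (0 : ℝ) 1, tail ω r ≤ C ^ n * tail ω (1 - (1 - r) / 2 ^ n) := by
    intro n
    induction n with
    | zero => intro r _; simp
    | succ n ih =>
      intro r hr
      refine (hd r hr).trans ?_
      rw [pow_succ', mul_assoc]
      gcongr
      refine (ih ((1 + r) / 2) ⟨by linarith [hr.1], by linarith [hr.2]⟩).trans_eq ?_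
      rw [show 1 - (1 - (1 + r) / 2) / 2 ^ n = 1 - (1 - r) / 2 ^ (n + 1) by field_simp; ring]
  refine ⟨C ^ n, one_le_pow₀ hC, fun r hr => (key n r hr).trans ?_⟩
  have h1 : 0 < 1 - r := by linarith [hr.2]
  have h3 : (1 - r) / 2 ^ n ≤ (1 - r) / K := by gcongr
  have h4 : (1 - r) / K ≤ 1 - r := div_le_self h1.le hK
  have h5 : 0 < (1 - r) / 2 ^ n := by positivity
  gcongr
  exact h.1.tail_antitone (by linarith [hr.1]) (by linarith) (by linarith)

/-- Integration by parts for moments. -/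
theorem IsRadialWeight.moment_eq_integral_tail {ω : ℝ → ℝ} (h : IsRadialWeight ω) {x : ℝ}
    (hx : 1 ≤ x) : moment ω x = x * ∫ s in (0 : ℝ)..1, s ^ (x - 1) * tail ω s := by
  have h0 := h.intervalIntegrable (a := 0) (b := 1) (by simp) (by simp)
  have hf : AbsolutelyContinuousOnInterval (fun s : ℝ => s ^ x) 0 1 :=
    ContDiffOn.absolutelyContinuousOnInterval
      (Real.contDiff_rpow_const_of_le (n := 1) (by simpa using hx)).contDiffOn
  have hparts := hf.integral_mul_deriv_eq_deriv_mul h.absolutelyContinuous_tail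
  have h1 : tail ω 1 = 0 := by simp [tail]
  have h2 : ∫ s in (0 : ℝ)..1, s ^ x * deriv (tail ω) s = -moment ω x := by
    rw [moment, ← intervalIntegral.integral_neg]
    refine intervalIntegral.integral_congr_ae ?_
    filter_upwards [h0.ae_hasDerivAt_integral] with s hs hs'
    have := (hs (uIoc_subset_uIcc hs') 1 (by simp)).neg
    have h3 : HasDerivAt (tail ω) (-ω s) s := by
      convert! this using 1
      ext x
      simp [tail, intervalIntegral.integral_symm x 1]
    rw [h3.deriv]
    ring
  -- Both boundary terms vanish: s^x at 0 and the tail at 1.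
  rw [h2, h1, Real.zero_rpow (by linarith)] at hparts
  have h4 : moment ω x = ∫ s in (0 : ℝ)..1, deriv (fun s : ℝ => s ^ x) s * tail ω s := by linarith
  rw [h4, ← intervalIntegral.integral_const_mul]
  refine intervalIntegral.integral_congr fun s _ => ?_
  rw [(Real.hasDerivAt_rpow_const (Or.inr hx)).deriv]
  ring

/-- After integration by parts, ω̂(s) is replaced by ω̂((1+s)/2). In the variable t = (1+s)/2 the
power is (2t-1)^(x-1) ≤ t^(2(x-1)), because 2t - 1 ≤ t². The exponent x - 1 is thus doubled, which
turns x into 2x - 1. -/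
theorem UpperDoubling.exists_moment_le {ω : ℝ → ℝ} (h : UpperDoubling ω) :
    ∃ C : ℝ, 1 ≤ C ∧ ∀ x : ℝ, 1 ≤ x → moment ω x ≤ C * moment ω (2 * x - 1) := by
  obtain ⟨C, hC, hd⟩ := h.exists_forall
  have hω := h.1
  refine ⟨2 * C, by linarith, fun x hx => ?_⟩
  have hcont : ContinuousOn (fun s => tail ω s) (uIcc 0 1) := by
    simpa using hω.continuousOn_tail
  have hrp : ∀ y : ℝ, 0 ≤ y → Continuous fun s : ℝ => s ^ y := fun y hy =>
    Real.continuous_rpow_const hy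
  have hx1 : 0 ≤ x - 1 := by linarith
  have hmaps : MapsTo (fun s : ℝ => (1 + s) / 2) (uIcc 0 1) (uIcc 0 1) := by
    simp only [uIcc_of_le zero_le_one]
    exact fun s hs => ⟨by linarith [hs.1], by linarith [hs.2]⟩
  have h1 : ∫ s in (0 : ℝ)..1, s ^ (x - 1) * tail ω s ≤
      ∫ s in (0 : ℝ)..1, s ^ (x - 1) * (C * tail ω ((1 + s) / 2)) := by
    refine intervalIntegral.integral_mono_on_of_le_Ioo zero_le_one
      ((hrp _ hx1).continuousOn.mul hcont).intervalIntegrable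
      ((hrp _ hx1).continuousOn.mul (continuousOn_const.mul
        (hcont.comp (by fun_prop) hmaps))).intervalIntegrable fun s hs => ?_
    exact mul_le_mul_of_nonneg_left (hd s ⟨hs.1.le, hs.2⟩) (Real.rpow_nonneg hs.1.le _)
  have h2 : ∫ s in (0 : ℝ)..1, s ^ (x - 1) * (C * tail ω ((1 + s) / 2)) =
      2 * ∫ t in (1 / 2 : ℝ)..1, (2 * t - 1) ^ (x - 1) * (C * tail ω t) := by
    have := intervalIntegral.integral_comp_div_add (a := 0) (b := 1)
      (fun t => (2 * t - 1) ^ (x - 1) * (C * tail ω t)) (two_ne_zero (α := ℝ)) (1 / 2)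
    norm_num at this ⊢
    rw [← this]
    refine intervalIntegral.integral_congr fun s _ => ?_
    congr 3 <;> ring
  have hc2 : ContinuousOn (fun t : ℝ => t ^ (2 * x - 2) * (C * tail ω t)) (uIcc 0 1) :=
    (hrp _ (by linarith)).continuousOn.mul (continuousOn_const.mul hcont)
  have hsub : uIcc (1 / 2 : ℝ) 1 ⊆ uIcc 0 1 := by
    rw [uIcc_of_le (by norm_num), uIcc_of_le zero_le_one]
    exact Icc_subset_Icc_left (by norm_num)
  have h3 : ∫ t in (1 / 2 : ℝ)..1, (2 * t - 1) ^ (x - 1) * (C * tail ω t) ≤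
      ∫ t in (1 / 2 : ℝ)..1, t ^ (2 * x - 2) * (C * tail ω t) := by
    refine intervalIntegral.integral_mono_on_of_le_Ioo (by norm_num) ?_
      (hc2.mono hsub).intervalIntegrable fun t ht => ?_
    · refine ContinuousOn.intervalIntegrable (((hrp _ hx1).comp (by fun_prop)).continuousOn.mul
        (continuousOn_const.mul (hcont.mono hsub)))
    · have ht0 : 0 ≤ 2 * t - 1 := by linarith [ht.1]
      have ht1 : 0 ≤ t := by linarith [ht.1]
      have := hω.tail_nonneg (r := t) ⟨ht1, ht.2.le⟩
      refine mul_le_mul_of_nonneg_right ?_ (by positivity)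
      calc (2 * t - 1) ^ (x - 1) ≤ (t ^ (2 : ℝ)) ^ (x - 1) := by
            refine Real.rpow_le_rpow ht0 ?_ hx1
            rw [Real.rpow_two]
            nlinarith [sq_nonneg (t - 1)]
        _ = t ^ (2 * x - 2) := by rw [← Real.rpow_mul ht1]; ring_nf
  have h4 : ∫ t in (1 / 2 : ℝ)..1, t ^ (2 * x - 2) * (C * tail ω t) ≤
      ∫ t in (0 : ℝ)..1, t ^ (2 * x - 2) * (C * tail ω t) := by
    refine intervalIntegral.integral_mono_interval (by norm_num) (by norm_num) le_rfl ?_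
      hc2.intervalIntegrable
    refine (ae_restrict_iff' measurableSet_Ioc).2 (.of_forall fun t ht => ?_)
    have := hω.tail_nonneg (r := t) ⟨ht.1.le, ht.2⟩
    exact mul_nonneg (Real.rpow_nonneg ht.1.le _) (by positivity)
  have h5 : ∫ t in (0 : ℝ)..1, t ^ (2 * x - 2) * (C * tail ω t) =
      C * ∫ t in (0 : ℝ)..1, t ^ (2 * x - 2) * tail ω t := by
    rw [← intervalIntegral.integral_const_mul]
    refine intervalIntegral.integral_congr fun s _ => ?_
    ring
  have h6 := hω.moment_eq_integral_tail hx
  have h7 := hω.moment_eq_integral_tail (x := 2 * x - 1) (by linarith)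
  rw [show 2 * x - 1 - 1 = 2 * x - 2 by ring] at h7
  set I := ∫ t in (0 : ℝ)..1, t ^ (2 * x - 2) * tail ω t
  have hI : 0 ≤ I := by
    have := (hω.moment_pos' (x := 2 * x - 1) (by linarith)).le
    rw [h7] at this
    exact nonneg_of_mul_nonneg_right this (by linarith)
  rw [h6, h7]
  calc x * ∫ s in (0 : ℝ)..1, s ^ (x - 1) * tail ω s ≤ x * (2 * (C * I)) := by
        gcongr; linarith
    _ = 2 * C * (x * I) := by ring
    _ ≤ _ := by gcongr; linarith

/-- Two applications of `exists_moment_le` lead from x to 4x - 3, which exceeds 2x when x > 2. For x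
≤ 2 the moments involved lie between the fixed positive numbers ω_4 and ω_0. -/
theorem UpperDoubling.exists_moment_le_two_mul {ω : ℝ → ℝ} (h : UpperDoubling ω) :
    ∃ C : ℝ, 1 ≤ C ∧ ∀ x : ℝ, 0 ≤ x → moment ω x ≤ C * moment ω (2 * x) := by
  obtain ⟨C, hC, hd⟩ := h.exists_moment_le
  have hω := h.1
  have hp := hω.moment_pos' (x := 4) (by norm_num)
  refine ⟨max (C * C) (moment ω 0 / moment ω 4), ?_, fun x hx => ?_⟩
  · exact le_max_of_le_left (by nlinarith)
  have hp' := hω.moment_pos' (x := 2 * x) (by linarith)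
  rcases le_or_gt x 2 with h2 | h2
  · calc moment ω x ≤ moment ω 0 := hω.moment_antitone le_rfl hx
      _ = moment ω 0 / moment ω 4 * moment ω 4 := by field_simp
      _ ≤ moment ω 0 / moment ω 4 * moment ω (2 * x) := by
        gcongr
        · exact div_nonneg (hω.moment_pos' le_rfl).le hp.le
        · exact hω.moment_antitone (by linarith) (by linarith)
      _ ≤ _ := by gcongr; exact le_max_right _ _
  · calc moment ω x ≤ C * moment ω (2 * x - 1) := hd x (by linarith)
      _ ≤ C * (C * moment ω (2 * (2 * x - 1) - 1)) := by gcongr; exact hd _ (by linarith)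
      _ ≤ C * (C * moment ω (2 * x)) := by
        gcongr
        exact hω.moment_antitone (by linarith) (by linarith)
      _ ≤ _ := by rw [← mul_assoc]; gcongr; exact le_max_left _ _

/-- Split at 1 - 1/x. Below this point s^((K-1)x) ≤ exp(-(K-1)); above it the power is bounded by 1.
The exponential gain allows the first term to be absorbed when K is large. -/
theorem IsRadialWeight.moment_mul_le {ω : ℝ → ℝ} (h : IsRadialWeight ω) {x K : ℝ} (hx : 1 ≤ x)
    (hK : 1 ≤ K) :
    moment ω (K * x) ≤ Real.exp (-(K - 1)) * moment ω x + tail ω (1 - 1 / x) := by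
  have hx0 : 0 < x := by linarith
  have hi : 1 / x ≤ 1 := by rw [div_le_one hx0]; exact hx
  have hi0 : 0 < 1 / x := by positivity
  set t := 1 - 1 / x with ht
  have ht0 : 0 ≤ t := by linarith
  have ht1 : t ≤ 1 := by linarith
  have hint : ∀ y : ℝ, 0 ≤ y → ∀ a ∈ Icc (0 : ℝ) 1, ∀ b ∈ Icc (0 : ℝ) 1,
      IntervalIntegrable (fun s => s ^ y * ω s) volume a b := fun y hy a ha b hb =>
    (h.intervalIntegrable ha hb).continuousOn_mul (Real.continuous_rpow_const hy).continuousOn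
  have h0 : (0 : ℝ) ∈ Icc (0 : ℝ) 1 := by simp
  have h1 : (1 : ℝ) ∈ Icc (0 : ℝ) 1 := by simp
  have htm : t ∈ Icc (0 : ℝ) 1 := ⟨ht0, ht1⟩
  have hKx : 0 ≤ K * x := by positivity
  have hb : ∫ s in t..1, s ^ (K * x) * ω s ≤ tail ω t := by
    refine intervalIntegral.integral_mono_on_of_le_Ioo ht1 (hint _ hKx _ htm _ h1)
      (h.intervalIntegrable htm h1) fun s hs => ?_
    exact mul_le_of_le_one_left (h.nonneg s ⟨ht0.trans hs.1.le, hs.2⟩)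
      (Real.rpow_le_one (ht0.trans hs.1.le) hs.2.le hKx)
  have ha : ∫ s in (0 : ℝ)..t, s ^ (K * x) * ω s ≤ Real.exp (-(K - 1)) * moment ω x := by
    calc ∫ s in (0 : ℝ)..t, s ^ (K * x) * ω s ≤
        ∫ s in (0 : ℝ)..t, Real.exp (-(K - 1)) * (s ^ x * ω s) := by
          refine intervalIntegral.integral_mono_on_of_le_Ioo ht0 (hint _ hKx _ h0 _ htm)
            ((hint _ hx0.le _ h0 _ htm).const_mul _) fun s hs => ?_
          rw [← mul_assoc]
          refine mul_le_mul_of_nonneg_right ?_ (h.nonneg s ⟨hs.1.le, hs.2.trans_le ht1⟩)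
          rw [show K * x = (K - 1) * x + x by ring, Real.rpow_add hs.1]
          refine mul_le_mul_of_nonneg_right ?_ (Real.rpow_nonneg hs.1.le _)
          rw [Real.rpow_def_of_pos hs.1]
          refine Real.exp_le_exp.2 ?_
          have h3 : Real.log s ≤ -(1 / x) := by
            have := Real.log_le_sub_one_of_pos hs.1
            linarith [hs.2]
          calc Real.log s * ((K - 1) * x) ≤ -(1 / x) * ((K - 1) * x) := by
                refine mul_le_mul_of_nonneg_right h3 (mul_nonneg (by linarith) hx0.le)
            _ = -(K - 1) := by field_simp
      _ ≤ Real.exp (-(K - 1)) * moment ω x := by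
          rw [intervalIntegral.integral_const_mul]
          gcongr
          refine intervalIntegral.integral_mono_interval le_rfl ht0 ht1 ?_ (hint _ hx0.le _ h0 _ h1)
          rw [← restrict_Ioo_eq_restrict_Ioc]
          refine (ae_restrict_iff' measurableSet_Ioo).2 (.of_forall fun s hs => ?_)
          exact mul_nonneg (Real.rpow_nonneg hs.1.le _) (h.nonneg s ⟨hs.1.le, hs.2⟩)
  have hsplit := intervalIntegral.integral_add_adjacent_intervals (hint _ hKx _ h0 _ htm)
    (hint _ hKx _ htm _ h1)
  rw [moment, ← hsplit]
  linarith

/-- For upper doubling weights, the moments are dominated by the tail at the natural scale. -/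
theorem UpperDoubling.exists_moment_le_tail {ω : ℝ → ℝ} (h : UpperDoubling ω) :
    ∃ C : ℝ, 1 ≤ C ∧ ∀ x : ℝ, 1 ≤ x → moment ω x ≤ C * tail ω (1 - 1 / x) := by
  obtain ⟨C, hC, hd⟩ := h.exists_moment_le_two_mul
  have hω := h.1
  have key : ∀ n : ℕ, ∀ x : ℝ, 0 ≤ x → moment ω x ≤ C ^ n * moment ω (2 ^ n * x) := by
    intro n
    induction n with
    | zero => intro x _; simp
    | succ n ih =>
      intro x hx
      refine (hd x hx).trans ?_
      rw [pow_succ', mul_assoc]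
      gcongr
      refine (ih (2 * x) (by linarith)).trans_eq ?_
      rw [show (2 : ℝ) ^ n * (2 * x) = 2 ^ (n + 1) * x by ring]
  -- Doubling the exponent n times costs C^n, whereas `moment_mul_le` with K = 2^n gains exp(-(2^n -
  -- 1)). The gain wins for large n, and half of the moment is then absorbed on the left.
  obtain ⟨n, hn⟩ : ∃ n : ℕ, C ^ n * Real.exp (-(2 ^ n - 1)) ≤ 1 / 2 := by
    have h1 : Tendsto (fun n : ℕ => (n : ℝ) * (Real.log C + 1) - 2 ^ n) atTop atBot := by
      have h2 : Tendsto (fun n : ℕ => ((n : ℝ) ^ 1 / 2 ^ n)) atTop (𝓝 0) :=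
        tendsto_pow_const_div_const_pow_of_one_lt 1 one_lt_two
      have h3 : Tendsto (fun n : ℕ => (2 : ℝ) ^ n * ((n : ℝ) ^ 1 / 2 ^ n * (Real.log C + 1) - 1))
          atTop atBot := by
        refine Tendsto.atTop_mul_neg (C := -1) (by norm_num)
          (tendsto_pow_atTop_atTop_of_one_lt one_lt_two) ?_
        simpa using (h2.mul_const (Real.log C + 1)).sub_const 1
      refine h3.congr fun n => ?_
      field_simp
    obtain ⟨n, hn⟩ := (h1.eventually (eventually_le_atBot (Real.log (1 / 2) - 1))).exists
    refine ⟨n, ?_⟩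
    have hC0 : 0 < C := by linarith
    rw [← Real.exp_log (show (0 : ℝ) < 1 / 2 by norm_num), ← Real.exp_log hC0, ← Real.exp_nat_mul,
      ← Real.exp_add]
    refine Real.exp_le_exp.2 ?_
    have : (0 : ℝ) ≤ n := n.cast_nonneg
    nlinarith
  refine ⟨2 * C ^ n, by nlinarith [one_le_pow₀ hC (n := n)], fun x hx => ?_⟩
  have h1 := key n x (by linarith)
  have h2 := hω.moment_mul_le hx (K := 2 ^ n) (one_le_pow₀ one_le_two)
  have h3 := hω.moment_pos' (x := x) (by linarith)
  have h4 : C ^ n * moment ω (2 ^ n * x) ≤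
      C ^ n * (Real.exp (-(2 ^ n - 1)) * moment ω x + tail ω (1 - 1 / x)) := by gcongr
  have h5 : C ^ n * Real.exp (-(2 ^ n - 1)) * moment ω x ≤ 1 / 2 * moment ω x := by gcongr
  linarith

/-! ### Doubling conditions in convenient form. -/

theorem UpperDoubling.of_forall {ω : ℝ → ℝ} (h : IsRadialWeight ω) {C r₀ : ℝ} (hC : 0 < C)
    (hr₀ : r₀ < 1) (hd : ∀ r ∈ Ioo r₀ 1, tail ω r ≤ C * tail ω ((1 + r) / 2)) :
    UpperDoubling ω :=
  ⟨h, C, hC, mem_of_superset (Ioo_mem_nhdsLT hr₀) hd⟩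

theorem LowerDoubling.of_forall {ω : ℝ → ℝ} (h : IsRadialWeight ω) {K C r₀ : ℝ} (hK : 1 < K)
    (hC : 1 < C) (hr₀ : r₀ < 1) (hd : ∀ r ∈ Ioo r₀ 1, C * tail ω (1 - (1 - r) / K) ≤ tail ω r) :
    LowerDoubling ω :=
  ⟨h, K, hK, C, hC, mem_of_superset (Ioo_mem_nhdsLT hr₀) hd⟩

/-- Iterating the lower doubling condition. -/
theorem LowerDoubling.exists_forall {ω : ℝ → ℝ} (h : LowerDoubling ω) (A : ℝ) :
    ∃ K : ℝ, 1 < K ∧ ∃ r₀ ∈ Ico (0 : ℝ) 1,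
      ∀ r ∈ Ioo r₀ 1, A * tail ω (1 - (1 - r) / K) ≤ tail ω r := by
  obtain ⟨hω, K, hK, C, hC, hev⟩ := h
  obtain ⟨r₀, hr₀, hr⟩ := mem_nhdsLT_iff_exists_Ioo_subset.1 hev
  have hr₀1 : r₀ < 1 := hr₀
  have hK0 : 0 < K := by linarith
  have key : ∀ n : ℕ, ∀ r ∈ Ioo (max r₀ 0) 1, C ^ n * tail ω (1 - (1 - r) / K ^ n) ≤ tail ω r := by
    intro n
    induction n with
    | zero => intro r _; simp
    | succ n ih =>
      intro r hr'
      have h1 : r₀ < r := (le_max_left _ _).trans_lt hr'.1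
      have h2 : 0 < 1 - r := by linarith [hr'.2]
      have h3 : (1 - r) / K < 1 - r := div_lt_self h2 hK
      have h4 : 0 < (1 - r) / K := by positivity
      have h5 := ih (1 - (1 - r) / K) ⟨by linarith [hr'.1], by linarith⟩
      rw [show 1 - (1 - (1 - (1 - r) / K)) / K ^ n = 1 - (1 - r) / K ^ (n + 1) by
        field_simp; ring] at h5
      calc _ = C * (C ^ n * tail ω (1 - (1 - r) / K ^ (n + 1))) := by ring
        _ ≤ C * tail ω (1 - (1 - r) / K) := by gcongr
        _ ≤ _ := hr ⟨h1, hr'.2⟩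
  obtain ⟨n, hn⟩ := pow_unbounded_of_one_lt A hC
  -- The exponent n + 1 instead of n keeps the dilation factor strictly above 1 even when n = 0.
  refine ⟨K ^ (n + 1), one_lt_pow₀ hK n.succ_ne_zero, max r₀ 0,
    ⟨le_max_right _ _, max_lt hr₀1 one_pos⟩, fun r hr' => (le_trans ?_ (key (n + 1) r hr'))⟩
  have h0 : 0 ≤ r := (le_max_right _ _).trans hr'.1.le
  have h2 : 0 < 1 - r := by linarith [hr'.2]
  have h3 : (1 - r) / K ^ (n + 1) ≤ 1 - r := div_le_self h2.le (one_le_pow₀ hK.le)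
  have h4 : 0 < (1 - r) / K ^ (n + 1) := by positivity
  refine mul_le_mul_of_nonneg_right ?_ (hω.tail_nonneg ⟨by linarith, by linarith⟩)
  exact hn.le.trans (pow_le_pow_right₀ hC.le n.le_succ)

/-! ### The weight ω/ν̂: tail condition, moment condition and doubling. -/

section DivTail

variable {ω ν : ℝ → ℝ}

theorem divTail_nonneg (hω : IsRadialWeight ω) (hν : IsRadialWeight ν) :
    ∀ r ∈ Ico (0 : ℝ) 1, 0 ≤ divTail ω ν r := fun r hr =>
  div_nonneg (hω.nonneg r hr) (hν.tail_pos r hr).le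

theorem intervalIntegrable_divTail (hσ : IntegrableOn (divTail ω ν) (Ico 0 1)) {a b : ℝ}
    (ha : a ∈ Icc (0 : ℝ) 1) (hb : b ∈ Icc (0 : ℝ) 1) :
    IntervalIntegrable (divTail ω ν) volume a b := by
  have h0 : IntervalIntegrable (divTail ω ν) volume 0 1 :=
    (intervalIntegrable_iff_integrableOn_Ico_of_le zero_le_one).2 hσ
  refine h0.mono_set ?_
  rw [uIcc_of_le zero_le_one]
  exact uIcc_subset_Icc ha hb

/-- On [a, b] the decreasing function ν̂ lies between ν̂(b) and ν̂(a), and ω = ν̂σ. This lemma and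
the next are the two resulting bounds. -/
theorem integral_le_mul_integral_divTail (hω : IsRadialWeight ω) (hν : IsRadialWeight ν)
    (hσ : IntegrableOn (divTail ω ν) (Ico 0 1)) {a b : ℝ} (ha : 0 ≤ a) (hab : a ≤ b)
    (hb : b ≤ 1) : ∫ s in a..b, ω s ≤ tail ν a * ∫ s in a..b, divTail ω ν s := by
  have ham : a ∈ Icc (0 : ℝ) 1 := ⟨ha, hab.trans hb⟩
  have hbm : b ∈ Icc (0 : ℝ) 1 := ⟨ha.trans hab, hb⟩
  rw [← intervalIntegral.integral_const_mul]
  refine intervalIntegral.integral_mono_on_of_le_Ioo hab (hω.intervalIntegrable ham hbm)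
    ((intervalIntegrable_divTail hσ ham hbm).const_mul _) fun s hs => ?_
  have hs1 : s < 1 := hs.2.trans_le hb
  have hs0 : 0 ≤ s := ha.trans hs.1.le
  have h1 := hν.tail_pos s ⟨hs0, hs1⟩
  have h2 := hν.tail_antitone ha hs1.le hs.1.le
  rw [divTail, mul_div_assoc', le_div_iff₀ h1, mul_comm]
  exact mul_le_mul_of_nonneg_right h2 (hω.nonneg s ⟨hs0, hs1⟩)

theorem mul_integral_divTail_le_integral (hω : IsRadialWeight ω) (hν : IsRadialWeight ν)
    (hσ : IntegrableOn (divTail ω ν) (Ico 0 1)) {a b : ℝ} (ha : 0 ≤ a) (hab : a ≤ b)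
    (hb : b ≤ 1) : tail ν b * ∫ s in a..b, divTail ω ν s ≤ ∫ s in a..b, ω s := by
  have ham : a ∈ Icc (0 : ℝ) 1 := ⟨ha, hab.trans hb⟩
  have hbm : b ∈ Icc (0 : ℝ) 1 := ⟨ha.trans hab, hb⟩
  rw [← intervalIntegral.integral_const_mul]
  refine intervalIntegral.integral_mono_on_of_le_Ioo hab
    ((intervalIntegrable_divTail hσ ham hbm).const_mul _) (hω.intervalIntegrable ham hbm)
    fun s hs => ?_
  have hs1 : s < 1 := hs.2.trans_le hb
  have hs0 : 0 ≤ s := ha.trans hs.1.le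
  have h1 := hν.tail_pos s ⟨hs0, hs1⟩
  have h2 := hν.tail_antitone hs0 hb hs.2.le
  rw [divTail, mul_div_assoc', div_le_iff₀ h1, mul_comm]
  exact mul_le_mul_of_nonneg_left h2 (hω.nonneg s ⟨hs0, hs1⟩)

/-- The half of ω̂ ≈ ν̂σ̂ that costs nothing; the other half is the tail condition. -/
theorem tail_le_mul_tail_divTail (hω : IsRadialWeight ω) (hν : IsRadialWeight ν)
    (hσ : IntegrableOn (divTail ω ν) (Ico 0 1)) {r : ℝ} (hr : r ∈ Ico (0 : ℝ) 1) :
    tail ω r ≤ tail ν r * tail (divTail ω ν) r :=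
  integral_le_mul_integral_divTail hω hν hσ hr.1 hr.2.le le_rfl

theorem isRadialWeight_divTail (hω : IsRadialWeight ω) (hν : IsRadialWeight ν)
    (hσ : IntegrableOn (divTail ω ν) (Ico 0 1)) : IsRadialWeight (divTail ω ν) :=
  ⟨divTail_nonneg hω hν, hσ, fun r hr => pos_of_mul_pos_right
    ((hω.tail_pos r hr).trans_le (tail_le_mul_tail_divTail hω hν hσ hr)) (hν.tail_pos r hr).le⟩

theorem TailCondition.exists_mul_le (hω : IsRadialWeight ω) (h : TailCondition ω ν) :
    ∃ C : ℝ, 1 ≤ C ∧ ∀ r ∈ Ico (0 : ℝ) 1, tail ν r * tail (divTail ω ν) r ≤ C * tail ω r := by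
  obtain ⟨-, C, hC⟩ := h
  refine ⟨max C 1, le_max_right _ _, fun r hr => ?_⟩
  have h1 := hω.tail_pos r hr
  have h2 : tail ν r / tail ω r * tail (divTail ω ν) r ≤ C := hC r hr
  rw [div_mul_eq_mul_div, div_le_iff₀ h1] at h2
  exact h2.trans (by gcongr; exact le_max_left _ _)

/-- With t = (1+r)/2, ν̂(r)σ̂(r) ≲ ω̂(r) ≲ ω̂(t) ≤ ν̂(t)σ̂(t) ≤ ν̂(t)σ̂(r), and σ̂(r) cancels.
Bounding ν̂(t) by ν̂(r) in the last step instead gives the same conclusion for σ. -/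
theorem TailCondition.upperDoubling (hν : IsRadialWeight ν) (hω : UpperDoubling ω)
    (h : TailCondition ω ν) : UpperDoubling ν := by
  obtain ⟨C, hC, hle⟩ := h.exists_mul_le hω.1
  obtain ⟨D, hD, hd⟩ := hω.exists_forall
  have hσ := isRadialWeight_divTail hω.1 hν h.1
  refine .of_forall hν (C := C * D) (by positivity) one_half_lt_one fun r hr => ?_
  have hr' : r ∈ Ico (0 : ℝ) 1 := ⟨by linarith [hr.1], hr.2⟩
  have ht : (1 + r) / 2 ∈ Ico (0 : ℝ) 1 := ⟨by linarith [hr'.1], by linarith [hr.2]⟩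
  refine le_of_mul_le_mul_right ?_ (hσ.tail_pos r hr')
  have hνt := hν.tail_pos _ ht
  calc tail ν r * tail (divTail ω ν) r ≤ C * tail ω r := hle r hr'
    _ ≤ C * (D * tail ω ((1 + r) / 2)) := by gcongr; exact hd r hr'
    _ ≤ C * (D * (tail ν ((1 + r) / 2) * tail (divTail ω ν) ((1 + r) / 2))) := by
      gcongr; exact tail_le_mul_tail_divTail hω.1 hν h.1 ht
    _ ≤ C * (D * (tail ν ((1 + r) / 2) * tail (divTail ω ν) r)) := by
      gcongr; exact hσ.tail_antitone hr'.1 ht.2.le (by linarith [hr.2])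
    _ = _ := by ring

theorem TailCondition.upperDoubling_divTail (hν : IsRadialWeight ν) (hω : UpperDoubling ω)
    (h : TailCondition ω ν) : UpperDoubling (divTail ω ν) := by
  obtain ⟨C, hC, hle⟩ := h.exists_mul_le hω.1
  obtain ⟨D, hD, hd⟩ := hω.exists_forall
  have hσ := isRadialWeight_divTail hω.1 hν h.1
  refine .of_forall hσ (C := C * D) (by positivity) one_half_lt_one fun r hr => ?_
  have hr' : r ∈ Ico (0 : ℝ) 1 := ⟨by linarith [hr.1], hr.2⟩
  have ht : (1 + r) / 2 ∈ Ico (0 : ℝ) 1 := ⟨by linarith [hr'.1], by linarith [hr.2]⟩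
  refine le_of_mul_le_mul_left ?_ (hν.tail_pos r hr')
  have hσt := hσ.tail_pos _ ht
  calc tail ν r * tail (divTail ω ν) r ≤ C * tail ω r := hle r hr'
    _ ≤ C * (D * tail ω ((1 + r) / 2)) := by gcongr; exact hd r hr'
    _ ≤ C * (D * (tail ν ((1 + r) / 2) * tail (divTail ω ν) ((1 + r) / 2))) := by
      gcongr; exact tail_le_mul_tail_divTail hω.1 hν h.1 ht
    _ ≤ C * (D * (tail ν r * tail (divTail ω ν) ((1 + r) / 2))) := by
      gcongr; exact hν.tail_antitone hr'.1 ht.2.le (by linarith [hr.2])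
    _ = _ := by ring

/-- Choose K so that ν̂ drops by the factor 2C + 1 between r and t = 1 - (1-r)/K. Then ω̂ at least
halves, so [r, t] carries half of ω̂(r). On [r, t] one has ω ≤ ν̂(r)σ, hence σ̂(r) - σ̂(t) ≥
ω̂(r)/(2ν̂(r)) ≥ σ̂(r)/(2C). -/
theorem TailCondition.lowerDoubling_divTail (hω : UpperDoubling ω) (hν : LowerDoubling ν)
    (h : TailCondition ω ν) : LowerDoubling (divTail ω ν) := by
  obtain ⟨C, hC, hle⟩ := h.exists_mul_le hω.1
  have hσ := isRadialWeight_divTail hω.1 hν.1 h.1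
  obtain ⟨K, hK, r₀, hr₀, hd⟩ := hν.exists_forall (2 * C + 1)
  -- The gain per step is `1 / (1 - 1 / (2 * C))`.
  have hq : 1 < 2 * C / (2 * C - 1) := by
    rw [one_lt_div (by linarith)]; linarith
  refine .of_forall hσ hK hq hr₀.2 fun r hr => ?_
  have hr' : r ∈ Ico (0 : ℝ) 1 := ⟨hr₀.1.trans hr.1.le, hr.2⟩
  have h2 : 0 < 1 - r := by linarith [hr.2]
  have h3 : (1 - r) / K ≤ 1 - r := div_le_self h2.le hK.le
  have h4 : 0 < (1 - r) / K := by positivity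
  set t := 1 - (1 - r) / K with ht
  have ht' : t ∈ Ico (0 : ℝ) 1 := ⟨by linarith [hr'.1], by linarith⟩
  have hrt : r ≤ t := by linarith
  have hνr := hν.1.tail_pos r hr'
  have hνt := hν.1.tail_pos t ht'
  have hσr := hσ.tail_pos r hr'
  have hσt := hσ.tail_pos t ht'
  have hωr := hω.1.tail_pos r hr'
  have hωt := hω.1.tail_pos t ht'
  have h5 := tail_le_mul_tail_divTail hω.1 hν.1 h.1 ht'
  have h6 : tail (divTail ω ν) t ≤ tail (divTail ω ν) r := hσ.tail_antitone hr'.1 ht'.2.le hrt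
  have h7 := hle r hr'
  have h8 := hd r hr
  have h9 := integral_le_mul_integral_divTail hω.1 hν.1 h.1 hr'.1 hrt ht'.2.le
  rw [← hω.1.tail_sub ⟨hr'.1, hr'.2.le⟩ ⟨ht'.1, ht'.2.le⟩,
    ← hσ.tail_sub ⟨hr'.1, hr'.2.le⟩ ⟨ht'.1, ht'.2.le⟩] at h9
  -- Otherwise ν̂(r)σ̂(r) ≤ C ω̂(r) < 2C ω̂(t) ≤ 2C ν̂(t)σ̂(r), against the drop of ν̂ by 2C + 1.
  have h10 : 2 * tail ω t ≤ tail ω r := by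
    by_contra! hcon
    have e1 : tail ν r * tail (divTail ω ν) r < 2 * C * (tail ν t * tail (divTail ω ν) r) := by
      calc _ ≤ C * tail ω r := h7
        _ < C * (2 * tail ω t) := by gcongr
        _ ≤ C * (2 * (tail ν t * tail (divTail ω ν) r)) := by
          gcongr
          exact h5.trans (by gcongr)
        _ = _ := by ring
    have e2 : (2 * C + 1) * tail ν t * tail (divTail ω ν) r ≤
        tail ν r * tail (divTail ω ν) r := by gcongr
    nlinarith [mul_pos hνt hσr]
  have h11 : tail ν r * tail (divTail ω ν) r ≤
      tail ν r * (2 * C * (tail (divTail ω ν) r - tail (divTail ω ν) t)) := by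
    nlinarith
  have h12 := le_of_mul_le_mul_left h11 hνr
  rw [div_mul_eq_mul_div, div_le_iff₀ (by linarith)]
  linarith

/-- Choose K so that at least half of σ̂(r) sits on [r, t], t = 1 - (1-r)/K. Upper doubling gives
ν̂(r) ≤ C ν̂(t), and ν̂(t) ∫_r^t σ ≤ ∫_r^t ω ≤ ω̂(r). Radii up to r₀ are handled by monotonicity. -/
theorem TailCondition.of_doubling (hω : IsRadialWeight ω) (hσ : LowerDoubling (divTail ω ν))
    (hν : UpperDoubling ν) : TailCondition ω ν := by
  refine ⟨hσ.1.integrableOn, ?_⟩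
  obtain ⟨K, hK, r₀, hr₀, hd⟩ := hσ.exists_forall 2
  obtain ⟨C, hC, hC'⟩ := hν.exists_forall_le hK.le
  have hp := hω.tail_pos r₀ hr₀
  refine ⟨max (2 * C) (tail ν 0 / tail ω r₀ * tail (divTail ω ν) 0), fun r hr => ?_⟩
  change tail ν r / tail ω r * tail (divTail ω ν) r ≤ _
  have hωr := hω.tail_pos r hr
  have hσr := hσ.1.tail_pos r hr
  have hν0 := hν.1.tail_pos 0 (by simp)
  rcases le_or_gt r r₀ with hle | hlt
  · refine le_max_of_le_right ?_
    gcongr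
    · exact hν.1.tail_antitone le_rfl hr.2.le hr.1
    · exact hω.tail_antitone hr.1 hr₀.2.le hle
    · exact hσ.1.tail_antitone le_rfl hr.2.le hr.1
  · refine le_max_of_le_left ?_
    have h2 : 0 < 1 - r := by linarith [hr.2]
    have h3 : (1 - r) / K ≤ 1 - r := div_le_self h2.le hK.le
    have h4 : 0 < (1 - r) / K := by positivity
    have h5 := hd r ⟨hlt, hr.2⟩
    have h6 := hC' r hr
    set t := 1 - (1 - r) / K with ht
    have ht' : t ∈ Ico (0 : ℝ) 1 := ⟨by linarith [hr.1], by linarith⟩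
    have hrt : r ≤ t := by linarith
    have hνt := hν.1.tail_pos t ht'
    have h9 := mul_integral_divTail_le_integral hω hν.1 hσ.1.integrableOn hr.1 hrt ht'.2.le
    rw [← hω.tail_sub ⟨hr.1, hr.2.le⟩ ⟨ht'.1, ht'.2.le⟩,
      ← hσ.1.tail_sub ⟨hr.1, hr.2.le⟩ ⟨ht'.1, ht'.2.le⟩] at h9
    have h10 := hω.tail_nonneg ⟨ht'.1, ht'.2.le⟩
    rw [div_mul_eq_mul_div, div_le_iff₀ hωr]
    calc tail ν r * tail (divTail ω ν) r ≤ C * tail ν t * tail (divTail ω ν) r := by gcongr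
      _ ≤ C * tail ν t * (2 * (tail (divTail ω ν) r - tail (divTail ω ν) t)) := by
        gcongr; linarith
      _ = 2 * C * (tail ν t * (tail (divTail ω ν) r - tail (divTail ω ν) t)) := by ring
      _ ≤ _ := by gcongr; linarith

/-- The tail condition makes ν and σ upper doubling, so their moments of order x are bounded by
their tails at 1 - 1/x. The order 2x on ω is harmless since ω_x ≲ ω_{2x}. -/
theorem TailCondition.momentCondition (hν : IsRadialWeight ν) (hω : UpperDoubling ω)
    (h : TailCondition ω ν) : MomentCondition ω ν := by
  have hσ := isRadialWeight_divTail hω.1 hν h.1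
  obtain ⟨C, hC, hle⟩ := h.exists_mul_le hω.1
  obtain ⟨C₁, hC₁, h₁⟩ := (h.upperDoubling hν hω).exists_moment_le_tail
  obtain ⟨C₂, hC₂, h₂⟩ := (h.upperDoubling_divTail hν hω).exists_moment_le_tail
  obtain ⟨D, hD, hd⟩ := hω.exists_moment_le_two_mul
  have hp := hω.1.moment_pos' (x := 4) (by norm_num)
  refine ⟨h.1, max (moment ν 0 / moment ω 4 * moment (divTail ω ν) 0)
    (C₁ * C₂ * C * (Real.exp 2 * D)), fun x hx => ?_⟩
  have hp' := hω.1.moment_pos' (x := 2 * x) (by linarith)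
  have hσx := hσ.moment_pos' hx
  rcases le_or_gt x 2 with hx2 | hx2
  · refine le_max_of_le_left ?_
    have := (hν.moment_pos' le_rfl).le
    gcongr
    · exact hν.moment_antitone le_rfl hx
    · exact hω.1.moment_antitone (by linarith) (by linarith)
    · exact hσ.moment_antitone le_rfl hx
  · refine le_max_of_le_right ?_
    have hi : 1 / x ≤ 1 := by rw [div_le_one (by linarith)]; linarith
    have hi0 : 0 < 1 / x := by positivity
    have hr : 1 - 1 / x ∈ Ico (0 : ℝ) 1 := ⟨by linarith, by linarith⟩
    have hνr := hν.tail_pos _ hr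
    rw [div_mul_eq_mul_div, div_le_iff₀ hp']
    calc moment ν x * moment (divTail ω ν) x
        ≤ (C₁ * tail ν (1 - 1 / x)) * (C₂ * tail (divTail ω ν) (1 - 1 / x)) := by
          gcongr
          · exact h₁ x (by linarith)
          · exact h₂ x (by linarith)
      _ = C₁ * C₂ * (tail ν (1 - 1 / x) * tail (divTail ω ν) (1 - 1 / x)) := by ring
      _ ≤ C₁ * C₂ * (C * (Real.exp 2 * (D * moment ω (2 * x)))) := by
          refine mul_le_mul_of_nonneg_left ?_ (by positivity)
          refine (hle _ hr).trans ?_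
          gcongr
          exact (hω.1.tail_le_moment hx2.le).trans (by gcongr; exact hd x hx)
      _ = _ := by ring

/-- Take x = 1/(1-r). For ν and σ only the elementary bound of tails by moments is used; the hard
converse is needed for ω alone, where it is available by hypothesis. -/
theorem MomentCondition.tailCondition (hν : IsRadialWeight ν) (hω : UpperDoubling ω)
    (h : MomentCondition ω ν) : TailCondition ω ν := by
  obtain ⟨hint, C, hle⟩ := h
  have hσ := isRadialWeight_divTail hω.1 hν hint
  obtain ⟨D, hD, hd⟩ := hω.exists_moment_le_tail
  have hp := hω.1.tail_pos (1 / 2) (by norm_num)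
  have hν0 := hν.tail_pos 0 (by simp)
  have hC : 0 ≤ C := by
    refine le_trans ?_ (hle 0 le_rfl)
    have h1 := hν.moment_pos' le_rfl
    have h2 := hω.1.moment_pos' (x := 2 * 0) (by simp)
    have h3 := hσ.moment_pos' le_rfl
    positivity
  refine ⟨hint, max (tail ν 0 / tail ω (1 / 2) * tail (divTail ω ν) 0)
    (Real.exp 2 * Real.exp 2 * (C * D)), fun r hr => ?_⟩
  change tail ν r / tail ω r * tail (divTail ω ν) r ≤ _
  have hωr := hω.1.tail_pos r hr
  have hσr := hσ.tail_pos r hr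
  have hνr := hν.tail_pos r hr
  rcases le_or_gt r (1 / 2) with hr2 | hr2
  · refine le_max_of_le_left ?_
    gcongr
    · exact hν.tail_antitone le_rfl hr.2.le hr.1
    · exact hω.1.tail_antitone hr.1 (by norm_num) hr2
    · exact hσ.tail_antitone le_rfl hr.2.le hr.1
  · refine le_max_of_le_right ?_
    have h1 : 0 < 1 - r := by linarith [hr.2]
    obtain ⟨x, hx⟩ : ∃ x, x = 1 / (1 - r) := ⟨_, rfl⟩
    have hx2 : 2 ≤ x := by rw [hx, le_div_iff₀ h1]; linarith
    have hxr : 1 - 1 / x = r := by rw [hx]; simp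
    have e1 := hν.tail_le_moment hx2
    have e2 := hσ.tail_le_moment hx2
    have e3 := hd x (by linarith)
    have e4 := hle x (by linarith)
    have e5 := hω.1.moment_antitone (x := x) (y := 2 * x) (by linarith) (by linarith)
    have hp' := hω.1.moment_pos' (x := 2 * x) (by linarith)
    have hν' := hν.moment_pos' (x := x) (by linarith)
    rw [hxr] at e1 e2 e3
    rw [div_mul_eq_mul_div, div_le_iff₀ hp'] at e4
    rw [div_mul_eq_mul_div, div_le_iff₀ hωr]
    calc tail ν r * tail (divTail ω ν) r
        ≤ (Real.exp 2 * moment ν x) * (Real.exp 2 * moment (divTail ω ν) x) := by gcongr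
      _ = Real.exp 2 * Real.exp 2 * (moment ν x * moment (divTail ω ν) x) := by ring
      _ ≤ Real.exp 2 * Real.exp 2 * (C * (D * tail ω r)) := by
          refine mul_le_mul_of_nonneg_left ?_ (by positivity)
          exact e4.trans (by gcongr; exact e5.trans e3)
      _ = _ := by ring

end DivTail

/-! ### Power series with slowly varying coefficients. -/

/-- One summation by parts: multiplying by 1 - u replaces the coefficients by their differences. -/
theorem one_sub_mul_tsum {c : ℕ → ℂ} {u : ℂ} (hu : ‖u‖ < 1)
    (hc : Summable fun n => c n * u ^ n) :
    (Summable fun n => (c (n + 1) - c n) * u ^ n) ∧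
      (1 - u) * ∑' n, c n * u ^ n = c 0 + u * ∑' n, (c (n + 1) - c n) * u ^ n := by
  rcases eq_or_ne u 0 with rfl | hu0
  · refine ⟨summable_of_ne_finset_zero (s := {0}) fun n hn => ?_, ?_⟩
    · rw [zero_pow (by simpa using hn), mul_zero]
    · rw [tsum_eq_single 0 fun n hn => by rw [zero_pow hn, mul_zero]]
      simp
  have h1 : Summable fun n => c (n + 1) * u ^ n := by
    have := (summable_nat_add_iff 1).2 hc
    refine (this.mul_left u⁻¹).congr fun n => ?_
    rw [pow_succ]
    field_simp
  have h2 : (fun n => (c (n + 1) - c n) * u ^ n) = fun n => c (n + 1) * u ^ n - c n * u ^ n := by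
    ext n; ring
  rw [h2]
  refine ⟨h1.sub hc, ?_⟩
  rw [h1.tsum_sub hc, mul_sub]
  have h3 : u * ∑' n, c (n + 1) * u ^ n = ∑' n, c (n + 1) * u ^ (n + 1) := by
    rw [← tsum_mul_left]
    refine tsum_congr fun n => ?_
    ring
  have h4 := hc.tsum_eq_zero_add
  simp only [pow_zero, mul_one] at h4
  rw [h3]
  linear_combination h4

/-- A power series with slowly varying positive coefficients is controlled by the sum of the
absolute values of its terms, localized to indices `n ≲ 1 / ‖1 - u‖`. -/
theorem norm_tsum_le_of_slowly_varying {b : ℕ → ℝ} {A : ℝ} (hb : ∀ n, 0 ≤ b n)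
    (hA : 0 ≤ A) (hdbl : ∀ n N, n ≤ N → N ≤ 2 * n + 1 → b N ≤ A * b n)
    (h1 : ∀ n, |b (n + 1) - b n| ≤ A * b n / (n + 1))
    (h2 : ∀ n, |b (n + 2) - 2 * b (n + 1) + b n| ≤ A * b n / (n + 1) ^ 2)
    {u : ℂ} (hu : ‖u‖ < 1) (hs : Summable fun n => b n * ‖u‖ ^ n) :
    ‖∑' n, (b n : ℂ) * u ^ n‖ ≤
      (10 + 20 * A * (1 + A) + 2 * A) *
        ∑' n : ℕ, b n * ‖u‖ ^ n / (1 + (n + 1) ^ 2 * ‖1 - u‖ ^ 2) := by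
  set ρ := ‖u‖ with hρ
  set δ := ‖1 - u‖ with hδ
  have hρ0 : 0 ≤ ρ := norm_nonneg u
  have hδ0 : 0 < δ := by
    refine norm_pos_iff.2 fun h => ?_
    rw [sub_eq_zero] at h
    rw [hρ, ← h, norm_one] at hu
    exact lt_irrefl _ hu
  have hδ2 : δ ≤ 2 := by
    calc δ ≤ ‖(1 : ℂ)‖ + ‖u‖ := norm_sub_le _ _
      _ ≤ 2 := by rw [norm_one]; linarith
  set w : ℕ → ℝ := fun n => b n * ρ ^ n / (1 + (n + 1) ^ 2 * δ ^ 2) with hw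
  have hw0 : ∀ n, 0 ≤ w n := fun n => by have := hb n; positivity
  have hws : Summable w := by
    refine Summable.of_nonneg_of_le hw0 (fun n => ?_) hs
    have := hb n
    exact div_le_self (by positivity) (by nlinarith [mul_nonneg (sq_nonneg ((n : ℝ) + 1)) (sq_nonneg δ)])
  -- The cutoff at which (n+1)δ reaches size 1. Up to N the denominator 1 + (n+1)²δ² of `w` is at
  -- most 10; from N on it is at most 2(n+1)²δ².
  set N := ⌊1 / δ⌋₊ with hN
  have hN1 : (N : ℝ) ≤ 1 / δ := Nat.floor_le (by positivity)
  have hN2 : 1 / δ < N + 1 := Nat.lt_floor_add_one _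
  have hN1' : N * δ ≤ 1 := by rwa [le_div_iff₀ hδ0] at hN1
  have hN2' : 1 < (N + 1) * δ := by rwa [div_lt_iff₀ hδ0] at hN2
  -- indices up to `N`
  have hlow : ∀ n ≤ N, b n * ρ ^ n ≤ 10 * w n := by
    intro n hn
    have h3 : ((n : ℝ) + 1) * δ ≤ 3 := by
      have : (n : ℝ) * δ ≤ N * δ := by gcongr
      linarith
    have h4 : ((n : ℝ) + 1) ^ 2 * δ ^ 2 ≤ 9 := by
      rw [← mul_pow]
      have : 0 ≤ ((n : ℝ) + 1) * δ := by positivity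
      nlinarith
    have := hb n
    rw [hw, mul_div_assoc', le_div_iff₀ (by positivity)]
    have : 0 ≤ b n * ρ ^ n := by positivity
    nlinarith
  have hhigh : ∀ n, N ≤ n → b n * ρ ^ n / (n + 1) ^ 2 ≤ 2 * δ ^ 2 * w n := by
    intro n hn
    have h3 : 1 ≤ ((n : ℝ) + 1) * δ := by
      have : (N : ℝ) * δ ≤ n * δ := by gcongr
      linarith
    have h4 : 1 ≤ ((n : ℝ) + 1) ^ 2 * δ ^ 2 := by
      rw [← mul_pow]
      exact one_le_pow₀ h3
    have := hb n
    rw [hw, mul_div_assoc', div_le_div_iff₀ (by positivity) (by positivity)]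
    have : 0 ≤ b n * ρ ^ n := by positivity
    nlinarith
  -- The boundary term at N is spread over the indices from N - N/2 to N: by doubling each of them
  -- carries at least a fixed fraction of b_N ρ^N, and there are at least (N+1)/2 of them.
  have hbdry : (N + 1) * (b N * ρ ^ N) ≤ 20 * A * ∑' n, w n := by
    have h3 : ∀ n ∈ Finset.Icc (N - N / 2) N, b N * ρ ^ N ≤ 10 * A * w n := by
      intro n hn
      rw [Finset.mem_Icc] at hn
      calc b N * ρ ^ N ≤ (A * b n) * ρ ^ n := by
            have := hb n
            gcongr ?_ * ?_
            · exact hdbl n N hn.2 (by omega)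
            · exact pow_le_pow_of_le_one hρ0 hu.le hn.2
        _ = A * (b n * ρ ^ n) := by ring
        _ ≤ A * (10 * w n) := mul_le_mul_of_nonneg_left (hlow n hn.2) hA
        _ = _ := by ring
    have h4 := Finset.sum_le_sum h3
    rw [Finset.sum_const, ← Finset.mul_sum, Nat.card_Icc, nsmul_eq_mul] at h4
    have h5 : ((N : ℝ) + 1) / 2 ≤ ((N + 1 - (N - N / 2) : ℕ) : ℝ) := by
      rw [div_le_iff₀ two_pos]
      exact_mod_cast (by omega : N + 1 ≤ (N + 1 - (N - N / 2)) * 2)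
    have h6 : ∑ n ∈ Finset.Icc (N - N / 2) N, w n ≤ ∑' n, w n := hws.sum_le_tsum _ fun n _ => hw0 n
    have h7 : 0 ≤ b N * ρ ^ N := by have := hb N; positivity
    calc (N + 1) * (b N * ρ ^ N) = 2 * (((N : ℝ) + 1) / 2 * (b N * ρ ^ N)) := by ring
      _ ≤ 2 * (((N + 1 - (N - N / 2) : ℕ) : ℝ) * (b N * ρ ^ N)) := by gcongr
      _ ≤ 2 * (10 * A * ∑' n, w n) := by
        refine mul_le_mul_of_nonneg_left (h4.trans ?_) two_pos.le
        gcongr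
      _ = _ := by ring
  have hsc : Summable fun n => (b n : ℂ) * u ^ n := by
    refine Summable.of_norm (hs.congr fun n => ?_)
    rw [norm_mul, norm_pow, Complex.norm_real, Real.norm_of_nonneg (hb n)]
  rw [← hsc.sum_add_tsum_nat_add N]
  have hhead : ‖∑ n ∈ Finset.range N, (b n : ℂ) * u ^ n‖ ≤ 10 * ∑' n, w n := by
    calc _ ≤ ∑ n ∈ Finset.range N, 10 * w n := by
          refine norm_sum_le_of_le _ fun n hn => ?_
          rw [norm_mul, norm_pow, Complex.norm_real, Real.norm_of_nonneg (hb n)]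
          exact hlow n (Finset.mem_range.1 hn).le
      _ ≤ _ := by
          rw [← Finset.mul_sum]
          gcongr
          exact hws.sum_le_tsum _ fun n _ => hw0 n
  -- the tail, by summation by parts
  set c : ℕ → ℂ := fun k => (b (k + N) : ℂ) with hc
  have htail : ∑' k, (b (k + N) : ℂ) * u ^ (k + N) = u ^ N * ∑' k, c k * u ^ k := by
    rw [← tsum_mul_left]
    refine tsum_congr fun k => ?_
    rw [pow_add]; ring
  have hcs : Summable fun k => c k * u ^ k := by
    rcases eq_or_ne u 0 with hu0 | hu0
    · refine summable_of_ne_finset_zero (s := {0}) fun n hn => ?_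
      rw [hu0, zero_pow (by simpa using hn), mul_zero]
    · have := ((summable_nat_add_iff N).2 hsc).mul_left (u ^ N)⁻¹
      refine this.congr fun k => ?_
      rw [pow_add, hc]
      field_simp
  obtain ⟨hs1, e1⟩ := one_sub_mul_tsum hu hcs
  obtain ⟨hs2, e2⟩ := one_sub_mul_tsum hu hs1
  set T := ∑' k, c k * u ^ k with hT
  set R := ∑' k, (c (k + 1 + 1) - c (k + 1) - (c (k + 1) - c k)) * u ^ k with hR
  -- Two summations by parts started at N: two boundary terms and a remainder built from second
  -- differences. The factor (1-u)² is compensated by the decay (n+1)^(-2) of these differences.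
  have e3 : (1 - u) ^ 2 * (u ^ N * T) = u ^ N * (1 - u) * c 0 + u ^ (N + 1) * (c 1 - c 0) +
      u ^ (N + 2) * R := by
    have e2' : (1 - u) * ∑' n, (c (n + 1) - c n) * u ^ n = c 1 - c 0 + u * R := e2
    linear_combination (u ^ N * (1 - u)) * e1 + u ^ (N + 1) * e2'
  have hRle : ρ ^ N * ‖R‖ ≤ 2 * A * δ ^ 2 * ∑' n, w n := by
    have hterm : ∀ k, ‖(c (k + 1 + 1) - c (k + 1) - (c (k + 1) - c k)) * u ^ k‖ * ρ ^ N ≤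
        2 * A * δ ^ 2 * w (k + N) := by
      intro k
      have h3 : c (k + 1 + 1) - c (k + 1) - (c (k + 1) - c k) =
          ((b (k + N + 2) - 2 * b (k + N + 1) + b (k + N) : ℝ) : ℂ) := by
        simp only [hc]
        rw [show k + 1 + 1 + N = k + N + 2 by ring, show k + 1 + N = k + N + 1 by ring]
        push_cast
        ring
      rw [h3, norm_mul, norm_pow, Complex.norm_real, Real.norm_eq_abs]
      have h4 := h2 (k + N)
      have h5 := hhigh (k + N) (by omega)
      calc _ ≤ A * b (k + N) / (((k + N : ℕ) : ℝ) + 1) ^ 2 * ρ ^ k * ρ ^ N := by gcongr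
        _ = A * (b (k + N) * ρ ^ (k + N) / (((k + N : ℕ) : ℝ) + 1) ^ 2) := by rw [pow_add]; ring
        _ ≤ A * (2 * δ ^ 2 * w (k + N)) := by gcongr
        _ = _ := by ring
    have hwN : Summable fun k => w (k + N) := (summable_nat_add_iff N).2 hws
    have h6 : ∑' k, w (k + N) ≤ ∑' n, w n := by
      rw [← hws.sum_add_tsum_nat_add N]
      have := Finset.sum_nonneg (s := Finset.range N) fun n _ => hw0 n
      linarith
    have h7 : ‖u ^ N * R‖ ≤ ∑' k, 2 * A * δ ^ 2 * w (k + N) := by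
      rw [hR, ← tsum_mul_left]
      refine tsum_of_norm_bounded (hwN.mul_left _).hasSum fun k => ?_
      rw [norm_mul, norm_pow, mul_comm]
      exact hterm k
    rw [norm_mul, norm_pow, tsum_mul_left] at h7
    exact h7.trans (by gcongr)
  have h0 : ‖c 0‖ = b N := by
    simp only [hc, zero_add, Complex.norm_real, Real.norm_of_nonneg (hb N)]
  have h01 : ‖c 1 - c 0‖ ≤ A * b N / (N + 1) := by
    simp only [hc, zero_add]
    rw [← Complex.ofReal_sub, Complex.norm_real, Real.norm_eq_abs, add_comm 1 N]
    exact h1 N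
  have hTle : ‖u ^ N * T‖ ≤ (20 * A * (1 + A) + 2 * A) * ∑' n, w n := by
    refine le_of_mul_le_mul_left ?_ (show 0 < δ ^ 2 by positivity)
    have hW : 0 ≤ ∑' n, w n := tsum_nonneg hw0
    have hbN := hb N
    -- As (N+1)δ > 1, both δ and 1/(N+1) are at most δ²(N+1), the form in which `hbdry` applies to
    -- the boundary terms.
    have hδ1 : δ ≤ δ ^ 2 * (N + 1) := by nlinarith
    have h1N : 1 / ((N : ℝ) + 1) ≤ δ ^ 2 * (N + 1) := by
      rw [div_le_iff₀ (by positivity)]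
      nlinarith
    calc δ ^ 2 * ‖u ^ N * T‖ = ‖(1 - u) ^ 2 * (u ^ N * T)‖ := by
          rw [norm_mul ((1 - u) ^ 2), norm_pow]
      _ ≤ ρ ^ N * δ * b N + ρ ^ (N + 1) * (A * b N / (N + 1)) + ρ ^ (N + 2) * ‖R‖ := by
          rw [e3]
          refine (norm_add₃_le).trans ?_
          simp only [norm_mul, norm_pow, h0]
          gcongr
      _ ≤ ρ ^ N * (δ ^ 2 * (N + 1)) * b N + ρ ^ N * (A * b N * (δ ^ 2 * (N + 1))) +
          ρ ^ N * ‖R‖ := by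
          refine add_le_add (add_le_add (by gcongr) ?_) ?_
          · rw [div_eq_mul_one_div]
            refine mul_le_mul (pow_le_pow_of_le_one hρ0 hu.le (by omega)) ?_ (by positivity)
              (by positivity)
            gcongr
          · exact mul_le_mul_of_nonneg_right (pow_le_pow_of_le_one hρ0 hu.le (by omega))
              (norm_nonneg _)
      _ = δ ^ 2 * (1 + A) * ((N + 1) * (b N * ρ ^ N)) + ρ ^ N * ‖R‖ := by ring
      _ ≤ δ ^ 2 * (1 + A) * (20 * A * ∑' n, w n) + 2 * A * δ ^ 2 * ∑' n, w n := by gcongr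
      _ = _ := by ring
  rw [htail]
  calc _ ≤ 10 * ∑' n, w n + (20 * A * (1 + A) + 2 * A) * ∑' n, w n :=
        (norm_add_le _ _).trans (add_le_add hhead hTle)
    _ = _ := by ring

/-! ### Differences of moments and of the kernel coefficients. -/

/-- A factor 1 - s is traded for a power s^p at the price 1/p: s^p ≤ exp(-p(1-s)) and y ≤ exp(y). -/
theorem mul_one_sub_mul_rpow_le {p s : ℝ} (hp : 0 ≤ p) (hs : s ∈ Ioo (0 : ℝ) 1) :
    p * (1 - s) * s ^ p ≤ 1 := by
  have h1 : p * (1 - s) ≤ Real.exp (p * (1 - s)) := by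
    linarith [Real.add_one_le_exp (p * (1 - s))]
  have h2 : s ^ p ≤ Real.exp (-(p * (1 - s))) := by
    rw [Real.rpow_def_of_pos hs.1]
    refine Real.exp_le_exp.2 ?_
    nlinarith [Real.log_le_sub_one_of_pos hs.1]
  calc p * (1 - s) * s ^ p ≤ Real.exp (p * (1 - s)) * Real.exp (-(p * (1 - s))) :=
        mul_le_mul h1 h2 (Real.rpow_nonneg hs.1.le _) (Real.exp_pos _).le
    _ = 1 := by rw [← Real.exp_add]; simp

/-- The integrand contains 1 - s² = (1+s)(1-s), and half of the power s^x pays for 1 - s. -/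
theorem IsRadialWeight.moment_sub_le {ω : ℝ → ℝ} (h : IsRadialWeight ω) {x : ℝ} (hx : 0 < x) :
    moment ω x - moment ω (x + 2) ≤ 8 / x * moment ω (x / 2) := by
  rw [moment_eq_setIntegral, moment_eq_setIntegral, moment_eq_setIntegral,
    ← integral_sub (h.integrableOn_rpow_mul hx.le) (h.integrableOn_rpow_mul (by linarith)),
    ← integral_const_mul]
  refine setIntegral_mono_on ((h.integrableOn_rpow_mul hx.le).sub
    (h.integrableOn_rpow_mul (by linarith))) ((h.integrableOn_rpow_mul (by linarith)).const_mul _)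
    measurableSet_Ioo fun s hs => ?_
  have hω := h.nonneg s ⟨hs.1.le, hs.2⟩
  rw [← sub_mul, ← mul_assoc]
  refine mul_le_mul_of_nonneg_right ?_ hω
  have h1 := mul_one_sub_mul_rpow_le (p := x / 2) (by linarith) hs
  have h2 : s ^ x = s ^ (x / 2) * s ^ (x / 2) := by rw [← Real.rpow_add hs.1]; ring_nf
  have h3 : s ^ (x + 2) = s ^ x * s ^ 2 := by rw [Real.rpow_add hs.1, Real.rpow_two]
  have h4 : 0 < s ^ (x / 2) := Real.rpow_pos_of_pos hs.1 _
  have h5 : (1 - s) * s ^ (x / 2) ≤ 2 / x := by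
    rw [le_div_iff₀ hx]; linarith
  rw [h3, h2]
  set y := s ^ (x / 2)
  calc y * y - y * y * s ^ 2 = (1 + s) * ((1 - s) * y) * y := by ring
    _ ≤ 4 * (2 / x) * y := by
      gcongr
      · exact mul_nonneg (by linarith [hs.2]) h4.le
      · linarith [hs.2]
    _ = _ := by ring

/-- The second difference has the integrand s^x (1-s²)². Each of the two factors 1 - s is paid for
by s^(x/4), leaving s^(x/2). -/
theorem IsRadialWeight.abs_moment_second_difference_le {ω : ℝ → ℝ} (h : IsRadialWeight ω) {x : ℝ}
    (hx : 0 < x) :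
    |moment ω x - 2 * moment ω (x + 2) + moment ω (x + 4)| ≤ 64 / x ^ 2 * moment ω (x / 2) := by
  have i0 := h.integrableOn_rpow_mul hx.le
  have i2 := h.integrableOn_rpow_mul (x := x + 2) (by linarith)
  have i4 := h.integrableOn_rpow_mul (x := x + 4) (by linarith)
  have ih := h.integrableOn_rpow_mul (x := x / 2) (by linarith)
  rw [moment_eq_setIntegral, moment_eq_setIntegral, moment_eq_setIntegral, moment_eq_setIntegral,
    ← integral_const_mul, ← integral_sub i0 (i2.const_mul _)]
  have hadd := integral_add (i0.sub (i2.const_mul 2)) i4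
  simp only [Pi.sub_apply] at hadd
  rw [← hadd, ← integral_const_mul]
  refine (abs_integral_le_integral_abs).trans ?_
  refine setIntegral_mono_on ((i0.sub (i2.const_mul _)).add i4).abs (ih.const_mul _)
    measurableSet_Ioo fun s hs => ?_
  have hω := h.nonneg s ⟨hs.1.le, hs.2⟩
  have h1 := mul_one_sub_mul_rpow_le (p := x / 4) (by linarith) hs
  have h2 : s ^ (x / 2) = s ^ (x / 4) * s ^ (x / 4) := by rw [← Real.rpow_add hs.1]; ring_nf
  have h2' : s ^ x = s ^ (x / 2) * s ^ (x / 2) := by rw [← Real.rpow_add hs.1]; ring_nf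
  have h3 : s ^ (x + 2) = s ^ x * s ^ 2 := by rw [Real.rpow_add hs.1, Real.rpow_two]
  have h3' : s ^ (x + 4) = s ^ x * s ^ 4 := by
    rw [Real.rpow_add hs.1]; norm_cast
  have h4 : 0 < s ^ (x / 4) := Real.rpow_pos_of_pos hs.1 _
  have h5 : (1 - s) * s ^ (x / 4) ≤ 4 / x := by
    rw [le_div_iff₀ hx]; linarith
  rw [h3, h3', h2', h2]
  set y := s ^ (x / 4)
  have h6 : 0 ≤ (1 - s) * y := mul_nonneg (by linarith [hs.2]) h4.le
  have e : y * y * (y * y) * ω s - 2 * (y * y * (y * y) * s ^ 2 * ω s) +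
      y * y * (y * y) * s ^ 4 * ω s = (1 + s) ^ 2 * ((1 - s) * y) ^ 2 * (y * y * ω s) := by ring
  rw [e, abs_of_nonneg (by positivity)]
  calc (1 + s) ^ 2 * ((1 - s) * y) ^ 2 * (y * y * ω s) ≤ 2 ^ 2 * (4 / x) ^ 2 * (y * y * ω s) := by
        gcongr
        · linarith [hs.1]
        · linarith [hs.2]
    _ = _ := by ring

/-- The coefficients of the Bergman kernel. -/
noncomputable def kernelCoeff (ω : ℝ → ℝ) (n : ℕ) : ℝ := 1 / (2 * moment ω (2 * n + 1))

theorem IsRadialWeight.kernelCoeff_pos {ω : ℝ → ℝ} (h : IsRadialWeight ω) (n : ℕ) :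
    0 < kernelCoeff ω n := by
  have := h.moment_pos n
  rw [kernelCoeff]
  positivity

/-- The estimates for differences of moments lose half of the exponent, which upper doubling
restores. Passing to reciprocals uses that moments of comparable order are comparable. -/
theorem UpperDoubling.exists_kernelCoeff_bounds {ω : ℝ → ℝ} (h : UpperDoubling ω) :
    ∃ A : ℝ, 0 ≤ A ∧
      (∀ n N, n ≤ N → N ≤ 2 * n + 1 → kernelCoeff ω N ≤ A * kernelCoeff ω n) ∧
      (∀ n : ℕ, |kernelCoeff ω (n + 1) - kernelCoeff ω n| ≤ A * kernelCoeff ω n / (n + 1)) ∧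
      ∀ n : ℕ, |kernelCoeff ω (n + 2) - 2 * kernelCoeff ω (n + 1) + kernelCoeff ω n| ≤
        A * kernelCoeff ω n / (n + 1) ^ 2 := by
  obtain ⟨D, hD, hd⟩ := h.exists_moment_le_two_mul
  have hω := h.1
  have hm : ∀ n : ℕ, 0 < moment ω (2 * n + 1) := hω.moment_pos
  have hdbl : ∀ n N : ℕ, N ≤ 2 * n + 1 → moment ω (2 * n + 1) ≤ D * D * moment ω (2 * N + 1) := by
    intro n N hN
    have hN' : (N : ℝ) ≤ 2 * n + 1 := by exact_mod_cast hN
    calc moment ω (2 * n + 1) ≤ D * (D * moment ω (2 * (2 * (2 * n + 1)))) :=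
          (hd _ (by positivity)).trans (by gcongr; exact hd _ (by positivity))
      _ ≤ D * (D * moment ω (2 * N + 1)) := by
          gcongr
          exact hω.moment_antitone (by positivity) (by linarith)
      _ = _ := by ring
  have hinv : ∀ n N : ℕ, N ≤ 2 * n + 1 →
      1 / moment ω (2 * N + 1) ≤ D * D * (1 / moment ω (2 * n + 1)) := by
    intro n N hN
    rw [mul_one_div, div_le_div_iff₀ (hm N) (hm n), one_mul]
    exact hdbl n N hN
  have hk : ∀ n, kernelCoeff ω n = 1 / 2 * (1 / moment ω (2 * n + 1)) := fun n => by
    rw [kernelCoeff]; field_simp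
  have hhalf : ∀ n : ℕ, moment ω ((2 * n + 1) / 2) ≤ D * moment ω (2 * n + 1) := by
    intro n
    refine (hd _ (by positivity)).trans_eq ?_
    ring_nf
  have hp0 : ∀ n : ℕ, 0 ≤ moment ω (2 * n + 1) - moment ω (2 * (n + 1 : ℕ) + 1) := fun n => by
    rw [sub_nonneg]
    exact hω.moment_antitone (by positivity) (by push_cast; linarith)
  have hp : ∀ n : ℕ, moment ω (2 * n + 1) - moment ω (2 * (n + 1 : ℕ) + 1) ≤
      64 * D * moment ω (2 * n + 1) / (n + 1) := by
    intro n
    have h1 := hω.moment_sub_le (x := 2 * n + 1) (by positivity)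
    rw [show (2 : ℝ) * n + 1 + 2 = 2 * (n + 1 : ℕ) + 1 by push_cast; ring] at h1
    refine h1.trans ?_
    have := hm n
    calc 8 / (2 * (n : ℝ) + 1) * moment ω ((2 * n + 1) / 2)
        ≤ 64 / ((n : ℝ) + 1) * (D * moment ω (2 * n + 1)) := by
          gcongr
          · exact (hω.moment_pos' (by positivity)).le
          · norm_num
          · linarith [(Nat.cast_nonneg n : (0 : ℝ) ≤ n)]
          · exact hhalf n
      _ = _ := by ring
  have hq : ∀ n : ℕ, |moment ω (2 * n + 1) - 2 * moment ω (2 * (n + 1 : ℕ) + 1) +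
      moment ω (2 * (n + 2 : ℕ) + 1)| ≤ 64 * D * moment ω (2 * n + 1) / (n + 1) ^ 2 := by
    intro n
    have h1 := hω.abs_moment_second_difference_le (x := 2 * n + 1) (by positivity)
    rw [show (2 : ℝ) * n + 1 + 2 = 2 * (n + 1 : ℕ) + 1 by push_cast; ring,
      show (2 : ℝ) * n + 1 + 4 = 2 * (n + 2 : ℕ) + 1 by push_cast; ring] at h1
    refine h1.trans ?_
    have := hm n
    calc 64 / (2 * (n : ℝ) + 1) ^ 2 * moment ω ((2 * n + 1) / 2)
        ≤ 64 / ((n : ℝ) + 1) ^ 2 * (D * moment ω (2 * n + 1)) := by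
          gcongr
          · exact (hω.moment_pos' (by positivity)).le
          · linarith [(Nat.cast_nonneg n : (0 : ℝ) ≤ n)]
          · exact hhalf n
      _ = _ := by ring
  set E := D * D with hE
  have hE1 : 1 ≤ E := by nlinarith
  set F := 64 * D with hF
  have hF1 : 1 ≤ F := by linarith
  -- F controls the differences of moments and E the ratio of neighbouring reciprocals. The second
  -- difference is the worst case: F + 2F² from its numerator, E from 1/m₁ and E² from 1/m₂.
  refine ⟨E * E * E * (F + 2 * F * F), by positivity, fun n N _ hN => ?_, fun n => ?_, fun n => ?_⟩
  · rw [hk, hk]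
    have h1 := hinv n N hN
    have h2 : 0 < 1 / moment ω (2 * n + 1) := by have := hm n; positivity
    have h3 : E ≤ E * E * E * (F + 2 * F * F) := by
      have : 1 ≤ E * E * (F + 2 * F * F) := by nlinarith
      nlinarith
    nlinarith
  · rw [hk, hk]
    have h1 := hinv n (n + 1) (by omega)
    have a0 := hm n
    have a1 := hm (n + 1)
    have e : 1 / 2 * (1 / moment ω (2 * (n + 1 : ℕ) + 1)) - 1 / 2 * (1 / moment ω (2 * n + 1)) =
        1 / 2 * ((moment ω (2 * n + 1) - moment ω (2 * (n + 1 : ℕ) + 1)) *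
          (1 / moment ω (2 * n + 1)) * (1 / moment ω (2 * (n + 1 : ℕ) + 1))) := by
      field_simp
    rw [e, abs_of_nonneg (by have := hp0 n; positivity)]
    calc _ ≤ 1 / 2 * ((F * moment ω (2 * n + 1) / (n + 1)) *
          (1 / moment ω (2 * n + 1)) * (E * (1 / moment ω (2 * n + 1)))) := by
          gcongr
          exact hp n
      _ = E * F * (1 / 2 * (1 / moment ω (2 * n + 1))) / (n + 1) := by field_simp
      _ ≤ _ := by
          have : 1 ≤ E * E := by nlinarith
          refine div_le_div_of_nonneg_right (mul_le_mul_of_nonneg_right ?_ (by positivity))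
            (by positivity)
          calc E * F ≤ E * (E * E) * (F + 2 * F * F) := by
                gcongr
                · exact le_mul_of_one_le_right (by linarith) this
                · nlinarith
            _ = _ := by ring
  · rw [hk, hk, hk]
    have h1 := hinv n (n + 1) (by omega)
    have h2 := hinv (n + 1) (n + 2) (by omega)
    have h3 := hdbl n (n + 1) (by omega)
    have a0 := hm n
    have a1 := hm (n + 1)
    have a2 := hm (n + 2)
    have p0 := hp n
    have p1 := hp (n + 1)
    have p0' := hp0 n
    have p1' := hp0 (n + 1)
    have q0 := hq n
    rw [show n + 1 + 1 = n + 2 by ring] at p1 p1'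
    set m₀ := moment ω (2 * n + 1)
    set m₁ := moment ω (2 * (n + 1 : ℕ) + 1)
    set m₂ := moment ω (2 * (n + 2 : ℕ) + 1)
    have p1'' : m₁ - m₂ ≤ F * m₀ / (n + 1) := by
      refine p1.trans ?_
      gcongr
      · linarith
      · exact_mod_cast n.le_succ
    -- Over a common denominator the second difference of 1/m is the second difference of m times
    -- m₀, plus a product of two first differences. Both parts are of order m₀²/(n+1)².
    have e : 1 / 2 * (1 / m₂) - 2 * (1 / 2 * (1 / m₁)) + 1 / 2 * (1 / m₀) =
        1 / 2 * ((-(m₀ - 2 * m₁ + m₂) * m₀ + (m₀ - m₁) * ((m₀ - m₁) + (m₁ - m₂))) *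
          (1 / m₀) * (1 / m₁) * (1 / m₂)) := by
      field_simp
      ring
    have hnum : |-(m₀ - 2 * m₁ + m₂) * m₀ + (m₀ - m₁) * ((m₀ - m₁) + (m₁ - m₂))| ≤
        (F + 2 * F * F) * m₀ ^ 2 / (n + 1) ^ 2 := by
      refine (abs_add_le _ _).trans ?_
      rw [abs_mul, abs_neg, abs_of_pos a0,
        abs_of_nonneg (mul_nonneg p0' (add_nonneg p0' p1'))]
      calc _ ≤ F * m₀ / (n + 1) ^ 2 * m₀ +
            (F * m₀ / (n + 1)) * (F * m₀ / (n + 1) + F * m₀ / (n + 1)) := by gcongr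
        _ = _ := by field_simp; ring
    rw [e, abs_mul, abs_mul, abs_mul, abs_mul, abs_of_pos (show (0 : ℝ) < 1 / 2 by norm_num),
      abs_of_pos (show 0 < 1 / m₀ by positivity), abs_of_pos (show 0 < 1 / m₁ by positivity),
      abs_of_pos (show 0 < 1 / m₂ by positivity)]
    calc _ ≤ 1 / 2 * ((F + 2 * F * F) * m₀ ^ 2 / (n + 1) ^ 2 * (1 / m₀) * (E * (1 / m₀)) *
          (E * (E * (1 / m₀)))) := by
          gcongr
          exact h2.trans (by gcongr)
      _ = _ := by field_simp

/-! ### The L¹ estimate of the Bergman kernel. -/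

theorem setIntegral_ball_polar {G : ℂ → ℂ} (hG : IntegrableOn G (Metric.ball 0 1)) :
    ∫ z in Metric.ball 0 1, G z = ∫ r in Ioo (0 : ℝ) 1, ∫ θ in Ioo (-Real.pi) Real.pi,
      (r : ℂ) * G (Complex.polarCoord.symm (r, θ)) := by
  have hball : MeasurableSet (Metric.ball (0 : ℂ) 1) := measurableSet_ball
  rw [← integral_indicator hball, integral_polar ((integrable_indicator_iff hball).2 hG)]
  have : ∀ r ∈ Ioi (0 : ℝ), (∫ θ in Ioo (-Real.pi) Real.pi, (r : ℂ) *
      (Metric.ball 0 1).indicator G (Complex.polarCoord.symm (r, θ))) =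
        (Ioo (0 : ℝ) 1).indicator (fun r => ∫ θ in Ioo (-Real.pi) Real.pi,
          (r : ℂ) * G (Complex.polarCoord.symm (r, θ))) r := by
    intro r hr
    have hr0 : (0 : ℝ) < r := hr
    have hn : ∀ θ, ‖Complex.polarCoord.symm (r, θ)‖ = r := fun θ => by
      rw [Complex.norm_polarCoord_symm, abs_of_pos hr0]
    by_cases hr1 : r < 1
    · rw [indicator_of_mem (show r ∈ Ioo (0 : ℝ) 1 from ⟨hr0, hr1⟩)]
      refine integral_congr_ae (.of_forall fun θ => ?_)
      simp only
      rw [indicator_of_mem (by rw [mem_ball_zero_iff, hn]; exact hr1)]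
    · rw [indicator_of_notMem (show r ∉ Ioo (0 : ℝ) 1 from fun h => hr1 h.2)]
      simp only [indicator, mem_ball_zero_iff, hn, hr1, if_false, mul_zero, integral_zero]
  rw [setIntegral_congr_fun measurableSet_Ioi this, setIntegral_indicator measurableSet_Ioo,
    inter_eq_self_of_subset_right (fun x hx => hx.1)]

theorem setIntegral_ball_polar_real {G : ℂ → ℝ} (hG : IntegrableOn G (Metric.ball 0 1)) :
    ∫ z in Metric.ball 0 1, G z = ∫ r in Ioo (0 : ℝ) 1, ∫ θ in Ioo (-Real.pi) Real.pi,
      r * G (Complex.polarCoord.symm (r, θ)) := by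
  have h := setIntegral_ball_polar (G := fun z => (G z : ℂ)) hG.ofReal
  simp only [← Complex.ofReal_mul, integral_complex_ofReal] at h
  exact_mod_cast h

/-- With y = (t/π)² ≤ 1 and cos t ≤ 1 - 2y, the squared norm (1-ρ)² + 2ρ(1 - cos t) is at least
(1-ρ)²y + 4ρy = (1+ρ)²y ≥ y. -/
theorem sq_div_le_norm_one_sub_sq {ρ t : ℝ} (h0 : 0 ≤ ρ) (ht : |t| ≤ Real.pi) :
    (t / Real.pi) ^ 2 ≤ ‖1 - ρ * Complex.exp (t * Complex.I)‖ ^ 2 := by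
  have e : ‖1 - ρ * Complex.exp (t * Complex.I)‖ ^ 2 = 1 - 2 * ρ * Real.cos t + ρ ^ 2 := by
    rw [← Complex.normSq_eq_norm_sq, Complex.normSq_apply]
    simp only [Complex.sub_re, Complex.one_re, Complex.sub_im, Complex.one_im,
      Complex.re_ofReal_mul, Complex.im_ofReal_mul, Complex.exp_ofReal_mul_I_re,
      Complex.exp_ofReal_mul_I_im]
    have := Real.sin_sq_add_cos_sq t
    linear_combination ρ ^ 2 * this
  rw [e]
  have h2 := Real.cos_le_one_sub_mul_cos_sq ht
  have hpi := Real.pi_pos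
  have h3 : (t / Real.pi) ^ 2 ≤ 1 := by
    rw [← sq_abs, abs_div, abs_of_pos hpi]
    exact pow_le_one₀ (by positivity) ((div_le_one hpi).2 ht)
  have h4 : Real.cos t ≤ 1 - 2 * (t / Real.pi) ^ 2 := by
    refine h2.trans_eq ?_
    rw [div_pow]; ring
  set y := (t / Real.pi) ^ 2
  have h5 : 0 ≤ y := sq_nonneg _
  nlinarith [mul_le_mul_of_nonneg_left h4 h0, mul_nonneg h0 h5, sq_nonneg (1 - ρ),
    mul_nonneg (sq_nonneg (1 - ρ)) (sub_nonneg.2 h3)]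

/-- Rotating by arg z and using `sq_div_le_norm_one_sub_sq`, the integrand is dominated by 1/(1 +
(at/π)²), whose integral over the line is π²/a. With a = n + 1 this produces the factor 1/(n+1) in
the kernel estimate. -/
theorem integral_poisson_type_le {a : ℝ} (ha : 0 < a) {z : ℂ} {r : ℝ} (hr : 0 ≤ r) :
    ∫ θ in Ioo (-Real.pi) Real.pi,
      1 / (1 + a ^ 2 * ‖1 - conj z * Complex.polarCoord.symm (r, θ)‖ ^ 2) ≤ Real.pi ^ 2 / a := by
  have hpi := Real.pi_pos
  set ρ := ‖z‖ * r with hρ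
  have hρ0 : 0 ≤ ρ := by positivity
  set α := Complex.arg z with hα
  set g : ℝ → ℝ := fun t => 1 / (1 + a ^ 2 * ‖1 - ρ * Complex.exp (t * Complex.I)‖ ^ 2) with hg
  have hgc : Continuous g := by
    refine continuous_const.div (by fun_prop) fun t => ?_
    positivity
  have hper : Function.Periodic g (2 * Real.pi) := fun t => by
    simp only [hg]
    rw [show ((t + 2 * Real.pi : ℝ) : ℂ) * Complex.I = t * Complex.I + 2 * Real.pi * Complex.I by
      push_cast; ring, Complex.exp_periodic]
  have h1 : ∀ θ : ℝ, 1 / (1 + a ^ 2 * ‖1 - conj z * Complex.polarCoord.symm (r, θ)‖ ^ 2) =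
      g (θ - α) := by
    intro θ
    have e : conj z * Complex.polarCoord.symm (r, θ) =
        ρ * Complex.exp ((θ - α : ℝ) * Complex.I) := by
      have e1 : Complex.polarCoord.symm (r, θ) = r * Complex.exp (θ * Complex.I) := by
        simp [Complex.exp_mul_I]
      have e2 : conj z = ‖z‖ * Complex.exp (-α * Complex.I) := by
        conv_lhs => rw [← Complex.norm_mul_exp_arg_mul_I z]
        rw [map_mul, Complex.conj_ofReal, ← Complex.exp_conj]
        simp [hα]
      rw [e1, e2, hρ]
      push_cast
      rw [show ((θ : ℂ) - α) * Complex.I = -α * Complex.I + θ * Complex.I by ring, Complex.exp_add]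
      ring
    rw [e]
  simp only [h1]
  rw [← integral_Ioc_eq_integral_Ioo, ← intervalIntegral.integral_of_le (by linarith),
    intervalIntegral.integral_comp_sub_right (fun t => g t)]
  have h2 := hper.intervalIntegral_add_eq (-Real.pi - α) (-Real.pi)
  rw [show -Real.pi - α + 2 * Real.pi = Real.pi - α by ring,
    show -Real.pi + 2 * Real.pi = Real.pi by ring] at h2
  rw [h2]
  have hint : Integrable fun t : ℝ => (1 + (a / Real.pi * t) ^ 2)⁻¹ :=
    integrable_inv_one_add_sq.comp_mul_left' (by positivity)
  calc ∫ t in -Real.pi..Real.pi, g t ≤ ∫ t in -Real.pi..Real.pi, (1 + (a / Real.pi * t) ^ 2)⁻¹ := by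
        refine intervalIntegral.integral_mono_on (by linarith) (hgc.intervalIntegrable _ _)
          hint.intervalIntegrable fun t ht => ?_
        have h3 := sq_div_le_norm_one_sub_sq hρ0 (abs_le.2 ⟨ht.1, ht.2⟩)
        simp only [hg]
        rw [← one_div]
        refine one_div_le_one_div_of_le (by positivity) ?_
        have : (a / Real.pi * t) ^ 2 = a ^ 2 * (t / Real.pi) ^ 2 := by
          field_simp
        rw [this]
        gcongr
    _ ≤ ∫ t : ℝ, (1 + (a / Real.pi * t) ^ 2)⁻¹ := by
        rw [intervalIntegral.integral_of_le (by linarith)]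
        exact setIntegral_le_integral hint (.of_forall fun t => by positivity)
    _ = Real.pi ^ 2 / a := by
        rw [Measure.integral_comp_mul_left (fun t : ℝ => (1 + t ^ 2)⁻¹),
          integral_univ_inv_one_add_sq, abs_of_pos (by positivity), smul_eq_mul]
        field_simp

theorem bergmanKernel_eq (ω : ℝ → ℝ) (z ζ : ℂ) :
    bergmanKernel ω z ζ = ∑' n : ℕ, (kernelCoeff ω n : ℂ) * (conj z * ζ) ^ n := by
  rw [bergmanKernel]
  refine tsum_congr fun n => ?_
  rw [kernelCoeff, Complex.ofReal_div, Complex.ofReal_one, one_div_mul_eq_div]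

theorem IsRadialWeight.summable_kernelCoeff {ω : ℝ → ℝ} (h : IsRadialWeight ω) {t : ℝ}
    (h0 : 0 ≤ t) (h1 : t < 1) : Summable fun n : ℕ => kernelCoeff ω n * t ^ n :=
  (h.summable h0 h1).congr fun n => by rw [kernelCoeff, one_div_mul_eq_div]

theorem IsRadialWeight.norm_bergmanKernel_le {ω : ℝ → ℝ} (h : IsRadialWeight ω) {z ζ : ℂ}
    (hz : ‖z‖ < 1) (hζ : ‖ζ‖ < 1) :
    ‖bergmanKernel ω z ζ‖ ≤ ∑' n : ℕ, kernelCoeff ω n * ‖z‖ ^ n := by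
  rw [bergmanKernel_eq]
  refine tsum_of_norm_bounded (h.summable_kernelCoeff (norm_nonneg z) hz).hasSum fun n => ?_
  have := (h.kernelCoeff_pos n).le
  rw [norm_mul, norm_pow, norm_mul, RCLike.norm_conj, Complex.norm_real, Real.norm_of_nonneg this]
  gcongr
  exact mul_le_of_le_one_right (norm_nonneg _) hζ.le

theorem IsRadialWeight.differentiableOn_bergmanKernel {ω : ℝ → ℝ} (h : IsRadialWeight ω) {z : ℂ}
    (hz : ‖z‖ < 1) : DifferentiableOn ℂ (bergmanKernel ω z) (Metric.ball 0 1) :=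
  (bergmanKernel_reproducing h (by simpa using hz)).1.1

theorem IsRadialWeight.integrableOn_kernel_mul {ω σ : ℝ → ℝ} (h : IsRadialWeight ω)
    (hσ : IsRadialWeight σ) {z : ℂ} (hz : ‖z‖ < 1) :
    IntegrableOn (fun ζ => ‖bergmanKernel ω z ζ‖ * σ ‖ζ‖) (Metric.ball 0 1) := by
  refine hσ.integrableOn_disk.bdd_mul (c := ∑' n : ℕ, kernelCoeff ω n * ‖z‖ ^ n)
    ((h.differentiableOn_bergmanKernel hz).continuousOn.norm.aestronglyMeasurable
      measurableSet_ball) ?_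
  refine (ae_restrict_iff' measurableSet_ball).2 (.of_forall fun ζ hζ => ?_)
  rw [norm_norm]
  exact h.norm_bergmanKernel_le hz (by simpa using hζ)

theorem moment_natCast_add_one (σ : ℝ → ℝ) (n : ℕ) :
    moment σ (n + 1) = ∫ s in Ioo (0 : ℝ) 1, s ^ (n + 1) * σ s := by
  rw [moment_eq_setIntegral]
  refine setIntegral_congr_fun measurableSet_Ioo fun s _ => ?_
  rw [← Real.rpow_natCast]
  push_cast
  rfl

/-- `L¹` estimate of the Bergman kernel against a radial weight. -/
theorem UpperDoubling.exists_integral_kernel_le {ω : ℝ → ℝ} (h : UpperDoubling ω) :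
    ∃ C : ℝ, 0 ≤ C ∧ ∀ σ : ℝ → ℝ, IsRadialWeight σ → ∀ z : ℂ, ‖z‖ < 1 →
      (Summable fun n : ℕ => kernelCoeff ω n * ‖z‖ ^ n / (n + 1) * moment σ (n + 1)) ∧
      ∫ ζ in Metric.ball 0 1, ‖bergmanKernel ω z ζ‖ * σ ‖ζ‖ ≤
        C * ∑' n : ℕ, kernelCoeff ω n * ‖z‖ ^ n / (n + 1) * moment σ (n + 1) := by
  obtain ⟨A, hA, hdbl, h1, h2⟩ := h.exists_kernelCoeff_bounds
  have hω := h.1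
  set B := 10 + 20 * A * (1 + A) + 2 * A with hB
  have hB0 : 0 ≤ B := by positivity
  have hpi := Real.pi_pos
  refine ⟨B * Real.pi ^ 2, by positivity, fun σ hσ z hz => ?_⟩
  have hcp : ∀ n, 0 < kernelCoeff ω n := hω.kernelCoeff_pos
  have hmp : ∀ n : ℕ, 0 < moment σ (n + 1) := fun n => hσ.moment_pos' (by positivity)
  have hsum := hω.summable_kernelCoeff (norm_nonneg z) hz
  have hes : Summable fun n : ℕ => kernelCoeff ω n * ‖z‖ ^ n / (n + 1) * moment σ (n + 1) := by
    refine Summable.of_nonneg_of_le (fun n => ?_) (fun n => ?_) (hsum.mul_right (moment σ 0))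
    · have := hcp n; have := hmp n; positivity
    · have := hcp n
      gcongr
      · exact (hmp n).le
      · exact div_le_self (by positivity) (by linarith [(Nat.cast_nonneg n : (0 : ℝ) ≤ n)])
      · exact hσ.moment_antitone le_rfl (by positivity)
  refine ⟨hes, ?_⟩
  -- The terms of `norm_tsum_le_of_slowly_varying` at u = z̄ζ, weighted by σ. In polar coordinates
  -- the angle contributes π²/(n+1), and |ζ|^n with the Jacobian gives the moment of order n + 1.
  set F : ℕ → ℂ → ℝ := fun n ζ => B * (kernelCoeff ω n * (‖z‖ * ‖ζ‖) ^ n /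
    (1 + (n + 1) ^ 2 * ‖1 - conj z * ζ‖ ^ 2)) * σ ‖ζ‖ with hF
  have hden : ∀ (n : ℕ) (ζ : ℂ), 1 ≤ 1 + ((n : ℝ) + 1) ^ 2 * ‖1 - conj z * ζ‖ ^ 2 := fun n ζ => by
    have : 0 ≤ ((n : ℝ) + 1) ^ 2 * ‖1 - conj z * ζ‖ ^ 2 := by positivity
    linarith
  have hσ0 : ∀ ζ ∈ Metric.ball (0 : ℂ) 1, 0 ≤ σ ‖ζ‖ := fun ζ hζ =>
    hσ.nonneg _ ⟨norm_nonneg _, by simpa using hζ⟩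
  have hF0 : ∀ n, ∀ ζ ∈ Metric.ball (0 : ℂ) 1, 0 ≤ F n ζ := fun n ζ hζ => by
    have := hcp n; have := hσ0 ζ hζ; have := hden n ζ
    positivity
  have hFint : ∀ n, IntegrableOn (F n) (Metric.ball 0 1) := by
    intro n
    refine hσ.integrableOn_disk.bdd_mul (c := B * kernelCoeff ω n) ?_ ?_
    · refine Continuous.aestronglyMeasurable ?_
      refine continuous_const.mul (Continuous.div (by fun_prop) (by fun_prop) fun ζ => ?_)
      linarith [hden n ζ]
    · refine (ae_restrict_iff' measurableSet_ball).2 (.of_forall fun ζ hζ => ?_)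
      have hζ' : ‖ζ‖ < 1 := by simpa using hζ
      have := hcp n
      have := hden n ζ
      rw [Real.norm_of_nonneg (by positivity)]
      gcongr
      refine (div_le_self (by positivity) this).trans ?_
      refine mul_le_of_le_one_right (by positivity) (pow_le_one₀ (by positivity) ?_)
      exact mul_le_one₀ hz.le (norm_nonneg _) hζ'.le
  have hpt : ∀ ζ ∈ Metric.ball (0 : ℂ) 1,
      ENNReal.ofReal (‖bergmanKernel ω z ζ‖ * σ ‖ζ‖) ≤ ∑' n, ENNReal.ofReal (F n ζ) := by
    intro ζ hζ
    have hζ' : ‖ζ‖ < 1 := by simpa using hζ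
    have hu : ‖conj z * ζ‖ = ‖z‖ * ‖ζ‖ := by rw [norm_mul, RCLike.norm_conj]
    have hu1 : ‖z‖ * ‖ζ‖ < 1 := mul_lt_one_of_nonneg_of_lt_one_left (norm_nonneg _) hz hζ'.le
    have hsu := hω.summable_kernelCoeff (by positivity) hu1
    have hk := norm_tsum_le_of_slowly_varying (fun n => (hcp n).le) hA hdbl h1 h2
      (u := conj z * ζ) (by rwa [hu]) (by rwa [hu])
    rw [← bergmanKernel_eq, hu] at hk
    have hsF : Summable fun n => F n ζ := by
      refine Summable.of_nonneg_of_le (fun n => hF0 n ζ hζ) (fun n => ?_)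
        ((hsu.mul_left B).mul_right (σ ‖ζ‖))
      have := hcp n; have := hσ0 ζ hζ
      simp only [hF]
      gcongr
      exact div_le_self (by positivity) (hden n ζ)
    rw [← ENNReal.ofReal_tsum_of_nonneg (fun n => hF0 n ζ hζ) hsF]
    refine ENNReal.ofReal_le_ofReal ?_
    simp only [hF]
    rw [tsum_mul_right, tsum_mul_left]
    exact mul_le_mul_of_nonneg_right hk (hσ0 ζ hζ)
  have hFle : ∀ n : ℕ, ∫ ζ in Metric.ball 0 1, F n ζ ≤
      B * Real.pi ^ 2 * (kernelCoeff ω n * ‖z‖ ^ n / (n + 1) * moment σ (n + 1)) := by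
    intro n
    have hc := hcp n
    rw [setIntegral_ball_polar_real (hFint n), moment_natCast_add_one, ← integral_const_mul,
      ← integral_const_mul]
    refine integral_mono_of_nonneg ?_ ?_ ?_
    · refine (ae_restrict_iff' measurableSet_Ioo).2 (.of_forall fun r hr => ?_)
      refine integral_nonneg fun θ => ?_
      exact mul_nonneg hr.1.le (hF0 n _ (by simpa [abs_of_pos hr.1] using hr.2))
    · refine Integrable.const_mul (Integrable.const_mul ?_ _) _
      refine (hσ.integrableOn_rpow_mul (x := n + 1) (by positivity)).congr_fun (fun s _ => ?_)
        measurableSet_Ioo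
      rw [← Real.rpow_natCast]
      push_cast
      rfl
    · refine (ae_restrict_iff' measurableSet_Ioo).2 (.of_forall fun r hr => ?_)
      have hσr := hσ.nonneg r ⟨hr.1.le, hr.2⟩
      have hr0 := hr.1
      have hn : ∀ θ, ‖Complex.polarCoord.symm (r, θ)‖ = r := fun θ => by
        rw [Complex.norm_polarCoord_symm, abs_of_pos hr.1]
      have hP := integral_poisson_type_le (a := n + 1) (by positivity) (z := z) hr.1.le
      calc ∫ θ in Ioo (-Real.pi) Real.pi, r * F n (Complex.polarCoord.symm (r, θ))
          = B * (kernelCoeff ω n * ‖z‖ ^ n * (r ^ (n + 1) * σ r)) *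
            ∫ θ in Ioo (-Real.pi) Real.pi, 1 / (1 + ((n : ℝ) + 1) ^ 2 *
              ‖1 - conj z * Complex.polarCoord.symm (r, θ)‖ ^ 2) := by
            rw [← integral_const_mul]
            refine integral_congr_ae (.of_forall fun θ => ?_)
            simp only [hF, hn]
            rw [mul_pow]
            ring
        _ ≤ B * (kernelCoeff ω n * ‖z‖ ^ n * (r ^ (n + 1) * σ r)) * (Real.pi ^ 2 / (n + 1)) := by
            gcongr
        _ = _ := by ring
  have hnn : ∀ n : ℕ, 0 ≤ kernelCoeff ω n * ‖z‖ ^ n / (n + 1) * moment σ (n + 1) := fun n => by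
    have := hcp n; have := hmp n; positivity
  -- With lower integrals, sum and integral can be exchanged without first knowing that the summed
  -- majorant is integrable.
  rw [integral_eq_lintegral_of_nonneg_ae ((ae_restrict_iff' measurableSet_ball).2
    (.of_forall fun ζ hζ => mul_nonneg (norm_nonneg _) (hσ0 ζ hζ)))
    (hω.integrableOn_kernel_mul hσ hz).1]
  refine ENNReal.toReal_le_of_le_ofReal (mul_nonneg (by positivity) (tsum_nonneg hnn)) ?_
  calc ∫⁻ ζ in Metric.ball 0 1, ENNReal.ofReal (‖bergmanKernel ω z ζ‖ * σ ‖ζ‖)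
      ≤ ∫⁻ ζ in Metric.ball 0 1, ∑' n, ENNReal.ofReal (F n ζ) :=
        setLIntegral_mono' measurableSet_ball hpt
    _ = ∑' n, ∫⁻ ζ in Metric.ball 0 1, ENNReal.ofReal (F n ζ) :=
        lintegral_tsum fun n => (hFint n).aemeasurable.ennreal_ofReal
    _ ≤ ∑' n : ℕ, ENNReal.ofReal (B * Real.pi ^ 2 *
          (kernelCoeff ω n * ‖z‖ ^ n / (n + 1) * moment σ (n + 1))) := by
        refine ENNReal.tsum_le_tsum fun n => ?_
        rw [← ofReal_integral_eq_lintegral_ofReal (hFint n)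
          ((ae_restrict_iff' measurableSet_ball).2 (.of_forall (hF0 n)))]
        exact ENNReal.ofReal_le_ofReal (hFle n)
    _ = _ := by
        rw [← tsum_mul_left, ENNReal.ofReal_tsum_of_nonneg
          (fun n => mul_nonneg (by positivity) (hnn n)) (hes.mul_left _)]

/-! ### Summing reciprocal moments of a doubling weight. -/

/-- Logarithmic sums of the reciprocal of the tail of a lower doubling weight. -/
theorem LowerDoubling.exists_sum_inv_tail_le {ν : ℝ → ℝ} (h : LowerDoubling ν) :
    ∃ A : ℝ, ∀ n : ℕ, 1 ≤ n →
      (∑ k ∈ Finset.range n, 1 / (((k : ℝ) + 1) * tail ν (1 - 1 / (k + 1)))) *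
        tail ν (1 - 1 / n) ≤ A := by
  obtain ⟨K, hK, r₀, hr₀, hd⟩ := h.exists_forall 2
  have hν := h.1
  set L := ⌈K⌉₊ with hL
  have hKL : K ≤ L := Nat.le_ceil K
  have hL1 : 1 < L := by exact_mod_cast hK.trans_le hKL
  have hmem : ∀ n : ℕ, 1 ≤ n → (1 - 1 / (n : ℝ)) ∈ Ico (0 : ℝ) 1 := by
    intro n hn
    have hn' : (1 : ℝ) ≤ n := by exact_mod_cast hn
    have h1 : 1 / (n : ℝ) ≤ 1 := by rw [div_le_one (by linarith)]; exact hn'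
    have h2 : 0 < 1 / (n : ℝ) := by positivity
    exact ⟨by linarith, by linarith⟩
  have hmem' : ∀ k : ℕ, (1 - 1 / ((k : ℝ) + 1)) ∈ Ico (0 : ℝ) 1 := fun k => by
    have := hmem (k + 1) (by omega)
    push_cast at this
    exact this
  have hanti : ∀ m n : ℕ, 1 ≤ m → m ≤ n → tail ν (1 - 1 / n) ≤ tail ν (1 - 1 / m) := by
    intro m n hm hmn
    have hm' : (0 : ℝ) < m := by exact_mod_cast hm
    refine hν.tail_antitone (hmem m hm).1 (hmem n (hm.trans hmn)).2.le ?_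
    have : 1 / (n : ℝ) ≤ 1 / m := one_div_le_one_div_of_le hm' (by exact_mod_cast hmn)
    linarith
  set G : ℕ → ℝ := fun n =>
    ∑ k ∈ Finset.range n, 1 / (((k : ℝ) + 1) * tail ν (1 - 1 / (k + 1))) with hG
  have hterm : ∀ k : ℕ, 0 ≤ 1 / (((k : ℝ) + 1) * tail ν (1 - 1 / (k + 1))) := fun k => by
    have := hν.tail_pos _ (hmem' k)
    positivity
  have hGmono : ∀ m n : ℕ, m ≤ n → G m ≤ G n := fun m n hmn =>
    Finset.sum_le_sum_of_subset_of_nonneg (Finset.range_mono hmn) fun k _ _ => hterm k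
  have hG0 : ∀ n, 0 ≤ G n := fun n => Finset.sum_nonneg fun k _ => hterm k
  set M := ⌈1 / (1 - r₀)⌉₊ with hM
  -- The induction passes from n to m = ⌊n/L⌋. The block from m to n contributes at most L. If m >
  -- M, then 1 - 1/m > r₀ and the tail halves between the two scales, so the inductive bound A
  -- becomes A/2; and A/2 + L ≤ A. If m ≤ M, the earlier terms are at most G M ν̂(0).
  set A := G M * tail ν 0 + 2 * L with hA
  have hν0 := hν.tail_pos 0 (by simp)
  refine ⟨A, fun n => ?_⟩
  induction n using Nat.strong_induction_on with
  | _ n ih =>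
    intro hn
    change G n * tail ν (1 - 1 / n) ≤ A
    have hn' : (0 : ℝ) < n := by exact_mod_cast hn
    set m := n / L with hm
    have hmn : m < n := Nat.div_lt_self hn hL1
    have hpos := hν.tail_pos _ (hmem n hn)
    have hsplit : G n = G m + ∑ k ∈ Finset.Ico m n,
        1 / (((k : ℝ) + 1) * tail ν (1 - 1 / (k + 1))) := by
      simp only [hG]
      rw [Finset.sum_range_add_sum_Ico _ hmn.le]
    have hlast : (∑ k ∈ Finset.Ico m n, 1 / (((k : ℝ) + 1) * tail ν (1 - 1 / (k + 1)))) *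
        tail ν (1 - 1 / n) ≤ L := by
      have hk : ∀ k ∈ Finset.Ico m n, 1 / (((k : ℝ) + 1) * tail ν (1 - 1 / (k + 1))) ≤
          L / (n * tail ν (1 - 1 / n)) := by
        intro k hk
        rw [Finset.mem_Ico] at hk
        have h1 := hanti (k + 1) n (by omega) (by omega)
        push_cast at h1
        have h2 : (n : ℝ) ≤ L * (k + 1) := by
          have h3 : n < L * (n / L + 1) := Nat.lt_mul_div_succ n (by omega)
          have h4 : L * (n / L + 1) ≤ L * (k + 1) := Nat.mul_le_mul_left _ (by omega)
          exact_mod_cast h3.le.trans h4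
        have h5 := hν.tail_pos _ (hmem' k)
        rw [div_le_div_iff₀ (by positivity) (by positivity), one_mul]
        calc (n : ℝ) * tail ν (1 - 1 / n) ≤ (L * (k + 1)) * tail ν (1 - 1 / (k + 1)) := by gcongr
          _ = _ := by ring
      have h1 := Finset.sum_le_sum hk
      rw [Finset.sum_const, Nat.card_Ico, nsmul_eq_mul] at h1
      have h2 : ((n - m : ℕ) : ℝ) ≤ n := by exact_mod_cast Nat.sub_le n m
      calc _ ≤ ((n - m : ℕ) : ℝ) * (L / (n * tail ν (1 - 1 / n))) * tail ν (1 - 1 / n) := by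
            gcongr
        _ ≤ n * (L / (n * tail ν (1 - 1 / n))) * tail ν (1 - 1 / n) := by gcongr
        _ = L := by
            have hne := hpos.ne'
            generalize tail ν (1 - 1 / (n : ℝ)) = y at hne ⊢
            field_simp
    have hle : G m * tail ν (1 - 1 / n) ≤ G M * tail ν 0 + L := by
      rcases le_or_gt m M with hmM | hmM
      · calc G m * tail ν (1 - 1 / n) ≤ G M * tail ν 0 := by
              gcongr
              · exact hG0 M
              · exact hGmono _ _ hmM
              · exact hν.tail_antitone le_rfl (hmem n hn).2.le (hmem n hn).1
          _ ≤ _ := by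
              have : (0 : ℝ) ≤ L := by positivity
              linarith
      · have hm1 : 1 ≤ m := by omega
        have hm0 : (0 : ℝ) < m := by exact_mod_cast hm1
        have h1 : 1 / (1 - r₀) < m := (Nat.le_ceil _).trans_lt (by exact_mod_cast hmM)
        have h2 : 0 < 1 - r₀ := by linarith [hr₀.2]
        have h3 : 1 / (m : ℝ) < 1 - r₀ := by
          rw [div_lt_iff₀ h2] at h1
          rw [div_lt_iff₀ hm0]
          linarith
        have h4 := hd (1 - 1 / m) ⟨by linarith, (hmem m hm1).2⟩
        have h5 : tail ν (1 - 1 / n) ≤ tail ν (1 - (1 - (1 - 1 / m)) / K) := by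
          have h6 : 1 / (n : ℝ) ≤ (1 - (1 - 1 / m)) / K := by
            rw [sub_sub_cancel, div_div]
            refine one_div_le_one_div_of_le (by positivity) ?_
            calc (m : ℝ) * K ≤ m * L := by gcongr
              _ ≤ n := by exact_mod_cast Nat.div_mul_le_self n L
          have h7 : (1 - (1 - 1 / (m : ℝ))) / K ≤ 1 := by
            rw [sub_sub_cancel, div_div]
            refine (div_le_one (by positivity)).2 ?_
            have : (1 : ℝ) ≤ m := by exact_mod_cast hm1
            nlinarith
          exact hν.tail_antitone (by linarith) (hmem n hn).2.le (by linarith)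
        have h8 : 2 * (G m * tail ν (1 - 1 / n)) ≤ A := by
          calc _ = G m * (2 * tail ν (1 - 1 / n)) := by ring
            _ ≤ G m * tail ν (1 - 1 / m) := by
              have := hG0 m
              gcongr
              linarith
            _ ≤ A := ih m hmn hm1
        have h9 : 0 ≤ G M * tail ν 0 := mul_nonneg (hG0 M) hν0.le
        rw [hA] at h8
        linarith
    rw [hsplit, add_mul, hA]
    linarith

theorem IsRadialWeight.exists_tail_le_moment {ν : ℝ → ℝ} (h : IsRadialWeight ν) :
    ∃ c : ℝ, 0 < c ∧ ∀ k : ℕ, tail ν (1 - 1 / (k + 1)) ≤ c * moment ν (k + 1) := by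
  have h1 := h.moment_pos' (x := 1) zero_le_one
  refine ⟨max (Real.exp 2) (tail ν 0 / moment ν 1), lt_max_of_lt_left (Real.exp_pos 2),
    fun k => ?_⟩
  rcases Nat.eq_zero_or_pos k with rfl | hk
  · simp only [Nat.cast_zero, zero_add, div_one, sub_self]
    calc tail ν 0 = tail ν 0 / moment ν 1 * moment ν 1 := by field_simp
      _ ≤ _ := by gcongr; exact le_max_right _ _
  · have hk' : (1 : ℝ) ≤ k := by exact_mod_cast hk
    refine (h.tail_le_moment (by linarith)).trans ?_
    have := h.moment_pos' (x := (k : ℝ) + 1) (by positivity)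
    gcongr
    exact le_max_left _ _

/-- Split near n = 1/(1-r). Below, r^n ≤ 1 and the moments dominate tails, so lower doubling enters
through `exists_sum_inv_tail_le`. Above, 1/(n+1) ≤ 1 - r and ν_{n+1} ≥ s^(n+1) ν̂(s) with s =
(1+r)/2; the geometric series of ratio r/s sums to 2s/(1-r), and upper doubling compares ν̂(s) with
ν̂(r). -/
theorem Doubling.exists_sum_inv_moment_le {ν : ℝ → ℝ} (h : Doubling ν) :
    ∃ C : ℝ, ∀ r ∈ Ico (0 : ℝ) 1, ∀ M : ℕ,
      tail ν r * ∑ n ∈ Finset.range M, r ^ n / ((n + 1) * moment ν (n + 1)) ≤ C := by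
  obtain ⟨A, hA⟩ := h.2.exists_sum_inv_tail_le
  obtain ⟨D, hD, hd⟩ := h.1.exists_forall
  have hν := h.1.1
  obtain ⟨c, hc, hcle⟩ := hν.exists_tail_le_moment
  refine ⟨c * A + 2 * D, fun r hr M => ?_⟩
  have hr1 : 0 < 1 - r := by linarith [hr.2]
  have hνr := hν.tail_pos r hr
  have hm : ∀ n : ℕ, 0 < moment ν (n + 1) := fun n => hν.moment_pos' (by positivity)
  set X := ⌊1 / (1 - r)⌋₊ with hX
  have hX1 : 1 ≤ X := by
    refine Nat.le_floor ?_
    rw [Nat.cast_one, le_div_iff₀ hr1]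
    linarith [hr.1]
  have hX0 : (0 : ℝ) < X := by exact_mod_cast hX1
  have hXle : (X : ℝ) ≤ 1 / (1 - r) := Nat.floor_le (by positivity)
  have hXlt : 1 / (1 - r) < X + 1 := Nat.lt_floor_add_one _
  have hrX : 1 - 1 / (X : ℝ) ≤ r := by
    have : 1 - r ≤ 1 / (X : ℝ) := by
      rw [le_div_iff₀ hr1] at hXle
      rw [le_div_iff₀ hX0]
      linarith
    linarith
  set s := (1 + r) / 2 with hs
  have hsm : s ∈ Ico (0 : ℝ) 1 := ⟨by linarith [hr.1], by linarith [hr.2]⟩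
  have hs0 : 0 < s := by linarith [hr.1]
  have hνs := hν.tail_pos s hsm
  have hmem' : ∀ k : ℕ, (1 - 1 / ((k : ℝ) + 1)) ∈ Ico (0 : ℝ) 1 := fun k => by
    have h1 : 1 / ((k : ℝ) + 1) ≤ 1 := by
      rw [div_le_one (by positivity)]; linarith [(Nat.cast_nonneg k : (0 : ℝ) ≤ k)]
    have h2 : 0 < 1 / ((k : ℝ) + 1) := by positivity
    exact ⟨by linarith, by linarith⟩
  set g : ℕ → ℝ := fun n => 1 / (((n : ℝ) + 1) * tail ν (1 - 1 / (n + 1))) with hg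
  have hg0 : ∀ n, 0 ≤ g n := fun n => by
    have := hν.tail_pos _ (hmem' n)
    positivity
  have hq0 : 0 ≤ r / s := div_nonneg hr.1 hs0.le
  have hq1 : r / s < 1 := by rw [div_lt_one hs0]; linarith
  have hterm : ∀ n : ℕ, r ^ n / ((n + 1) * moment ν (n + 1)) ≤
      (if n < X then c * g n else 0) + (1 - r) / (s * tail ν s) * (r / s) ^ n := by
    intro n
    have := hm n
    split_ifs with hn
    · have h1 : r ^ n / ((n + 1) * moment ν (n + 1)) ≤ c * g n := by
        have h2 := hν.tail_pos _ (hmem' n)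
        calc r ^ n / ((n + 1) * moment ν (n + 1)) ≤ 1 / ((n + 1) * moment ν (n + 1)) := by
              gcongr
              exact pow_le_one₀ hr.1 hr.2.le
          _ ≤ c * g n := by
              simp only [hg]
              rw [mul_one_div, div_le_div_iff₀ (by positivity) (by positivity), one_mul]
              calc _ ≤ ((n : ℝ) + 1) * (c * moment ν (n + 1)) := by gcongr; exact hcle n
                _ = _ := by ring
      have h3 : 0 ≤ (1 - r) / (s * tail ν s) * (r / s) ^ n := by positivity
      linarith
    · rw [zero_add]
      have h1 := hν.rpow_mul_tail_le hsm (x := (n + 1 : ℕ)) (by positivity)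
      rw [Real.rpow_natCast] at h1
      push_cast at h1
      have h2 : 1 / ((n : ℝ) + 1) ≤ 1 - r := by
        have h3 : (X : ℝ) ≤ n := by exact_mod_cast not_lt.1 hn
        rw [div_lt_iff₀ hr1] at hXlt
        rw [div_le_iff₀ (by positivity)]
        nlinarith
      calc r ^ n / ((n + 1) * moment ν (n + 1)) = 1 / ((n : ℝ) + 1) * (r ^ n / moment ν (n + 1)) := by
            field_simp
        _ ≤ (1 - r) * (r ^ n / (s ^ (n + 1) * tail ν s)) := by
            have := hr.1
            gcongr
        _ = _ := by
            rw [div_pow r s]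
            field_simp
            ring
  have hsum1 : ∑ n ∈ Finset.range M, (if n < X then c * g n else 0) ≤
      c * ∑ n ∈ Finset.range X, g n := by
    rw [Finset.mul_sum, ← Finset.sum_filter]
    refine Finset.sum_le_sum_of_subset_of_nonneg (fun n hn => ?_) fun n _ _ => ?_
    · simpa using (Finset.mem_filter.1 hn).2
    · exact mul_nonneg hc.le (hg0 n)
  have hsum2 : ∑ n ∈ Finset.range M, (r / s) ^ n ≤ (1 - r / s)⁻¹ := by
    rw [← tsum_geometric_of_lt_one hq0 hq1]
    exact (summable_geometric_of_lt_one hq0 hq1).sum_le_tsum _ fun n _ => pow_nonneg hq0 n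
  have hG := hA X hX1
  have hνX : tail ν r ≤ tail ν (1 - 1 / X) := by
    refine hν.tail_antitone ?_ hr.2.le hrX
    have : 1 / (X : ℝ) ≤ 1 := by rw [div_le_one hX0]; exact_mod_cast hX1
    linarith
  have hGX : 0 ≤ ∑ n ∈ Finset.range X, g n := Finset.sum_nonneg fun n _ => hg0 n
  calc tail ν r * ∑ n ∈ Finset.range M, r ^ n / ((n + 1) * moment ν (n + 1))
      ≤ tail ν r * (c * ∑ n ∈ Finset.range X, g n +
          (1 - r) / (s * tail ν s) * (1 - r / s)⁻¹) := by
        refine mul_le_mul_of_nonneg_left ?_ hνr.le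
        refine (Finset.sum_le_sum fun n _ => hterm n).trans ?_
        rw [Finset.sum_add_distrib, ← Finset.mul_sum]
        gcongr
    _ = c * ((∑ n ∈ Finset.range X, g n) * tail ν r) +
          tail ν r * ((1 - r) / (s * tail ν s) * (1 - r / s)⁻¹) := by ring
    _ ≤ c * A + (D * tail ν s) * ((1 - r) / (s * tail ν s) * (1 - r / s)⁻¹) := by
        have hinv : 0 ≤ (1 - r / s)⁻¹ := inv_nonneg.2 (by linarith)
        refine add_le_add ?_ ?_
        · refine mul_le_mul_of_nonneg_left (le_trans ?_ hG) hc.le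
          gcongr
        · refine mul_le_mul_of_nonneg_right (hd r hr) (by positivity)
    _ = c * A + 2 * D := by
        have h1 : s - r = (1 - r) / 2 := by rw [hs]; ring
        have h2 : 1 - r / s = (1 - r) / (2 * s) := by
          rw [← div_div, ← h1, sub_div, div_self hs0.ne']
        rw [h2]
        field_simp

/-- The moment condition at x = n + 1 gives σ_{n+1} ν_{n+1} ≲ ω_{2n+2} ≤ ω_{2n+1}, which cancels the
kernel coefficient and leaves the sum of |z|^n / ((n+1) ν_{n+1}). -/
theorem exists_tail_mul_integral_kernel_le {ω ν : ℝ → ℝ} (hω : UpperDoubling ω) (hν : Doubling ν)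
    (h : MomentCondition ω ν) : ∃ C : ℝ, 0 ≤ C ∧ ∀ z : ℂ, ‖z‖ < 1 →
      tail ν ‖z‖ * ∫ ζ in Metric.ball 0 1, ‖bergmanKernel ω z ζ‖ * divTail ω ν ‖ζ‖ ≤ C := by
  obtain ⟨hint, B, hB⟩ := h
  obtain ⟨C₁, hC₁, hk⟩ := hω.exists_integral_kernel_le
  obtain ⟨C₂, hC₂⟩ := hν.exists_sum_inv_moment_le
  have hσ := isRadialWeight_divTail hω.1 hν.1.1 hint
  have hB0 : 0 ≤ max B 0 := le_max_right _ _
  have hC₂' : 0 ≤ C₂ := by simpa using hC₂ 0 (by simp) 0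
  refine ⟨C₁ * (max B 0 / 2 * C₂), by positivity, fun z hz => ?_⟩
  obtain ⟨hs, hle⟩ := hk _ hσ z hz
  have hνz := hν.1.1.tail_pos ‖z‖ ⟨norm_nonneg _, hz⟩
  have hterm : ∀ n : ℕ, kernelCoeff ω n * ‖z‖ ^ n / (n + 1) * moment (divTail ω ν) (n + 1) ≤
      max B 0 / 2 * (‖z‖ ^ n / ((n + 1) * moment ν (n + 1))) := by
    intro n
    have e1 := hB (n + 1) (by positivity)
    have p1 := hω.1.moment_pos' (x := 2 * ((n : ℝ) + 1)) (by positivity)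
    have p2 := hν.1.1.moment_pos' (x := (n : ℝ) + 1) (by positivity)
    have p3 := hω.1.moment_pos n
    have e2 := hω.1.moment_antitone (x := 2 * n + 1) (y := 2 * ((n : ℝ) + 1)) (by positivity)
      (by linarith)
    rw [div_mul_eq_mul_div, div_le_iff₀ p1] at e1
    have e3 : moment (divTail ω ν) (n + 1) ≤ max B 0 * moment ω (2 * n + 1) / moment ν (n + 1) := by
      rw [le_div_iff₀ p2, mul_comm]
      exact e1.trans (mul_le_mul (le_max_left _ _) e2 p1.le hB0)
    rw [kernelCoeff]
    calc _ ≤ 1 / (2 * moment ω (2 * n + 1)) * ‖z‖ ^ n / (n + 1) *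
          (max B 0 * moment ω (2 * n + 1) / moment ν (n + 1)) := by gcongr
      _ = _ := by field_simp
  have hsum : ∑' n : ℕ, kernelCoeff ω n * ‖z‖ ^ n / (n + 1) * moment (divTail ω ν) (n + 1) ≤
      max B 0 / 2 * C₂ / tail ν ‖z‖ := by
    refine hs.tsum_le_of_sum_range_le fun M => ?_
    rw [le_div_iff₀ hνz]
    calc _ ≤ (∑ n ∈ Finset.range M, max B 0 / 2 * (‖z‖ ^ n / ((n + 1) * moment ν (n + 1)))) *
          tail ν ‖z‖ :=
          mul_le_mul_of_nonneg_right (Finset.sum_le_sum fun n _ => hterm n) hνz.le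
      _ = max B 0 / 2 * (tail ν ‖z‖ *
          ∑ n ∈ Finset.range M, ‖z‖ ^ n / ((n + 1) * moment ν (n + 1))) := by
          rw [← Finset.mul_sum]; ring
      _ ≤ _ := by gcongr; exact hC₂ _ ⟨norm_nonneg _, hz⟩ M
  calc _ ≤ tail ν ‖z‖ * (C₁ * (max B 0 / 2 * C₂ / tail ν ‖z‖)) := by
        gcongr
        exact hle.trans (by gcongr)
    _ = _ := by field_simp

/-! ### The projection on growth spaces: sufficiency. -/

theorem ae_diskMeasure_iff {p : ℂ → Prop} :
    (∀ᵐ z ∂diskMeasure, p z) ↔ ∀ᵐ z ∂volume.restrict (Metric.ball (0 : ℂ) 1), p z := by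
  rw [diskMeasure, Measure.ae_ennreal_smul_measure_iff (by simp [Real.pi_pos])]

theorem integrable_diskMeasure_iff {E : Type*} [NormedAddCommGroup E] {f : ℂ → E} :
    Integrable f diskMeasure ↔ IntegrableOn f (Metric.ball 0 1) := by
  rw [diskMeasure, integrable_smul_measure (by simp [Real.pi_pos]) (by simp), IntegrableOn]

theorem integral_diskMeasure {E : Type*} [NormedAddCommGroup E] [NormedSpace ℝ E] (f : ℂ → E) :
    ∫ z, f z ∂diskMeasure = (1 / Real.pi) • ∫ z in Metric.ball 0 1, f z := by
  rw [diskMeasure, integral_smul_measure, ENNReal.toReal_ofReal (by positivity)]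

theorem ae_mem_ball_diskMeasure : ∀ᵐ z ∂diskMeasure, z ∈ Metric.ball (0 : ℂ) 1 :=
  ae_diskMeasure_iff.2 (ae_restrict_mem measurableSet_ball)

/-- Power series expansion of the Bergman projection. -/
theorem hasSum_bergmanProj {ω : ℝ → ℝ} (h : IsRadialWeight ω) {f : ℂ → ℂ}
    (hf : Integrable (fun ζ => f ζ * (ω ‖ζ‖ : ℂ)) diskMeasure) {z : ℂ} (hz : ‖z‖ < 1) :
    HasSum (fun n : ℕ => (kernelCoeff ω n : ℂ) *
      (∫ ζ, conj ζ ^ n * (f ζ * (ω ‖ζ‖ : ℂ)) ∂diskMeasure) * z ^ n) (bergmanProj ω f z) := by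
  have hsum := h.summable_kernelCoeff (norm_nonneg z) hz
  have hpow : ∀ n : ℕ, ∀ᵐ ζ ∂diskMeasure, ‖conj ζ ^ n‖ ≤ 1 := by
    intro n
    filter_upwards [ae_mem_ball_diskMeasure] with ζ hζ
    have hζ' : ‖ζ‖ < 1 := by simpa using hζ
    simpa using pow_le_one₀ (norm_nonneg ζ) hζ'.le
  have hmono : ∀ n : ℕ, Integrable (fun ζ => conj ζ ^ n * (f ζ * (ω ‖ζ‖ : ℂ))) diskMeasure :=
    fun n => hf.bdd_mul (c := 1) (by fun_prop) (hpow n)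
  have hterm : ∀ n : ℕ, ∀ ζ : ℂ,
      f ζ * conj ((kernelCoeff ω n : ℂ) * (conj z * ζ) ^ n) * (ω ‖ζ‖ : ℂ) =
      (kernelCoeff ω n : ℂ) * z ^ n * (conj ζ ^ n * (f ζ * (ω ‖ζ‖ : ℂ))) := by
    intro n ζ
    simp only [map_pow, map_mul, Complex.conj_conj, Complex.conj_ofReal]
    ring
  have hs := hasSum_integral_of_summable_integral_norm (μ := diskMeasure)
    (F := fun (n : ℕ) ζ => (kernelCoeff ω n : ℂ) * z ^ n * (conj ζ ^ n * (f ζ * (ω ‖ζ‖ : ℂ))))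
    (fun n => (hmono n).const_mul _) (by
      refine Summable.of_nonneg_of_le (fun n => integral_nonneg fun _ => norm_nonneg _)
        (fun n => ?_) (hsum.mul_right (∫ ζ, ‖f ζ * (ω ‖ζ‖ : ℂ)‖ ∂diskMeasure))
      have hc := (h.kernelCoeff_pos n).le
      rw [← integral_const_mul]
      refine integral_mono_ae ((hmono n).const_mul _).norm (hf.norm.const_mul _) ?_
      filter_upwards [hpow n] with ζ hζ
      rw [norm_mul, norm_mul, norm_mul (conj ζ ^ n), norm_pow z, Complex.norm_real,
        Real.norm_of_nonneg hc]
      gcongr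
      exact mul_le_of_le_one_left (norm_nonneg _) hζ)
  have hrhs : ∫ ζ, (∑' n : ℕ, (kernelCoeff ω n : ℂ) * z ^ n *
      (conj ζ ^ n * (f ζ * (ω ‖ζ‖ : ℂ)))) ∂diskMeasure = bergmanProj ω f z := by
    rw [bergmanProj]
    refine integral_congr_ae (.of_forall fun ζ => ?_)
    simp only [bergmanKernel_eq, ← hterm]
    rw [tsum_mul_right, tsum_mul_left, Complex.conj_tsum]
  rw [hrhs] at hs
  refine hs.congr_fun ?_
  intro n
  rw [integral_const_mul]
  ring

/-- The integrals in the power series are bounded by the L¹ norm of fω, so the series converges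
uniformly on each disc of radius R < 1. -/
theorem differentiableOn_bergmanProj {ω : ℝ → ℝ} (h : IsRadialWeight ω) {f : ℂ → ℂ}
    (hf : Integrable (fun ζ => f ζ * (ω ‖ζ‖ : ℂ)) diskMeasure) :
    DifferentiableOn ℂ (bergmanProj ω f) (Metric.ball 0 1) := by
  set I := ∫ ζ, ‖f ζ * (ω ‖ζ‖ : ℂ)‖ ∂diskMeasure with hI
  have hcoef : ∀ n : ℕ, ‖∫ ζ, conj ζ ^ n * (f ζ * (ω ‖ζ‖ : ℂ)) ∂diskMeasure‖ ≤ I := by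
    intro n
    refine norm_integral_le_of_norm_le hf.norm ?_
    filter_upwards [ae_mem_ball_diskMeasure] with ζ hζ
    have hζ' : ‖ζ‖ < 1 := by simpa using hζ
    rw [norm_mul, norm_pow, RCLike.norm_conj]
    exact mul_le_of_le_one_left (norm_nonneg _) (pow_le_one₀ (norm_nonneg ζ) hζ'.le)
  intro z₀ hz₀
  obtain ⟨R, hR0, hR1⟩ := exists_between (show ‖z₀‖ < 1 by simpa using hz₀)
  have hRnn : 0 ≤ R := (norm_nonneg _).trans hR0.le
  have hd : DifferentiableOn ℂ (fun z => ∑' n : ℕ, (kernelCoeff ω n : ℂ) *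
      (∫ ζ, conj ζ ^ n * (f ζ * (ω ‖ζ‖ : ℂ)) ∂diskMeasure) * z ^ n) (Metric.ball 0 R) := by
    refine Complex.differentiableOn_tsum_of_summable_norm
      ((h.summable_kernelCoeff hRnn hR1).mul_right I) (fun n => by fun_prop) Metric.isOpen_ball
      fun n z hz => ?_
    have hz' : ‖z‖ < R := by simpa using hz
    have hc := (h.kernelCoeff_pos n).le
    rw [norm_mul, norm_mul, norm_pow, Complex.norm_real, Real.norm_of_nonneg hc, mul_right_comm]
    gcongr
    exact hcoef n
  have heq : EqOn (bergmanProj ω f) (fun z => ∑' n : ℕ, (kernelCoeff ω n : ℂ) *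
      (∫ ζ, conj ζ ^ n * (f ζ * (ω ‖ζ‖ : ℂ)) ∂diskMeasure) * z ^ n) (Metric.ball 0 R) := by
    intro z hz
    have hz' : ‖z‖ < R := by simpa using hz
    exact (hasSum_bergmanProj h hf (hz'.trans hR1)).tsum_eq.symm
  exact ((hd.congr heq).differentiableAt
    (Metric.isOpen_ball.mem_nhds (by simpa using hR0))).differentiableWithinAt

theorem IsRadialWeight.ae_bound_of_mem_growthSpace {ν : ℝ → ℝ} (h : IsRadialWeight ν) {f : ℂ → ℂ}
    (hf : growthNorm (tail ν) f < ∞) :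
    ∀ᵐ ζ ∂diskMeasure, ‖f ζ‖ ≤ (growthNorm (tail ν) f).toReal / tail ν ‖ζ‖ := by
  have h1 : ∀ᵐ ζ ∂diskMeasure, ‖f ζ * (tail ν ‖ζ‖ : ℂ)‖ₑ ≤ growthNorm (tail ν) f := by
    rw [growthNorm, eLpNorm_exponent_top]
    exact enorm_ae_le_eLpNormEssSup _ _
  filter_upwards [h1, ae_mem_ball_diskMeasure] with ζ hζ hb
  have hν := h.tail_pos ‖ζ‖ ⟨norm_nonneg _, by simpa using hb⟩
  rw [le_div_iff₀ hν]
  have h2 := ENNReal.toReal_mono hf.ne hζ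
  rwa [toReal_enorm, norm_mul, Complex.norm_real, Real.norm_of_nonneg hν.le] at h2

theorem integrable_mul_weight {ω ν : ℝ → ℝ} (hω : IsRadialWeight ω) (hν : IsRadialWeight ν)
    (hσ : IntegrableOn (divTail ω ν) (Ico 0 1)) {f : ℂ → ℂ} (hf : f ∈ growthSpace (tail ν)) :
    Integrable (fun ζ => f ζ * (ω ‖ζ‖ : ℂ)) diskMeasure := by
  have hσw := isRadialWeight_divTail hω hν hσ
  have h1 := integrable_diskMeasure_iff.2 hσw.integrableOn_disk
  have h2 := integrable_diskMeasure_iff.2 hω.integrableOn_disk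
  refine (h1.const_mul (growthNorm (tail ν) f).toReal).mono'
    (hf.1.mul (Complex.continuous_ofReal.comp_aestronglyMeasurable h2.1)) ?_
  filter_upwards [hν.ae_bound_of_mem_growthSpace hf.2, ae_mem_ball_diskMeasure] with ζ hζ hb
  have hω0 := hω.nonneg ‖ζ‖ ⟨norm_nonneg _, by simpa using hb⟩
  rw [norm_mul, Complex.norm_real, Real.norm_of_nonneg hω0]
  calc _ ≤ (growthNorm (tail ν) f).toReal / tail ν ‖ζ‖ * ω ‖ζ‖ := by gcongr
    _ = _ := by rw [divTail]; ring

/-- The Bergman projection is bounded on the growth space as soon as the kernel satisfies the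
corresponding `L¹` estimate. -/
theorem bergmanProjBounded_of_kernel_estimate {ω ν : ℝ → ℝ} (hω : IsRadialWeight ω)
    (hν : IsRadialWeight ν) (hσ : IntegrableOn (divTail ω ν) (Ico 0 1)) {C : ℝ} (hC : 0 ≤ C)
    (hle : ∀ z : ℂ, ‖z‖ < 1 →
      tail ν ‖z‖ * ∫ ζ in Metric.ball 0 1, ‖bergmanKernel ω z ζ‖ * divTail ω ν ‖ζ‖ ≤ C) :
    BergmanProjBounded ω (tail ν) := by
  have hσw := isRadialWeight_divTail hω hν hσ
  have hpi := Real.pi_pos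
  refine ⟨C.toNNReal, fun f hf => ?_⟩
  set M := (growthNorm (tail ν) f).toReal with hM
  have hM0 : 0 ≤ M := ENNReal.toReal_nonneg
  have hfω := integrable_mul_weight hω hν hσ hf
  have hbd : ∀ z : ℂ, ∀ᵐ ζ ∂diskMeasure,
      ‖f ζ * conj (bergmanKernel ω z ζ) * (ω ‖ζ‖ : ℂ)‖ ≤
        M * (‖bergmanKernel ω z ζ‖ * divTail ω ν ‖ζ‖) := by
    intro z
    filter_upwards [hν.ae_bound_of_mem_growthSpace hf.2, ae_mem_ball_diskMeasure] with ζ hζ hb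
    have hω0 := hω.nonneg ‖ζ‖ ⟨norm_nonneg _, by simpa using hb⟩
    rw [norm_mul, norm_mul, RCLike.norm_conj, Complex.norm_real, Real.norm_of_nonneg hω0]
    calc _ ≤ M / tail ν ‖ζ‖ * ‖bergmanKernel ω z ζ‖ * ω ‖ζ‖ := by gcongr
      _ = _ := by rw [divTail]; ring
  have hint : ∀ z : ℂ, ‖z‖ < 1 →
      Integrable (fun ζ => f ζ * conj (bergmanKernel ω z ζ) * (ω ‖ζ‖ : ℂ)) diskMeasure := by
    intro z hz
    have hk := integrable_diskMeasure_iff.2 (hω.integrableOn_kernel_mul hσw hz)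
    refine (hk.const_mul M).mono' ?_ (hbd z)
    have hB : AEStronglyMeasurable (fun ζ => conj (bergmanKernel ω z ζ)) diskMeasure := by
      refine Complex.continuous_conj.comp_aestronglyMeasurable ?_
      rw [diskMeasure]
      exact ((hω.differentiableOn_bergmanKernel hz).continuousOn.aestronglyMeasurable
        measurableSet_ball).smul_measure _
    refine (hfω.1.mul hB).congr (.of_forall fun ζ => ?_)
    simp only [Pi.mul_apply]
    ring
  have hptwise : ∀ z : ℂ, ‖z‖ < 1 → ‖bergmanProj ω f z‖ * tail ν ‖z‖ ≤ C * M := by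
    intro z hz
    have hk := integrable_diskMeasure_iff.2 (hω.integrableOn_kernel_mul hσw hz)
    have hνz := hν.tail_pos ‖z‖ ⟨norm_nonneg _, hz⟩
    have hP : ‖bergmanProj ω f z‖ ≤
        M * ∫ ζ in Metric.ball 0 1, ‖bergmanKernel ω z ζ‖ * divTail ω ν ‖ζ‖ := by
      refine (norm_integral_le_of_norm_le (hk.const_mul M) (hbd z)).trans ?_
      rw [integral_const_mul, integral_diskMeasure, smul_eq_mul]
      refine mul_le_mul_of_nonneg_left (mul_le_of_le_one_left ?_ ?_) hM0
      · refine setIntegral_nonneg measurableSet_ball fun ζ hζ => ?_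
        exact mul_nonneg (norm_nonneg _) (hσw.nonneg _ ⟨norm_nonneg _, by simpa using hζ⟩)
      · rw [div_le_one hpi]
        linarith [Real.pi_gt_three]
    calc _ ≤ (M * ∫ ζ in Metric.ball 0 1, ‖bergmanKernel ω z ζ‖ * divTail ω ν ‖ζ‖) *
          tail ν ‖z‖ := by gcongr
      _ = M * (tail ν ‖z‖ * ∫ ζ in Metric.ball 0 1,
          ‖bergmanKernel ω z ζ‖ * divTail ω ν ‖ζ‖) := by ring
      _ ≤ M * C := by gcongr; exact hle z hz
      _ = _ := mul_comm _ _
  have hdiff := differentiableOn_bergmanProj hω hfω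
  have hnorm : growthNorm (tail ν) (bergmanProj ω f) ≤
      (C.toNNReal : ℝ≥0∞) * growthNorm (tail ν) f := by
    have h1 : ((C.toNNReal : ℝ≥0∞) * growthNorm (tail ν) f) = ENNReal.ofReal (C * M) := by
      rw [ENNReal.ofReal_mul hC, hM, ENNReal.ofReal_toReal hf.2.ne]
      rfl
    rw [h1, growthNorm, eLpNorm_exponent_top]
    refine eLpNormEssSup_le_of_ae_bound ?_
    filter_upwards [ae_mem_ball_diskMeasure] with z hz
    have hz' : ‖z‖ < 1 := by simpa using hz
    have hνz := hν.tail_pos ‖z‖ ⟨norm_nonneg _, hz'⟩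
    rw [norm_mul, Complex.norm_real, Real.norm_of_nonneg hνz.le]
    exact hptwise z hz'
  refine ⟨fun z hz => hint z (by simpa using hz), ⟨⟨?_, ?_⟩, hdiff⟩, hnorm⟩
  · rw [diskMeasure]
    exact (hdiff.continuousOn.aestronglyMeasurable measurableSet_ball).smul_measure _
  · exact hnorm.trans_lt (ENNReal.mul_lt_top ENNReal.coe_lt_top hf.2)

/-! ### Test functions: necessity. -/

theorem IsRadialWeight.continuousOn_tail_norm {ν : ℝ → ℝ} (h : IsRadialWeight ν) :
    ContinuousOn (fun z : ℂ => tail ν ‖z‖) (Metric.ball 0 1) :=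
  h.continuousOn_tail.comp continuous_norm.continuousOn fun z hz =>
    ⟨norm_nonneg _, by simpa using (mem_ball_zero_iff.1 hz).le⟩

/-- For continuous functions, the weighted essential supremum bounds all values. -/
theorem IsRadialWeight.norm_mul_tail_le_of_growthNorm_le {ν : ℝ → ℝ} (h : IsRadialWeight ν)
    {g : ℂ → ℂ} (hg : ContinuousOn g (Metric.ball 0 1)) {K : ℝ} (hK : 0 ≤ K)
    (hle : growthNorm (tail ν) g ≤ ENNReal.ofReal K) {z : ℂ} (hz : ‖z‖ < 1) :
    ‖g z‖ * tail ν ‖z‖ ≤ K := by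
  have hae : ∀ᵐ ζ ∂volume.restrict (Metric.ball (0 : ℂ) 1), ‖g ζ‖ * tail ν ‖ζ‖ ≤ K := by
    rw [← ae_diskMeasure_iff]
    have h1 : ∀ᵐ ζ ∂diskMeasure, ‖g ζ * (tail ν ‖ζ‖ : ℂ)‖ₑ ≤ growthNorm (tail ν) g := by
      rw [growthNorm, eLpNorm_exponent_top]
      exact enorm_ae_le_eLpNormEssSup _ _
    filter_upwards [h1, ae_mem_ball_diskMeasure] with ζ hζ hb
    have hν := h.tail_pos ‖ζ‖ ⟨norm_nonneg _, by simpa using hb⟩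
    have h2 := ENNReal.toReal_mono ENNReal.ofReal_ne_top (hζ.trans hle)
    rwa [toReal_enorm, norm_mul, Complex.norm_real, Real.norm_of_nonneg hν.le,
      ENNReal.toReal_ofReal hK] at h2
  have hcont : ContinuousOn (fun ζ => ‖g ζ‖ * tail ν ‖ζ‖) (Metric.ball 0 1) :=
    hg.norm.mul h.continuousOn_tail_norm
  -- The set where the bound fails is open by continuity and null, hence empty.
  have hopen := hcont.isOpen_inter_preimage Metric.isOpen_ball (isOpen_Ioi (a := K))
  have hzero : volume (Metric.ball (0 : ℂ) 1 ∩ (fun ζ => ‖g ζ‖ * tail ν ‖ζ‖) ⁻¹' Ioi K) = 0 := by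
    rw [ae_restrict_iff' measurableSet_ball, ae_iff] at hae
    refine measure_mono_null (fun ζ hζ => ?_) hae
    simp only [mem_ofPred_eq, Classical.not_imp, not_le]
    exact ⟨hζ.1, hζ.2⟩
  have hempty := hopen.eq_empty_of_measure_zero hzero
  by_contra! hcon
  have : z ∈ (∅ : Set ℂ) := by
    rw [← hempty]
    exact ⟨by simpa using hz, hcon⟩
  exact this

/-- Source of the test functions: φ = 1 for integrability of ω/ν̂ and φ = arg for the quantitative
conditions. -/
theorem IsRadialWeight.div_tail_mem_growthSpace {ν : ℝ → ℝ} (h : IsRadialWeight ν) {φ : ℂ → ℂ}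
    (hφ : Measurable φ) {c : ℝ} (hc : ∀ z, ‖φ z‖ ≤ c) :
    (fun z => φ z / (tail ν ‖z‖ : ℂ)) ∈ growthSpace (tail ν) ∧
      growthNorm (tail ν) (fun z => φ z / (tail ν ‖z‖ : ℂ)) ≤ ENNReal.ofReal c := by
  have hle : growthNorm (tail ν) (fun z => φ z / (tail ν ‖z‖ : ℂ)) ≤ ENNReal.ofReal c := by
    rw [growthNorm, eLpNorm_exponent_top]
    refine eLpNormEssSup_le_of_ae_bound ?_
    filter_upwards [ae_mem_ball_diskMeasure] with z hz
    have hν := h.tail_pos ‖z‖ ⟨norm_nonneg _, by simpa using hz⟩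
    have hν' : (tail ν ‖z‖ : ℂ) ≠ 0 := by exact_mod_cast hν.ne'
    rw [div_mul_cancel₀ _ hν']
    exact hc z
  refine ⟨⟨?_, hle.trans_lt ENNReal.ofReal_lt_top⟩, hle⟩
  have h1 : AEStronglyMeasurable (fun z : ℂ => (tail ν ‖z‖ : ℂ)) diskMeasure := by
    refine Complex.continuous_ofReal.comp_aestronglyMeasurable ?_
    rw [diskMeasure]
    exact (h.continuousOn_tail_norm.aestronglyMeasurable measurableSet_ball).smul_measure _
  exact (hφ.aemeasurable.div h1.aemeasurable).aestronglyMeasurable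

/-- At z = 0 the kernel is constant, so absolute convergence for f = 1/ν̂ says that rσ(r) is
integrable. The factor r is removed by bounding σ by 2rσ beyond 1/2 and by ω/ν̂(1/2) before. -/
theorem BergmanProjBounded.integrableOn_divTail {ω ν : ℝ → ℝ} (hω : IsRadialWeight ω)
    (hν : IsRadialWeight ν) (h : BergmanProjBounded ω (tail ν)) :
    IntegrableOn (divTail ω ν) (Ico 0 1) := by
  obtain ⟨C, hC⟩ := h
  obtain ⟨hmem, -⟩ := hν.div_tail_mem_growthSpace (φ := fun _ => 1) measurable_const (c := 1)
    (by simp)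
  have h1 := (hC _ hmem).1 0 (by simp)
  have hk : ∀ ζ : ℂ, bergmanKernel ω 0 ζ = kernelCoeff ω 0 := by
    intro ζ
    rw [bergmanKernel_eq, tsum_eq_single 0 fun n hn => by simp [hn]]
    simp
  have hc := hω.kernelCoeff_pos 0
  have h2 : IntegrableOn (fun ζ : ℂ => divTail ω ν ‖ζ‖) (Metric.ball 0 1) := by
    have h3 := (integrable_diskMeasure_iff.1 h1).norm.const_mul (kernelCoeff ω 0)⁻¹
    refine IntegrableOn.congr_fun h3 (fun ζ hζ => ?_) measurableSet_ball
    have hζ' : ‖ζ‖ < 1 := by simpa using hζ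
    have hνζ := hν.tail_pos ‖ζ‖ ⟨norm_nonneg _, hζ'⟩
    have hωζ := hω.nonneg ‖ζ‖ ⟨norm_nonneg _, hζ'⟩
    simp only [hk, norm_mul, norm_div, norm_one, Complex.norm_real, Complex.conj_ofReal]
    rw [Real.norm_of_nonneg hνζ.le, Real.norm_of_nonneg hωζ, Real.norm_of_nonneg hc.le, divTail]
    field_simp
  rw [integrableOn_fun_norm_addHaar] at h2
  simp only [Complex.finrank_real_complex, smul_eq_mul, Nat.add_one_sub_one, pow_one] at h2
  rw [integrableOn_Ico_iff_integrableOn_Ioo]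
  have h4 : IntegrableOn ω (Ioo 0 1) := hω.integrableOn.mono_set Ioo_subset_Ico_self
  have hp := hν.tail_pos (1 / 2) (by norm_num)
  refine ((h2.const_mul 2).add (h4.const_mul (1 / tail ν (1 / 2)))).mono' ?_ ?_
  · have h5 : AEStronglyMeasurable (fun r : ℝ => r⁻¹ * (r * divTail ω ν r))
        (volume.restrict (Ioo 0 1)) :=
      (measurable_inv.aestronglyMeasurable (μ := volume.restrict (Ioo (0 : ℝ) 1))).mul h2.1
    refine h5.congr ((ae_restrict_iff' measurableSet_Ioo).2 (.of_forall fun r hr => ?_))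
    have := hr.1.ne'
    simp only
    field_simp
  · refine (ae_restrict_iff' measurableSet_Ioo).2 (.of_forall fun r hr => ?_)
    have hr' : r ∈ Ico (0 : ℝ) 1 := ⟨hr.1.le, hr.2⟩
    have hσ0 := divTail_nonneg hω hν r hr'
    have hω0 := hω.nonneg r hr'
    have hr0 := hr.1
    rw [Real.norm_of_nonneg hσ0]
    change divTail ω ν r ≤ 2 * (r * divTail ω ν r) + 1 / tail ν (1 / 2) * ω r
    rcases le_or_gt r (1 / 2) with hle | hlt
    · have h5 : divTail ω ν r ≤ 1 / tail ν (1 / 2) * ω r := by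
        rw [divTail, one_div_mul_eq_div]
        gcongr
        exact hν.tail_antitone hr.1.le (by norm_num) hle
      have : 0 ≤ 2 * (r * divTail ω ν r) := by positivity
      linarith
    · have : 0 ≤ 1 / tail ν (1 / 2) * ω r := by positivity
      have h6 : divTail ω ν r ≤ 2 * (r * divTail ω ν r) := by nlinarith
      linarith

theorem integral_mul_exp_neg (n : ℕ) :
    ∫ θ in Ioo (-Real.pi) Real.pi, (θ : ℂ) * Complex.exp (-(n * θ * Complex.I)) =
      2 * Real.pi * Complex.I * (-1) ^ n / n := by
  have hpi := Real.pi_pos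
  rw [← integral_Ioc_eq_integral_Ioo, ← intervalIntegral.integral_of_le (by linarith)]
  -- For n = 0 the integral of θ vanishes, in agreement with the value 0 of division by zero on the
  -- right.
  rcases Nat.eq_zero_or_pos n with rfl | hn
  · simp only [Nat.cast_zero, zero_mul, neg_zero, Complex.exp_zero, mul_one, div_zero]
    rw [intervalIntegral.integral_ofReal, integral_id]
    simp
  have hn' : (n : ℂ) ≠ 0 := by exact_mod_cast hn.ne'
  have hderiv : ∀ θ ∈ uIcc (-Real.pi) Real.pi, HasDerivAt (fun θ : ℝ =>
      (Complex.I * θ / n + 1 / n ^ 2) * Complex.exp (-(n * θ * Complex.I)))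
      ((θ : ℂ) * Complex.exp (-(n * θ * Complex.I))) θ := by
    intro θ _
    have h0 : HasDerivAt (fun θ : ℝ => (θ : ℂ)) 1 θ := Complex.ofRealCLM.hasDerivAt
    have h1 : HasDerivAt (fun θ : ℝ => Complex.I * θ / n + 1 / (n : ℂ) ^ 2)
        (Complex.I * 1 / n) θ := ((h0.const_mul Complex.I).div_const _).add_const _
    have h2 : HasDerivAt (fun θ : ℝ => Complex.exp (-(n * θ * Complex.I)))
        (Complex.exp (-(n * θ * Complex.I)) * (-(n * 1 * Complex.I))) θ :=
      (((h0.const_mul (n : ℂ)).mul_const Complex.I).neg).cexp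
    refine (h1.mul h2).congr_deriv ?_
    field_simp
    linear_combination (-(θ : ℂ) * n) * Complex.I_sq
  rw [intervalIntegral.integral_eq_sub_of_hasDerivAt hderiv
    (Continuous.intervalIntegrable (by fun_prop) _ _)]
  have e1 : Complex.exp (-(n * (Real.pi : ℝ) * Complex.I)) = (-1) ^ n := by
    rw [show -((n : ℂ) * (Real.pi : ℝ) * Complex.I) = n * (-(Real.pi * Complex.I)) by ring,
      Complex.exp_nat_mul, Complex.exp_neg, Complex.exp_pi_mul_I]
    norm_num
  have e2 : Complex.exp (-(n * ((-Real.pi : ℝ) : ℂ) * Complex.I)) = (-1) ^ n := by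
    rw [show -((n : ℂ) * ((-Real.pi : ℝ) : ℂ) * Complex.I) = n * (Real.pi * Complex.I) by
      push_cast; ring, Complex.exp_nat_mul, Complex.exp_pi_mul_I]
  rw [e1, e2]
  push_cast
  field_simp
  ring

/-- The function arg is bounded, yet its Fourier coefficients have the non-summable size 1/n. This
slow decay is what later produces harmonic sums. -/
theorem integral_conj_pow_mul_arg {ω ν : ℝ → ℝ} (hω : IsRadialWeight ω) (hν : IsRadialWeight ν)
    (hσ : IntegrableOn (divTail ω ν) (Ico 0 1)) (n : ℕ) :
    ∫ ζ, conj ζ ^ n * ((Complex.arg ζ : ℂ) / (tail ν ‖ζ‖ : ℂ) * (ω ‖ζ‖ : ℂ)) ∂diskMeasure =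
      2 * Complex.I * (-1) ^ n / n * moment (divTail ω ν) (n + 1) := by
  have hpi := Real.pi_pos
  obtain ⟨hmem, -⟩ := hν.div_tail_mem_growthSpace (φ := fun z => (Complex.arg z : ℂ))
    (by fun_prop) (c := Real.pi) fun z => by
      rw [Complex.norm_real, Real.norm_eq_abs]; exact Complex.abs_arg_le_pi z
  have hint := integrable_mul_weight hω hν hσ hmem
  have hint' : Integrable (fun ζ : ℂ => conj ζ ^ n *
      ((Complex.arg ζ : ℂ) / (tail ν ‖ζ‖ : ℂ) * (ω ‖ζ‖ : ℂ))) diskMeasure := by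
    refine hint.bdd_mul (c := 1) (by fun_prop) ?_
    filter_upwards [ae_mem_ball_diskMeasure] with ζ hζ
    have hζ' : ‖ζ‖ < 1 := by simpa using hζ
    simpa using pow_le_one₀ (norm_nonneg ζ) hζ'.le
  rw [integral_diskMeasure, setIntegral_ball_polar (integrable_diskMeasure_iff.1 hint')]
  have hinner : ∀ r ∈ Ioo (0 : ℝ) 1, (∫ θ in Ioo (-Real.pi) Real.pi, (r : ℂ) *
      (conj (Complex.polarCoord.symm (r, θ)) ^ n *
        ((Complex.arg (Complex.polarCoord.symm (r, θ)) : ℂ) /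
          (tail ν ‖Complex.polarCoord.symm (r, θ)‖ : ℂ) *
            (ω ‖Complex.polarCoord.symm (r, θ)‖ : ℂ)))) =
      ((r ^ (n + 1) * divTail ω ν r : ℝ) : ℂ) * (2 * Real.pi * Complex.I * (-1) ^ n / n) := by
    intro r hr
    rw [← integral_mul_exp_neg, ← integral_const_mul]
    refine setIntegral_congr_fun measurableSet_Ioo fun θ hθ => ?_
    have e1 : Complex.polarCoord.symm (r, θ) = r * Complex.exp (θ * Complex.I) := by
      simp [Complex.exp_mul_I]
    have e2 : ‖Complex.polarCoord.symm (r, θ)‖ = r := by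
      rw [Complex.norm_polarCoord_symm, abs_of_pos hr.1]
    have e3 : Complex.arg (Complex.polarCoord.symm (r, θ)) = θ := by
      rw [e1, Complex.exp_mul_I]
      exact Complex.arg_mul_cos_add_sin_mul_I hr.1 ⟨hθ.1, hθ.2.le⟩
    have e4 : conj (Complex.polarCoord.symm (r, θ)) ^ n =
        r ^ n * Complex.exp (-(n * θ * Complex.I)) := by
      rw [e1, map_mul, Complex.conj_ofReal, ← Complex.exp_conj, mul_pow, ← Complex.exp_nat_mul]
      congr 2
      simp only [map_mul, Complex.conj_ofReal, Complex.conj_I]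
      ring
    simp only [e2, e3, e4, divTail]
    push_cast
    ring
  rw [setIntegral_congr_fun measurableSet_Ioo hinner, integral_mul_const, integral_complex_ofReal,
    ← moment_natCast_add_one, Complex.real_smul]
  have : (Real.pi : ℂ) ≠ 0 := by exact_mod_cast hpi.ne'
  push_cast
  field_simp

/-- Testing the projection on `arg ζ / ν̂(ζ)`. -/
theorem BergmanProjBounded.exists_sum_moment_le {ω ν : ℝ → ℝ} (hω : IsRadialWeight ω)
    (hν : IsRadialWeight ν) (h : BergmanProjBounded ω (tail ν)) :
    ∃ C : ℝ, 0 < C ∧ ∀ r ∈ Ico (0 : ℝ) 1, ∀ s : Finset ℕ,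
      tail ν r * ∑ n ∈ s, moment (divTail ω ν) (n + 1) / moment ω (2 * n + 1) * (r ^ n / n) ≤
        C := by
  have hσ := h.integrableOn_divTail hω hν
  have hσw := isRadialWeight_divTail hω hν hσ
  obtain ⟨C, hC⟩ := h
  have hpi := Real.pi_pos
  obtain ⟨hmem, hnorm⟩ := hν.div_tail_mem_growthSpace (φ := fun z => (Complex.arg z : ℂ))
    (by fun_prop) (c := Real.pi) fun z => by
      rw [Complex.norm_real, Real.norm_eq_abs]; exact Complex.abs_arg_le_pi z
  set f : ℂ → ℂ := fun z => (Complex.arg z : ℂ) / (tail ν ‖z‖ : ℂ) with hf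
  obtain ⟨-, hP, hle⟩ := hC f hmem
  have hle' : growthNorm (tail ν) (bergmanProj ω f) ≤ ENNReal.ofReal (C * Real.pi) := by
    refine hle.trans ?_
    rw [ENNReal.ofReal_mul (NNReal.coe_nonneg C), ENNReal.ofReal_coe_nnreal]
    gcongr
  -- C π bounds the sums since |arg| ≤ π; the added 1 only makes the constant positive.
  refine ⟨C * Real.pi + 1, by positivity, fun r hr s => ?_⟩
  have hr0 := hr.1
  have hz : ‖(-r : ℂ)‖ = r := by
    rw [norm_neg, Complex.norm_real, Real.norm_of_nonneg hr.1]
  have h1 := hν.norm_mul_tail_le_of_growthNorm_le hP.2.continuousOn (by positivity) hle'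
    (z := -r) (by rw [hz]; exact hr.2)
  rw [hz] at h1
  have h2 := hasSum_bergmanProj hω (integrable_mul_weight hω hν hσ hmem) (z := -r)
    (by rw [hz]; exact hr.2)
  have h3 := Complex.hasSum_im h2
  -- At z = -r the sign of (-r)^n cancels the (-1)^n of the Fourier coefficient, so every term is i
  -- times a nonnegative number and partial sums are bounded by the imaginary part of the
  -- projection.
  have hterm : ∀ n : ℕ, ((kernelCoeff ω n : ℂ) *
      (∫ ζ, conj ζ ^ n * (f ζ * (ω ‖ζ‖ : ℂ)) ∂diskMeasure) * (-r : ℂ) ^ n).im =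
      moment (divTail ω ν) (n + 1) / moment ω (2 * n + 1) * (r ^ n / n) := by
    intro n
    rw [integral_conj_pow_mul_arg hω hν hσ, kernelCoeff]
    have hm := (hω.moment_pos n).ne'
    have hm' : (moment ω (2 * n + 1) : ℂ) ≠ 0 := by exact_mod_cast hm
    have e : ((1 / (2 * moment ω (2 * n + 1)) : ℝ) : ℂ) *
        (2 * Complex.I * (-1) ^ n / n * (moment (divTail ω ν) (n + 1) : ℂ)) * (-r : ℂ) ^ n =
        ((moment (divTail ω ν) (n + 1) / moment ω (2 * n + 1) * (r ^ n / n) : ℝ) : ℂ) *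
          Complex.I := by
      have h4 : ((-1 : ℂ) ^ n) * (-r : ℂ) ^ n = r ^ n := by
        rw [← mul_pow]; simp
      push_cast
      calc _ = (1 / (2 * (moment ω (2 * n + 1) : ℂ))) * (2 * Complex.I / n *
            (moment (divTail ω ν) (n + 1) : ℂ)) * ((-1 : ℂ) ^ n * (-r : ℂ) ^ n) := by ring
        _ = _ := by
            rw [h4]
            field_simp
    rw [e, Complex.mul_I_im, Complex.ofReal_re]
  simp only [hterm] at h3
  have hnn : ∀ n : ℕ, 0 ≤ moment (divTail ω ν) (n + 1) / moment ω (2 * n + 1) * (r ^ n / n) := by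
    intro n
    have := hω.moment_pos n
    have := hσw.moment_pos' (x := (n : ℝ) + 1) (by positivity)
    positivity
  have h5 := sum_le_hasSum s (fun n _ => hnn n) h3
  have hνr := hν.tail_pos r hr
  calc _ ≤ tail ν r * ‖bergmanProj ω f (-r)‖ := by
        refine mul_le_mul_of_nonneg_left (h5.trans ?_) hνr.le
        exact (le_abs_self _).trans (Complex.abs_im_le_norm _)
    _ ≤ C * Real.pi := by rwa [mul_comm]
    _ ≤ _ := by linarith

/-- Put x = 1/(1-r) and keep the indices n between x/2 and x. There r^n ≥ e^(-2), ω_{2n+1} ≤ ω_x ≲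
ω̂(r) and σ_{n+1} ≥ σ_x ≳ σ̂(r), and about x such terms have weight 1/n ≥ 1/x. -/
theorem BergmanProjBounded.tailCondition {ω ν : ℝ → ℝ} (hω : UpperDoubling ω)
    (hν : IsRadialWeight ν) (h : BergmanProjBounded ω (tail ν)) : TailCondition ω ν := by
  have hσ := h.integrableOn_divTail hω.1 hν
  have hσw := isRadialWeight_divTail hω.1 hν hσ
  obtain ⟨C, hC, hle⟩ := h.exists_sum_moment_le hω.1 hν
  obtain ⟨D, hD, hd⟩ := hω.exists_moment_le_tail
  have hp := hω.1.tail_pos (7 / 8) (by norm_num)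
  have hν0 := hν.tail_pos 0 (by simp)
  refine ⟨hσ, max (tail ν 0 / tail ω (7 / 8) * tail (divTail ω ν) 0)
    (4 * D * (Real.exp 2 * Real.exp 2) * C), fun r hr => ?_⟩
  change tail ν r / tail ω r * tail (divTail ω ν) r ≤ _
  have hωr := hω.1.tail_pos r hr
  have hσr := hσw.tail_pos r hr
  have hνr := hν.tail_pos r hr
  -- Beyond 7/8 one has x ≥ 8, so that the number of kept indices, at least x/2 - 2, is at least
  -- x/4.
  rcases le_or_gt r (7 / 8) with hr2 | hr2
  · refine le_max_of_le_left ?_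
    gcongr
    · exact hν.tail_antitone le_rfl hr.2.le hr.1
    · exact hω.1.tail_antitone hr.1 (by norm_num) hr2
    · exact hσw.tail_antitone le_rfl hr.2.le hr.1
  · refine le_max_of_le_right ?_
    have h1 : 0 < 1 - r := by linarith [hr.2]
    obtain ⟨x, hx⟩ : ∃ x, x = 1 / (1 - r) := ⟨_, rfl⟩
    have hx8 : 8 ≤ x := by rw [hx, le_div_iff₀ h1]; linarith
    have hxr : 1 - 1 / x = r := by rw [hx]; simp
    have hrx : Real.exp (-2) ≤ r ^ x := by
      rw [← hxr]; exact exp_neg_two_le_one_sub_inv_rpow (by linarith)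
    have e1 := hσw.tail_le_moment (x := x) (by linarith)
    have e2 := hd x (by linarith)
    rw [hxr] at e1 e2
    have hE : Real.exp 2 * Real.exp (-2) = 1 := by rw [← Real.exp_add]; simp
    have hE' := Real.exp_pos (-2)
    have hσx := hσw.moment_pos' (x := x) (by linarith)
    have hterm : ∀ n ∈ Finset.Ico ⌈x / 2⌉₊ ⌊x⌋₊,
        moment (divTail ω ν) x / (D * tail ω r) * (Real.exp (-2) / x) ≤
          moment (divTail ω ν) (n + 1) / moment ω (2 * n + 1) * (r ^ n / n) := by
      intro n hn
      rw [Finset.mem_Ico] at hn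
      have hn1 : x / 2 ≤ n := (Nat.le_ceil _).trans (by exact_mod_cast hn.1)
      have hn2 : (n : ℝ) + 1 ≤ x :=
        le_trans (by exact_mod_cast hn.2) (Nat.floor_le (by linarith))
      have hn0 : (0 : ℝ) < n := by linarith
      have hmω := hω.1.moment_pos n
      have hmσ := hσw.moment_pos' (x := (n : ℝ) + 1) (by linarith)
      have hrn : Real.exp (-2) ≤ r ^ n := by
        refine hrx.trans ?_
        rw [← Real.rpow_natCast]
        exact Real.rpow_le_rpow_of_exponent_ge (by linarith) hr.2.le (by linarith)
      have hω2 : moment ω (2 * n + 1) ≤ D * tail ω r :=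
        (hω.1.moment_antitone (by linarith) (by linarith)).trans e2
      have hσ2 : moment (divTail ω ν) x ≤ moment (divTail ω ν) (n + 1) :=
        hσw.moment_antitone (by linarith) hn2
      gcongr
      linarith
    have hsum := Finset.sum_le_sum hterm
    rw [Finset.sum_const, Nat.card_Ico, nsmul_eq_mul] at hsum
    have hcard : x / 4 ≤ ((⌊x⌋₊ - ⌈x / 2⌉₊ : ℕ) : ℝ) := by
      have h2 := Nat.ceil_lt_add_one (show 0 ≤ x / 2 by linarith)
      have h3 := Nat.lt_floor_add_one x
      have h4 : (⌊x⌋₊ : ℝ) - ⌈x / 2⌉₊ ≤ ((⌊x⌋₊ - ⌈x / 2⌉₊ : ℕ) : ℝ) := by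
        have : ⌊x⌋₊ ≤ (⌊x⌋₊ - ⌈x / 2⌉₊) + ⌈x / 2⌉₊ := by omega
        have h5 : (⌊x⌋₊ : ℝ) ≤ ((⌊x⌋₊ - ⌈x / 2⌉₊ : ℕ) : ℝ) + ⌈x / 2⌉₊ := by exact_mod_cast this
        linarith
      linarith
    have hkey : tail ν r * (x / 4 * (moment (divTail ω ν) x / (D * tail ω r) *
        (Real.exp (-2) / x))) ≤ C := by
      refine le_trans ?_ (hle r hr (Finset.Ico ⌈x / 2⌉₊ ⌊x⌋₊))
      refine mul_le_mul_of_nonneg_left (le_trans ?_ hsum) hνr.le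
      gcongr
    have hx0 : 0 < x := by linarith
    have hkey' : tail ν r * moment (divTail ω ν) x * Real.exp (-2) ≤ 4 * D * C * tail ω r := by
      have e : tail ν r * (x / 4 * (moment (divTail ω ν) x / (D * tail ω r) *
          (Real.exp (-2) / x))) =
          tail ν r * moment (divTail ω ν) x * Real.exp (-2) / (4 * D * tail ω r) := by
        field_simp
      rw [e, div_le_iff₀ (by positivity)] at hkey
      linarith
    rw [div_mul_eq_mul_div, div_le_iff₀ hωr]
    calc tail ν r * tail (divTail ω ν) r
        ≤ tail ν r * (Real.exp 2 * moment (divTail ω ν) x) := by gcongr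
      _ = Real.exp 2 * Real.exp 2 * (tail ν r * moment (divTail ω ν) x * Real.exp (-2)) := by
          linear_combination (-(Real.exp 2) * tail ν r * moment (divTail ω ν) x) * hE
      _ ≤ Real.exp 2 * Real.exp 2 * (4 * D * C * tail ω r) := by gcongr
      _ = _ := by ring

/-- Each of the j dyadic blocks contributes at least 1/2. -/
theorem half_mul_le_sum_one_div {X : ℕ} (hX : 0 < X) (j : ℕ) :
    (j : ℝ) / 2 ≤ ∑ n ∈ Finset.Ico X (2 ^ j * X), 1 / (n : ℝ) := by
  induction j with
  | zero => simp
  | succ j ih =>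
    have h1 : X ≤ 2 ^ j * X := Nat.le_mul_of_pos_left _ (by positivity)
    have h2 : 2 ^ j * X ≤ 2 ^ (j + 1) * X :=
      Nat.mul_le_mul_right _ (Nat.pow_le_pow_right two_pos j.le_succ)
    rw [← Finset.sum_Ico_consecutive _ h1 h2]
    have hY : 0 < 2 ^ j * X := by positivity
    have h3 : ∀ n ∈ Finset.Ico (2 ^ j * X) (2 ^ (j + 1) * X),
        1 / ((2 ^ (j + 1) * X : ℕ) : ℝ) ≤ 1 / (n : ℝ) := by
      intro n hn
      rw [Finset.mem_Ico] at hn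
      have hn0 : (0 : ℝ) < n := by exact_mod_cast hY.trans_le hn.1
      exact one_div_le_one_div_of_le hn0 (by exact_mod_cast hn.2.le)
    have h4 := Finset.sum_le_sum h3
    rw [Finset.sum_const, Nat.card_Ico, nsmul_eq_mul,
      show 2 ^ (j + 1) * X - 2 ^ j * X = 2 ^ j * X by
        rw [show 2 ^ (j + 1) * X = 2 ^ j * X + 2 ^ j * X by ring, Nat.add_sub_cancel]] at h4
    have h5 : ((2 ^ j * X : ℕ) : ℝ) * (1 / ((2 ^ (j + 1) * X : ℕ) : ℝ)) = 1 / 2 := by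
      have : (X : ℝ) ≠ 0 := by exact_mod_cast hX.ne'
      push_cast
      rw [pow_succ]
      field_simp
    rw [h5] at h4
    push_cast
    linarith

/-- With x = 1/(1-r), the test inequality is used at a point r' closer to 1, over j dyadic blocks of
indices n ≥ x. Since ω̂ ≤ ν̂σ̂, each quotient σ_{n+1}/ω_{2n+1} is at least a constant over ν̂(r), so
the harmonic sum gives j ν̂(r') ≲ ν̂(r). -/
theorem BergmanProjBounded.lowerDoubling {ω ν : ℝ → ℝ} (hω : UpperDoubling ω)
    (hν : IsRadialWeight ν) (h : BergmanProjBounded ω (tail ν)) : LowerDoubling ν := by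
  have hσ := h.integrableOn_divTail hω.1 hν
  have hσw := isRadialWeight_divTail hω.1 hν hσ
  obtain ⟨C, hC, hle⟩ := h.exists_sum_moment_le hω.1 hν
  obtain ⟨D, hD, hd⟩ := hω.exists_moment_le_tail
  have hE : Real.exp 2 * Real.exp (-2) = 1 := by rw [← Real.exp_add]; simp
  have hE' := Real.exp_pos (-2)
  -- This j makes the factor gained in the final inequality at least 2. With K = 2^(j+1) the indices
  -- stay below 2^j ⌈x⌉ ≤ Kx = 1/(1-r'), where r'^n ≥ e^(-2).
  obtain ⟨j, hj⟩ := exists_nat_ge (4 * C * D * (Real.exp 2 * Real.exp 2))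
  refine .of_forall hν (K := 2 ^ (j + 1)) (C := 2) (one_lt_pow₀ one_lt_two j.succ_ne_zero)
    one_lt_two one_half_lt_one fun r hr => ?_
  have hr' : r ∈ Ico (0 : ℝ) 1 := ⟨by linarith [hr.1], hr.2⟩
  have h1 : 0 < 1 - r := by linarith [hr.2]
  have hνr := hν.tail_pos r hr'
  obtain ⟨x, hx⟩ : ∃ x, x = 1 / (1 - r) := ⟨_, rfl⟩
  have hx2 : 2 ≤ x := by rw [hx, le_div_iff₀ h1]; linarith [hr.1]
  have hx0 : 0 < x := by linarith
  have hxr : 1 - 1 / x = r := by rw [hx]; simp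
  set L : ℝ := 2 ^ (j + 1) with hL
  have hL1 : 1 ≤ L := one_le_pow₀ one_le_two
  set r' := 1 - (1 - r) / L with hr'def
  have hr'x : 1 - 1 / (L * x) = r' := by rw [hr'def, hx]; field_simp
  have h2 : (1 - r) / L ≤ 1 - r := div_le_self h1.le hL1
  have h3 : 0 < (1 - r) / L := by positivity
  have hrm : r' ∈ Ico (0 : ℝ) 1 := ⟨by linarith [hr'.1], by linarith⟩
  have hνr' := hν.tail_pos r' hrm
  have hLx : 2 ≤ L * x := by nlinarith
  have hrx : Real.exp (-2) ≤ r' ^ (L * x) := by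
    rw [← hr'x]; exact exp_neg_two_le_one_sub_inv_rpow hLx
  set X := ⌈x⌉₊ with hX
  have hX0 : 0 < X := Nat.ceil_pos.2 hx0
  have hXx : x ≤ X := Nat.le_ceil x
  have hXx' : (X : ℝ) ≤ 2 * x := by
    have := Nat.ceil_lt_add_one hx0.le
    linarith
  have hterm : ∀ n ∈ Finset.Ico X (2 ^ j * X),
      Real.exp (-2) * Real.exp (-2) / (D * tail ν r) * (1 / (n : ℝ)) ≤
        moment (divTail ω ν) (n + 1) / moment ω (2 * n + 1) * (r' ^ n / n) := by
    intro n hn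
    rw [Finset.mem_Ico] at hn
    have hn1 : x ≤ n := hXx.trans (by exact_mod_cast hn.1)
    have hn2 : (n : ℝ) ≤ L * x := by
      calc (n : ℝ) ≤ ((2 ^ j * X : ℕ) : ℝ) := by exact_mod_cast hn.2.le
        _ = 2 ^ j * (X : ℝ) := by push_cast; ring
        _ ≤ 2 ^ j * (2 * x) := by gcongr
        _ = L * x := by rw [hL, pow_succ]; ring
    have hn0 : (0 : ℝ) < n := by linarith
    have hrn : Real.exp (-2) ≤ r' ^ n := by
      refine hrx.trans ?_
      rw [← Real.rpow_natCast]
      exact Real.rpow_le_rpow_of_exponent_ge (by linarith [hr'.1, hr.1]) hrm.2.le hn2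
    set t := 1 - 1 / ((n : ℝ) + 1) with ht
    have hi : 1 / ((n : ℝ) + 1) ≤ 1 / x := one_div_le_one_div_of_le hx0 (by linarith)
    have hi0 : 0 < 1 / ((n : ℝ) + 1) := by positivity
    have hrt : r ≤ t := by linarith
    have htm : t ∈ Ico (0 : ℝ) 1 := ⟨by linarith [hr'.1], by linarith⟩
    have hmω := hω.1.moment_pos n
    have e1 := hσw.tail_le_moment (x := (n : ℝ) + 1) (by linarith)
    have e2 := hd ((n : ℝ) + 1) (by linarith)
    have e3 := tail_le_mul_tail_divTail hω.1 hν hσ htm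
    have e4 := hν.tail_antitone hr'.1 htm.2.le hrt
    have e5 : moment ω (2 * n + 1) ≤ moment ω (n + 1) :=
      hω.1.moment_antitone (by linarith) (by linarith)
    have hσt := hσw.tail_pos t htm
    have hmσ := hσw.moment_pos' (x := (n : ℝ) + 1) (by linarith)
    have e6 : moment ω (2 * n + 1) * Real.exp (-2) ≤
        D * tail ν r * moment (divTail ω ν) (n + 1) := by
      calc moment ω (2 * n + 1) * Real.exp (-2)
          ≤ D * (tail ν r * (Real.exp 2 * moment (divTail ω ν) (n + 1))) * Real.exp (-2) := by
            gcongr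
            refine e5.trans (e2.trans ?_)
            gcongr
            exact e3.trans (mul_le_mul e4 e1 hσt.le hνr.le)
        _ = _ := by linear_combination (D * tail ν r * moment (divTail ω ν) (n + 1)) * hE
    have e7 : Real.exp (-2) / (D * tail ν r) ≤
        moment (divTail ω ν) (n + 1) / moment ω (2 * n + 1) := by
      rw [div_le_div_iff₀ (by positivity) hmω]
      linarith
    calc _ = Real.exp (-2) / (D * tail ν r) * (Real.exp (-2) / n) := by ring
      _ ≤ _ := by gcongr
  have hsum := Finset.sum_le_sum hterm
  rw [← Finset.mul_sum] at hsum
  have hhalf := half_mul_le_sum_one_div hX0 j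
  have hkey : tail ν r' * (Real.exp (-2) * Real.exp (-2) / (D * tail ν r) * (j / 2)) ≤ C := by
    refine le_trans ?_ (hle r' hrm (Finset.Ico X (2 ^ j * X)))
    refine mul_le_mul_of_nonneg_left (le_trans ?_ hsum) hνr'.le
    gcongr
  have hkey' : tail ν r' * (Real.exp (-2) * Real.exp (-2)) * j ≤ 2 * C * D * tail ν r := by
    have e : tail ν r' * (Real.exp (-2) * Real.exp (-2) / (D * tail ν r) * (j / 2)) =
        tail ν r' * (Real.exp (-2) * Real.exp (-2)) * j / (2 * D * tail ν r) := by
      field_simp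
    rw [e, div_le_iff₀ (by positivity)] at hkey
    linarith
  have hfin : 2 * C * D * (2 * tail ν r') ≤ 2 * C * D * tail ν r := by
    refine le_trans ?_ hkey'
    calc 2 * C * D * (2 * tail ν r') = tail ν r' * (Real.exp (-2) * Real.exp (-2)) *
          (4 * C * D * (Real.exp 2 * Real.exp 2)) := by
          linear_combination (-(4 * C * D * tail ν r') * (Real.exp 2 * Real.exp (-2) + 1)) * hE
      _ ≤ _ := by gcongr
  exact le_of_mul_le_mul_left hfin (by positivity)

/-! ### The equivalence. -/

theorem mainTheorem2 (ω ν : ℝ → ℝ) (hν : IsRadialWeight ν) (hω : UpperDoubling ω) :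
    List.TFAE [
      BergmanProjBounded ω (tail ν),
      LowerDoubling ν ∧ MomentCondition ω ν,
      LowerDoubling ν ∧ TailCondition ω ν,
      Doubling (divTail ω ν) ∧ Doubling ν] := by
  tfae_have 1 → 3 := fun h => ⟨h.lowerDoubling hω hν, h.tailCondition hω hν⟩
  tfae_have 3 → 4 := fun h =>
    ⟨⟨h.2.upperDoubling_divTail hν hω, h.2.lowerDoubling_divTail hω h.1⟩,
      h.2.upperDoubling hν hω, h.1⟩
  tfae_have 4 → 3 := fun h => ⟨h.2.2, .of_doubling hω.1 h.1.2 h.2.1⟩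
  tfae_have 3 → 2 := fun h => ⟨h.1, h.2.momentCondition hν hω⟩
  tfae_have 2 → 3 := fun h => ⟨h.1, h.2.tailCondition hν hω⟩
  -- The kernel estimate needs ν in both doubling classes; upper doubling of ν comes from the tail
  -- condition.
  tfae_have 2 → 1 := fun h => by
    obtain ⟨C, hC, hle⟩ := exists_tail_mul_integral_kernel_le hω
      ⟨(h.2.tailCondition hν hω).upperDoubling hν hω, h.1⟩ h.2
    exact bergmanProjBounded_of_kernel_estimate hω.1 hν h.2.1 hC hle
  tfae_finish
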